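/- Let $(X,R)$ be a metric space with a Borel measure $\mu$ that is doubling: every ball has positive finite measure and $\mu(B(x,2r))\le C\mu(B(x,r))$ for all $x\in X$, $r>0$. Let $\Delta$ be a non-positive self-adjoint (in general unbounded) operator on $L^2(\mu)$, and let $P$ be the spectral resolution of $-\Delta$. Assume that for every $t>0$ the heat operator $e^{t\Delta}$ (or, alternatively, $e^{t\Delta}$ with its projection onto $\ker\Delta$ subtracted) is given by integration against a measurable real-valued (for instance positive) kernel $h_t(x,y)$, and that there are constants $d>0$, $\gamma>0$, $c_1,c_2>0$ with $$|h_t(x,y)|\le c_1t^{-d/(d+1)}\exp\Bigl(-c_2\Bigl(\frac{R(x,y)^{d+1}}{t}\Bigr)^{\gamma}\Bigr)\qquad\text{for all }t>0,\ x,y\in X.$$ Assume moreover that, for all $x,y$, the function $t\mapsto h_t(x,y)$ extends to a holomorphic function $z\mapsto h_z(x,y)$ on $\{\operatorname{Re}z>0\}$. Let $p:(0,\infty)\to\mathbb C$ be an $S^0$-symbol, that is, $p$ is smooth and for every $k\ge0$ there is $C_k>0$ with $|\lambda^kp^{(k)}(\lambda)|\le C_k$ for all $\lambda>0$, and let $p(-\Delta)=\int_{(0,\infty)}p(\lambda)\,dP(\lambda)$,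 a bounded operator on $L^2(\mu)$. Then $p(-\Delta)$ has a measurable kernel $K(x,y)$ that is smooth off the diagonal of $X\times X$ and satisfies, for all $l,k\ge0$ and all $x\ne y$, $$|K(x,y)|\lesssim R(x,y)^{-d},\qquad |\Delta_x^l\Delta_y^kK(x,y)|\lesssim R(x,y)^{-d-(l+k)(d+1)},$$ with implied constants independent of $x,y$. Here "$p(-\Delta)$ has the kernel $K$" means that, whenever $u\in L^2(\mu)$ vanishes a.e. outside a closed bounded set $A$, then for a.e. $x\notin A$ the integral converges absolutely and $p(-\Delta)u(x)=\int K(x,y)u(y)\,d\mu(y)$. "Smooth off the diagonal" means that there are kernels $S_n$ on $X\times X$, lying in the domain of all powers of $\Delta$ in each variable, such that for all $l,k$ the functions $\Delta_x^l\Delta_y^kS_n$ converge, uniformly on $\{R(x,y)\ge\varepsilon\}$ for every $\varepsilon>0$; the limit is $K$ for $l=k=0$, and it is denoted $\Delta_x^l\Delta_y^kK$ in general. If, in addition, $h_t$ is continuous on $X\times X$ for every $t>0$, then all $\Delta_x^l\Delta_y^kK$ can be taken continuous off the diagonal. -/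

import Mathlib

open MeasureTheory Set Filter Topology
open scoped ContDiff

noncomputable section

/-! ### Projection-valued measures and functions of an unbounded self-adjoint operator -/

/-- A projection-valued Borel measure on `ℝ` acting on the Hilbert space `H`.
(The values of `proj` on non-measurable sets play no role.) -/
structure SpectralMeasure (H : Type*) [NormedAddCommGroup H] [InnerProductSpace ℂ H]
    [CompleteSpace H] where
  proj : Set ℝ → H →L[ℂ] H
  isStarProjection : ∀ s, MeasurableSet s → IsStarProjection (proj s)
  proj_univ : proj univ = 1
  hasSum : ∀ s : ℕ → Set ℝ, (∀ i, MeasurableSet (s i)) →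
    Pairwise (fun i j => Disjoint (s i) (s j)) →
      ∀ u : H, HasSum (fun i => proj (s i) u) (proj (⋃ i, s i) u)

namespace SpectralMeasure

variable {H : Type*} [NormedAddCommGroup H] [InnerProductSpace ℂ H] [CompleteSpace H]

/-- The unit mass at `0`. -/
def diracZero : SpectralMeasure H := by
  classical
  exact
  { proj := fun s => if (0 : ℝ) ∈ s then 1 else 0
    isStarProjection := by
      intro s _
      split_ifs
      · exact IsStarProjection.one _
      · exact IsStarProjection.zero _
    proj_univ := by simp
    hasSum := by
      intro s _ hd u
      by_cases h : ∃ i, (0 : ℝ) ∈ s i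
      · obtain ⟨i, hi⟩ := h
        have hU : (0 : ℝ) ∈ ⋃ j, s j := mem_iUnion.2 ⟨i, hi⟩
        have key := hasSum_single (f := fun j => (if (0 : ℝ) ∈ s j then (1 : H →L[ℂ] H) else 0) u) i
          (by
            intro j hj
            have hn : (0 : ℝ) ∉ s j := fun hj0 => (Set.disjoint_left.1 (hd hj)) hj0 hi
            simp [hn])
        simpa [hU, hi] using key
      · have hU : (0 : ℝ) ∉ ⋃ j, s j := fun h0 => h (mem_iUnion.1 h0)
        have hn : ∀ i, (0 : ℝ) ∉ s i := fun i hi => h ⟨i, hi⟩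
        simp only [hU, hn, if_false]
        simp }

instance : Nonempty (SpectralMeasure H) := ⟨diracZero⟩

theorem proj_empty (P : SpectralMeasure H) : P.proj ∅ = 0 := by
  ext u
  have h := P.hasSum (fun _ => ∅) (fun _ => MeasurableSet.empty)
    (fun _ _ _ => Set.disjoint_empty _) u
  have h0 := h.summable.tendsto_atTop_zero
  simpa using tendsto_nhds_unique tendsto_const_nhds h0

theorem re_inner_proj_nonneg (P : SpectralMeasure H) (u : H) {s : Set ℝ} (hs : MeasurableSet s) :
    0 ≤ (inner ℂ u (P.proj s u)).re := by
  have hp := P.isStarProjection s hs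
  have h1 : P.proj s u = P.proj s (P.proj s u) := by
    conv_lhs => rw [← hp.isIdempotentElem.eq]
    rfl
  have h2 : inner ℂ u (P.proj s u) = inner ℂ (P.proj s u) (P.proj s u) := by
    conv_lhs => rw [h1]
    rw [← ContinuousLinearMap.adjoint_inner_left, hp.isSelfAdjoint.adjoint_eq]
  rw [h2]
  exact inner_self_nonneg (𝕜 := ℂ)

/-- The finite positive measure `s ↦ ⟨u, P(s) u⟩`. -/
def scalar (P : SpectralMeasure H) (u : H) : Measure ℝ :=
  Measure.ofMeasurable (fun s _ => ENNReal.ofReal (inner ℂ u (P.proj s u)).re)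
    (by simp [P.proj_empty])
    (by
      intro f hf hd
      have h := P.hasSum f hf hd u
      have h' : HasSum (fun i => (inner ℂ u (P.proj (f i) u)).re)
          (inner ℂ u (P.proj (⋃ i, f i) u)).re :=
        Complex.hasSum_re (h.mapL (innerSL ℂ u))
      rw [← h'.tsum_eq]
      exact ENNReal.ofReal_tsum_of_nonneg (fun i => P.re_inner_proj_nonneg u (hf i)) h'.summable)

/-- `P` is the spectral resolution of the operator `A`, that is `A = ∫ λ dP(λ)`: the domain of `A`
is `{u | ∫ λ² d⟨P(λ)u,u⟩ < ∞}` and `⟨u, A u⟩ = ∫ λ d⟨P(λ)u,u⟩` there (by polarization this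
determines `A`). -/
def IsResolutionOf (P : SpectralMeasure H) (A : H →ₗ.[ℂ] H) : Prop :=
  (∀ u : H, u ∈ A.domain ↔ Integrable (fun t : ℝ => t ^ 2) (P.scalar u)) ∧
  ∀ u : A.domain, inner ℂ (u : H) (A u) = ∫ t : ℝ, (t : ℂ) ∂(P.scalar u)

/-- The operator `∫ f dP`: the bounded operator `T` with `⟨u, T u⟩ = ∫ f(λ) d⟨P(λ)u,u⟩` for all
`u`. It is unique by polarization, and it exists when `f` is Borel and bounded `P`-almost
everywhere. -/
def integral (P : SpectralMeasure H) (f : ℝ → ℂ) : H →L[ℂ] H :=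
  Classical.epsilon fun T => ∀ u : H, inner ℂ u (T u) = ∫ t : ℝ, f t ∂(P.scalar u)

end SpectralMeasure

/-- The spectral resolution of a self-adjoint operator (existence and uniqueness are the
spectral theorem). -/
def spectralResolution {H : Type*} [NormedAddCommGroup H] [InnerProductSpace ℂ H]
    [CompleteSpace H] (A : H →ₗ.[ℂ] H) : SpectralMeasure H :=
  Classical.epsilon fun P => P.IsResolutionOf A

/-- `p(-Δ) = ∫_{(0,∞)} p(λ) dP(λ)`, where `P` is the spectral resolution of `-Δ`. The null space
of `Δ` does not contribute. -/
def spectralMultiplier {H : Type*} [NormedAddCommGroup H] [InnerProductSpace ℂ H]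
    [CompleteSpace H] (Δ : H →ₗ.[ℂ] H) (p : ℝ → ℂ) : H →L[ℂ] H :=
  (spectralResolution (-Δ)).integral ((Ioi 0).indicator p)

/-- The heat operator `e^{tΔ} = ∫_{[0,∞)} e^{-tλ} dP(λ)`. -/
def heatOperator {H : Type*} [NormedAddCommGroup H] [InnerProductSpace ℂ H]
    [CompleteSpace H] (Δ : H →ₗ.[ℂ] H) (t : ℝ) : H →L[ℂ] H :=
  (spectralResolution (-Δ)).integral
    ((Ici 0).indicator fun s => Complex.exp (-((t : ℂ) * (s : ℂ))))

/-- The heat operator with its component on the null space of `Δ` removed. -/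
def reducedHeatOperator {H : Type*} [NormedAddCommGroup H] [InnerProductSpace ℂ H]
    [CompleteSpace H] (Δ : H →ₗ.[ℂ] H) (t : ℝ) : H →L[ℂ] H :=
  spectralMultiplier Δ fun s => Complex.exp (-((t : ℂ) * (s : ℂ)))

/-! ### Metric measure spaces, heat kernels -/

/-- The doubling condition; as usual, balls are understood to have positive finite measure. -/
def IsDoubling {X : Type*} [MetricSpace X] [MeasurableSpace X] (μ : Measure X) : Prop :=
  (∀ (x : X) (r : ℝ), 0 < r → 0 < μ (Metric.ball x r) ∧ μ (Metric.ball x r) < ⊤) ∧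
  ∃ C : ℝ, 0 < C ∧ ∀ (x : X) (r : ℝ), 0 < r →
    μ (Metric.ball x (2 * r)) ≤ ENNReal.ofReal C * μ (Metric.ball x r)

/-- `Δ` is a non-positive self-adjoint (in general unbounded) operator on `L²(μ)`. -/
def IsNonposSelfAdjoint {X : Type*} [MeasurableSpace X] {μ : Measure X}
    (Δ : Lp ℂ 2 μ →ₗ.[ℂ] Lp ℂ 2 μ) : Prop :=
  IsSelfAdjoint Δ ∧ ∀ u : Δ.domain, (inner ℂ (u : Lp ℂ 2 μ) (Δ u)).re ≤ 0

/-- `T` is integration against the measurable kernel `k`. -/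
def IsIntegralKernel {X : Type*} [MeasurableSpace X] {μ : Measure X}
    (k : X → X → ℂ) (T : Lp ℂ 2 μ →L[ℂ] Lp ℂ 2 μ) : Prop :=
  Measurable (fun q : X × X => k q.1 q.2) ∧
  ∀ u : Lp ℂ 2 μ, ∀ᵐ x ∂μ,
    Integrable (fun y => k x y * u y) μ ∧ T u x = ∫ y, k x y * u y ∂μ

/-- `h z x y`, defined for `Re z > 0`, is the complex heat kernel of `Δ`: for real `t > 0` it is a
real-valued (for example positive) kernel of the heat operator, and `z ↦ h z x y` is holomorphic
in the right half plane. The heat operator is `e^{tΔ}` or, as is customary when `Δ` has a null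
space, `e^{tΔ}` with its projection onto the null space subtracted. -/
def IsHeatKernel {X : Type*} [MeasurableSpace X] {μ : Measure X}
    (Δ : Lp ℂ 2 μ →ₗ.[ℂ] Lp ℂ 2 μ) (h : ℂ → X → X → ℂ) : Prop :=
  ((∀ t : ℝ, 0 < t → IsIntegralKernel (h t) (heatOperator Δ t)) ∨
    (∀ t : ℝ, 0 < t → IsIntegralKernel (h t) (reducedHeatOperator Δ t))) ∧
  (∀ t : ℝ, 0 < t → ∀ x y : X, (h t x y).im = 0) ∧
  ∀ x y : X, DifferentiableOn ℂ (fun z => h z x y) {z | 0 < z.re}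

/-- The sub-Gaussian estimate
`|h_t(x,y)| ≤ c₁ t^{-d/(d+1)} exp (-c₂ (R(x,y)^{d+1} / t)^γ)` for all `t > 0`. -/
def HasSubGaussianBound {X : Type*} [MetricSpace X] (d γ : ℝ) (h : ℂ → X → X → ℂ) : Prop :=
  ∃ c₁ c₂ : ℝ, 0 < c₁ ∧ 0 < c₂ ∧ ∀ t : ℝ, 0 < t → ∀ x y : X,
    ‖h t x y‖ ≤ c₁ * t ^ (-(d / (d + 1))) * Real.exp (-(c₂ * ((dist x y) ^ (d + 1) / t) ^ γ))

/-! ### Symbols and kernels -/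

/-- `p ∈ S⁰`: `p` is smooth on `(0,∞)` and `|λ^k p^{(k)}(λ)| ≤ C_k`. -/
def IsSymbolZero (p : ℝ → ℂ) : Prop :=
  ContDiffOn ℝ ∞ p (Ioi 0) ∧
  ∀ k : ℕ, ∃ C : ℝ, 0 < C ∧ ∀ s : ℝ, 0 < s → ‖((s : ℂ) ^ k) * iteratedDeriv k p s‖ ≤ C

/-- `T` has the kernel `K`, in the sense of singular integrals: `T u (x) = ∫ K(x,y) u(y) dμ(y)`,
with absolute convergence, whenever `u ∈ L²(μ)` has bounded support and `x` is outside this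
support. -/
def IsOffDiagonalKernel {X : Type*} [MetricSpace X] [MeasurableSpace X] {μ : Measure X}
    (K : X → X → ℂ) (T : Lp ℂ 2 μ →L[ℂ] Lp ℂ 2 μ) : Prop :=
  Measurable (fun q : X × X => K q.1 q.2) ∧
  ∀ (u : Lp ℂ 2 μ) (A : Set X), IsClosed A → Bornology.IsBounded A →
    (∀ᵐ y ∂μ, y ∉ A → u y = 0) →
    ∀ᵐ x ∂μ, x ∉ A → Integrable (fun y => K x y * u y) μ ∧ T u x = ∫ y, K x y * u y ∂μ

/-- The functions `f` and `g` are in `L²(μ)`, `f` is in the domain of `Δ`, and `Δ f = g`. -/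
def LaplacianEq {X : Type*} [MeasurableSpace X] {μ : Measure X}
    (Δ : Lp ℂ 2 μ →ₗ.[ℂ] Lp ℂ 2 μ) (f g : X → ℂ) : Prop :=
  ∃ (hf : MemLp f 2 μ) (hg : MemLp g 2 μ), (hf.toLp f, hg.toLp g) ∈ Δ.graph

/-- The function `E 0 0` on `X × X` is smooth (in the domain of all powers of `Δ`) in each
variable, with `Δ_x^l Δ_y^k (E 0 0) = E l k`. -/
def IsSmoothWithLaplacians {X : Type*} [MeasurableSpace X] {μ : Measure X}
    (Δ : Lp ℂ 2 μ →ₗ.[ℂ] Lp ℂ 2 μ) (E : ℕ → ℕ → X → X → ℂ) : Prop :=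
  ∀ l k : ℕ,
    (∀ y : X, LaplacianEq Δ (fun x => E l k x y) (fun x => E (l + 1) k x y)) ∧
    (∀ x : X, LaplacianEq Δ (fun y => E l k x y) (fun y => E l (k + 1) x y))

/-- `K` is smooth off the diagonal, with `Δ_x^l Δ_y^k K = D l k` there: `K` is a limit, uniform at
every positive distance from the diagonal, of kernels that are smooth on all of `X × X`, and for
all `l, k` their `Δ_x^l Δ_y^k` converge in the same sense to `D l k`. (So `Δ_x^l Δ_y^k` off the
diagonal is the closure of the globally defined operator with respect to uniform convergence away
from the diagonal. A local `Δ` can then be moved onto test functions with separated bounded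
supports, so that `D l k` is also the weak `Δ_x^l Δ_y^k K`.) -/
def IsSmoothOffDiagonal {X : Type*} [MetricSpace X] [MeasurableSpace X] {μ : Measure X}
    (Δ : Lp ℂ 2 μ →ₗ.[ℂ] Lp ℂ 2 μ) (K : X → X → ℂ) (D : ℕ → ℕ → X → X → ℂ) : Prop :=
  (∀ x y : X, x ≠ y → D 0 0 x y = K x y) ∧
  ∃ S : ℕ → ℕ → ℕ → X → X → ℂ,
    (∀ n, IsSmoothWithLaplacians Δ (S n)) ∧
    ∀ (l k : ℕ) (ε : ℝ), 0 < ε →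
      TendstoUniformlyOn (fun n (q : X × X) => S n l k q.1 q.2) (fun q => D l k q.1 q.2) atTop
        {q : X × X | ε ≤ dist q.1 q.2}

end

/-! The bounds come from a Littlewood–Paley decomposition matched to the heat semigroup. On `(0, ∞)`
the symbol splits as `p(λ) = ∑ₙ δ(2⁻ⁿλ) p(λ)` with `δ` smooth and supported in `[1/2, 2]`; to the
piece of index `n` belongs the time `t = 2⁻ⁿ`. It suffices to show that for every `N` the kernel of
`λ^L δ(tλ) p(λ)` is `O(t^(-L-d/(d+1)) (R^(d+1)/t)^(-N))`, uniformly in `n`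
(`exists_norm_dyadicKernel_le`). The cases `N = 0` and `N = L + 1` together sum over `n` to
`R^(-(d+1)(L+d/(d+1))) = R^(-d-L(d+1))`, with `L = l + k`, because a Laplacian in either variable
multiplies the symbol by `-λ`.

To bound one piece, write its symbol as `e^{-tλ} m(λ) e^{-tλ}` with `m(λ) = λ^L δ(tλ) p(λ) e^{2tλ}`.
An operator `T` between two heat operators has the kernel `∫ h_t(x,·) T h_t(·,y)` (`sandwich`),
defined at every pair of points and, for almost all of them, bounded by `‖T‖ c₁ (2t)^(-d/(d+1))`,
since almost all rows of `h_t` have `L²` norm at most the square root of `c₁ (2t)^(-d/(d+1))`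
(`norm_row_le`, `norm_sandwich_le`). This does not see the distance of `x` and `y`. Decay comes from
expanding `m` in heat operators at real times. With `v = e^{-tλ}` and `cos θ = 2v - 1`, the Fourier
series in `θ` gives `m = t^(-L) ∑ⱼ cⱼ v T_|j|(2v - 1)` with Chebyshev polynomials. The symbol class
is invariant under scaling, so the `cⱼ` decay faster than any power of `j`, uniformly in `t`
(`exists_chebyshev_series`).

The sandwiched `v T_m(2v - 1)` is a combination of heat kernels at times between `3t` and `(m+3)t`,
with coefficients of total size at most `7^m`. Its kernel is therefore at most `7^m exp(-c₂
(R^(d+1)/((m+3)t))^γ)` up to the on-diagonal factor, and also at most a multiple of that factor,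
because `|T_m| ≤ 1` on `[-1, 1]`. The smaller of the two bounds is polynomial in `m` times
`(R^(d+1)/t)^(-N)` (`exists_min_pow_mul_exp_le`), and the decay of `cⱼ` absorbs the polynomial.

Two foundations are needed. `spectralResolution` and `SpectralMeasure.integral` are picked by
choice, so the spectral theorem (through the resolvent `(1 + A)⁻¹`) and the bounded Borel functional
calculus have to be established. Also, the heat kernel is determined only up to null sets, while the
conclusion speaks of all points off the diagonal; the kernels are therefore cut off to a conull set
of good pairs whose sections are empty or conull, and which is everything when the heat kernel is
continuous. -/

noncomputable section

/-! ### Polarization, and operators determined by quadratic forms. -/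

section QuadraticForms

variable {H : Type*} [NormedAddCommGroup H] [InnerProductSpace ℂ H]

/-- The sesquilinear form obtained by polarizing a quadratic form. -/
def polarForm {V : Type*} [AddCommGroup V] [Module ℂ V] (Q : V → ℂ) (x y : V) : ℂ :=
  (Q (x + y) - Q (x - y) - Complex.I * Q (x + Complex.I • y)
    + Complex.I * Q (x - Complex.I • y)) / 4

/-- The separate map `ι` lets `T` be an unbounded operator, with `ι` the inclusion of its domain. -/
theorem inner_map_eq_polarForm {V : Type*} [AddCommGroup V] [Module ℂ V] (ι T : V →ₗ[ℂ] H)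
    (x y : V) : inner ℂ (ι x) (T y) = polarForm (fun u => inner ℂ (ι u) (T u)) x y := by
  simp only [polarForm, map_add, map_sub, map_smul, inner_add_left, inner_add_right,
    inner_sub_left, inner_sub_right, inner_smul_left, inner_smul_right, Complex.conj_I]
  ring_nf
  simp only [Complex.I_sq]
  ring

theorem inner_eq_polarForm (T : H →ₗ[ℂ] H) (x y : H) :
    inner ℂ x (T y) = polarForm (fun u => inner ℂ u (T u)) x y :=
  inner_map_eq_polarForm LinearMap.id T x y

theorem polarForm_tendsto {V : Type*} [AddCommGroup V] [Module ℂ V] {ι : Type*} {l : Filter ι}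
    {Q : ι → V → ℂ} {Q' : V → ℂ}
    (h : ∀ u, Tendsto (fun n => Q n u) l (𝓝 (Q' u))) (x y : V) :
    Tendsto (fun n => polarForm (Q n) x y) l (𝓝 (polarForm Q' x y)) := by
  unfold polarForm
  exact (((((h _).sub (h _)).sub ((h _).const_mul _)).add ((h _).const_mul _)).div_const _)

theorem ext_inner_quadratic {S T : H →L[ℂ] H}
    (h : ∀ u, inner ℂ u (S u) = inner ℂ u (T u)) : S = T := by
  ext y
  refine ext_inner_left ℂ fun x => ?_
  have h1 := inner_eq_polarForm (S : H →ₗ[ℂ] H) x y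
  have h2 := inner_eq_polarForm (T : H →ₗ[ℂ] H) x y
  simp only [ContinuousLinearMap.coe_coe] at h1 h2
  rw [h1, h2]
  simp [h]

theorem norm_inner_le_of_quadratic {T : H →ₗ[ℂ] H} {C : ℝ}
    (h : ∀ u, ‖inner ℂ u (T u)‖ ≤ C * ‖u‖ ^ 2) (x y : H) :
    ‖inner ℂ x (T y)‖ ≤ C * (‖x‖ ^ 2 + ‖y‖ ^ 2) := by
  rw [inner_eq_polarForm]
  unfold polarForm
  have e1 := parallelogram_law_with_norm ℂ x y
  have e2 := parallelogram_law_with_norm ℂ x (Complex.I • y)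
  have e3 : ‖Complex.I • y‖ = ‖y‖ := by simp [norm_smul]
  rw [e3] at e2
  have a1 := h (x + y)
  have a2 := h (x - y)
  have a3 := h (x + Complex.I • y)
  have a4 := h (x - Complex.I • y)
  rw [norm_div]
  have t : ∀ a b c d : ℂ, ‖a - b - Complex.I * c + Complex.I * d‖ ≤ ‖a‖ + ‖b‖ + ‖c‖ + ‖d‖ := by
    intro a b c d
    refine (norm_add_le _ _).trans ?_
    have := norm_sub_le (a - b) (Complex.I * c)
    have := norm_sub_le a b
    simp only [norm_mul, Complex.norm_I, one_mul] at *
    linarith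
  have := t (inner ℂ (x + y) (T (x + y))) (inner ℂ (x - y) (T (x - y)))
    (inner ℂ (x + Complex.I • y) (T (x + Complex.I • y)))
    (inner ℂ (x - Complex.I • y) (T (x - Complex.I • y)))
  have h4 : ‖(4 : ℂ)‖ = 4 := by norm_num
  rw [h4, div_le_iff₀ (by norm_num)]
  refine this.trans ?_
  have : C * (‖x + y‖ ^ 2 + ‖x - y‖ ^ 2)
      + C * (‖x + Complex.I • y‖ ^ 2 + ‖x - Complex.I • y‖ ^ 2) = C * (‖x‖ ^ 2 + ‖y‖ ^ 2) * 4 := by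
    rw [e1, e2]; ring
  nlinarith

theorem norm_apply_le_of_quadratic {T : H →ₗ[ℂ] H} {C : ℝ}
    (h : ∀ u, ‖inner ℂ u (T u)‖ ≤ C * ‖u‖ ^ 2) (y : H) : ‖T y‖ ≤ 2 * C * ‖y‖ := by
  rcases eq_or_ne (T y) 0 with h0 | h0
  · rw [h0, norm_zero]
    rcases eq_or_ne y 0 with rfl | hy
    · simp
    · have := (norm_nonneg _).trans (h y)
      have h2 : 0 < ‖y‖ ^ 2 := by positivity
      have : 0 ≤ C := by
        by_contra hc
        nlinarith
      positivity
  · have hT : 0 < ‖T y‖ := norm_pos_iff.2 h0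
    have hy : 0 < ‖y‖ := by
      rw [norm_pos_iff]; rintro rfl; simp at h0
    -- The test vector is scaled to have the norm of `y`, so that `C (‖x‖² + ‖y‖²)` becomes `2 C
    -- ‖y‖²`.
    have key := norm_inner_le_of_quadratic h (((‖y‖ / ‖T y‖ : ℝ) : ℂ) • T y) y
    rw [inner_smul_left, inner_self_eq_norm_sq_to_K, norm_smul, norm_mul] at key
    simp only [Complex.norm_conj, Complex.norm_real, norm_div, norm_norm, norm_pow,
      Complex.coe_algebraMap] at key
    rw [div_mul_cancel₀ _ hT.ne'] at key
    have e : ‖y‖ / ‖T y‖ * ‖T y‖ ^ 2 = ‖y‖ * ‖T y‖ := by field_simp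
    have : ‖y‖ * ‖T y‖ ≤ ‖y‖ * (2 * C * ‖y‖) := by
      rw [← e]
      refine le_trans ?_ (key.trans (le_of_eq (by ring)))
      simp
    exact le_of_mul_le_mul_left this hy

/-- By polarization the limits exist for the whole sesquilinear form, which is bounded by `2C`, and
the Riesz representation produces the operator. All operators of the functional calculus outside the
span of the projections arise in this way. -/
theorem exists_inner_eq_of_tendsto [CompleteSpace H] {T : ℕ → H →L[ℂ] H} {C : ℝ}
    (hT : ∀ n u, ‖inner ℂ u (T n u)‖ ≤ C * ‖u‖ ^ 2) {Q : H → ℂ}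
    (hQ : ∀ u, Tendsto (fun n => inner ℂ u (T n u)) atTop (𝓝 (Q u))) :
    ∃ S : H →L[ℂ] H, ∀ u, inner ℂ u (S u) = Q u := by
  have lim : ∀ x y, Tendsto (fun n => inner ℂ x (T n y)) atTop (𝓝 (polarForm Q x y)) := by
    intro x y
    have := polarForm_tendsto hQ x y
    refine this.congr fun n => ?_
    exact (inner_eq_polarForm (T n : H →ₗ[ℂ] H) x y).symm
  let B : H →ₗ⋆[ℂ] H →ₗ[ℂ] ℂ := LinearMap.mk₂'ₛₗ (starRingEnd ℂ) (RingHom.id ℂ) (polarForm Q)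
    (fun x x' y => tendsto_nhds_unique (lim _ _)
      (by simpa [inner_add_left] using (lim x y).add (lim x' y)))
    (fun c x y => tendsto_nhds_unique (lim _ _)
      (by simpa [inner_smul_left, mul_comm] using (lim x y).const_mul (starRingEnd ℂ c)))
    (fun x y y' => tendsto_nhds_unique (lim _ _)
      (by simpa [inner_add_right] using (lim x y).add (lim x y')))
    (fun c x y => tendsto_nhds_unique (lim _ _)
      (by simpa [inner_smul_right] using (lim x y).const_mul c))
  have bound : ∀ x y, ‖B x y‖ ≤ 2 * C * ‖x‖ * ‖y‖ := by
    intro x y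
    refine le_of_tendsto (lim x y).norm (Eventually.of_forall fun n => ?_)
    have h1 := norm_apply_le_of_quadratic (T := (T n : H →ₗ[ℂ] H)) (hT n) y
    have h2 := norm_inner_le_norm (𝕜 := ℂ) x (T n y)
    have h3 := mul_le_mul_of_nonneg_left h1 (norm_nonneg x)
    simp only [ContinuousLinearMap.coe_coe] at h3
    linarith
  let B' := B.mkContinuous₂ (2 * C) bound
  -- The operator attached to a bilinear form acts on the left entry of the inner product; the
  -- adjoint moves it to the right.
  refine ⟨ContinuousLinearMap.adjoint (InnerProductSpace.continuousLinearMapOfBilin B'), fun u => ?_⟩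
  rw [ContinuousLinearMap.adjoint_inner_right, InnerProductSpace.continuousLinearMapOfBilin_apply]
  have : polarForm Q u u = Q u := tendsto_nhds_unique (lim u u) (hQ u)
  exact this

end QuadraticForms

/-! ### Bounded Borel functions and bounded pointwise limits. -/

section BoundedMeasurable

/-- Bounded Borel functions on the line. -/
def BddMeas (f : ℝ → ℂ) : Prop := Measurable f ∧ ∃ C : ℝ, ∀ x, ‖f x‖ ≤ C

namespace BddMeas

variable {f g : ℝ → ℂ}

theorem add (hf : BddMeas f) (hg : BddMeas g) : BddMeas (f + g) := by
  obtain ⟨mf, C, hC⟩ := hf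
  obtain ⟨mg, C', hC'⟩ := hg
  exact ⟨mf.add mg, C + C', fun x => (norm_add_le _ _).trans (add_le_add (hC x) (hC' x))⟩

theorem mul (hf : BddMeas f) (hg : BddMeas g) : BddMeas (f * g) := by
  obtain ⟨mf, C, hC⟩ := hf
  obtain ⟨mg, C', hC'⟩ := hg
  exact ⟨mf.mul mg, C * C', fun x => by
    rw [Pi.mul_apply, norm_mul]
    exact mul_le_mul (hC x) (hC' x) (norm_nonneg _) ((norm_nonneg _).trans (hC x))⟩

theorem smul (c : ℂ) (hf : BddMeas f) : BddMeas (c • f) := by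
  obtain ⟨mf, C, hC⟩ := hf
  exact ⟨mf.const_smul c, ‖c‖ * C, fun x => by
    rw [Pi.smul_apply, norm_smul]
    exact mul_le_mul_of_nonneg_left (hC x) (norm_nonneg _)⟩

theorem star (hf : BddMeas f) : BddMeas (star f) := by
  obtain ⟨mf, C, hC⟩ := hf
  exact ⟨Complex.continuous_conj.measurable.comp mf, C, fun x => by simpa using hC x⟩

theorem indicator (hf : BddMeas f) {s : Set ℝ} (hs : MeasurableSet s) :
    BddMeas (s.indicator f) := by
  obtain ⟨mf, C, hC⟩ := hf
  exact ⟨mf.indicator hs, C, fun x => (norm_indicator_le_norm_self _ _).trans (hC x)⟩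

theorem one : BddMeas 1 := ⟨measurable_one, 1, fun x => by simp⟩

theorem integrable (hf : BddMeas f) (μ : Measure ℝ) [IsFiniteMeasure μ] : Integrable f μ := by
  obtain ⟨mf, C, hC⟩ := hf
  exact Integrable.of_bound mf.aestronglyMeasurable C (Eventually.of_forall hC)

/-- Simple functions truncated at a bound of `f` converge to `f` boundedly and pointwise. Closure
under such limits is all that is asked, since dominated convergence turns them into weak limits of
operators. -/
theorem induction {p : (ℝ → ℂ) → Prop}
    (indicator : ∀ s, MeasurableSet s → p (s.indicator 1))
    (smul : ∀ (c : ℂ) f, BddMeas f → p f → p (c • f))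
    (add : ∀ f g, BddMeas f → BddMeas g → p f → p g → p (f + g))
    (lim : ∀ (F : ℕ → ℝ → ℂ) (f : ℝ → ℂ) (C : ℝ), (∀ n, Measurable (F n)) →
      (∀ n x, ‖F n x‖ ≤ C) → (∀ x, Tendsto (fun n => F n x) atTop (𝓝 (f x))) →
      (∀ n, p (F n)) → p f) (hf : BddMeas f) : p f := by
  obtain ⟨mf, C, hC⟩ := hf
  have hC0 : 0 ≤ C := (norm_nonneg _).trans (hC 0)
  have simple : ∀ φ : SimpleFunc ℝ ℂ, BddMeas φ ∧ p φ := by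
    intro φ
    induction φ using SimpleFunc.induction with
    | const c hs =>
      rename_i s
      have e : ((SimpleFunc.piecewise s hs (SimpleFunc.const ℝ c) (SimpleFunc.const ℝ 0) :
          SimpleFunc ℝ ℂ) : ℝ → ℂ) = c • s.indicator 1 := by
        ext x
        by_cases hx : x ∈ s <;> simp [hx]
      rw [e]
      exact ⟨(one.indicator hs).smul c, smul c _ (one.indicator hs) (indicator s hs)⟩
    | add _ hf hg =>
      rw [SimpleFunc.coe_add]
      exact ⟨hf.1.add hg.1, add _ _ hf.1 hg.1 hf.2 hg.2⟩
  have sm : StronglyMeasurable f := mf.stronglyMeasurable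
  exact lim (fun n => sm.approxBounded C n) f C (fun n => SimpleFunc.measurable _)
    (fun n x => sm.norm_approxBounded_le hC0 n x)
    (fun x => sm.tendsto_approxBounded_of_norm_le (hC x)) (fun n => (simple _).2)

end BddMeas

variable {H : Type*} [NormedAddCommGroup H] [InnerProductSpace ℂ H]

/-- The total mass `‖u‖²` bounds all the quadratic forms by `C ‖u‖²`, and dominated convergence
identifies their limit. -/
theorem exists_inner_eq_integral_of_tendsto [CompleteSpace H] {m : H → Measure ℝ}
    (hm : ∀ u, m u univ = ENNReal.ofReal (‖u‖ ^ 2)) {F : ℕ → ℝ → ℂ} {f : ℝ → ℂ} {C : ℝ}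
    (mF : ∀ n, Measurable (F n)) (hC : ∀ n x, ‖F n x‖ ≤ C)
    (hF : ∀ x, Tendsto (fun n => F n x) atTop (𝓝 (f x)))
    (h : ∀ n, ∃ T : H →L[ℂ] H, ∀ u, inner ℂ u (T u) = ∫ t, F n t ∂(m u)) :
    ∃ T : H →L[ℂ] H, ∀ u, inner ℂ u (T u) = ∫ t, f t ∂(m u) := by
  have fin : ∀ u, IsFiniteMeasure (m u) := fun u => ⟨by rw [hm]; exact ENNReal.ofReal_lt_top⟩
  choose T hT using h
  refine exists_inner_eq_of_tendsto (T := T) (C := C) (fun n u => ?_) fun u => ?_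
  · rw [hT]
    refine (norm_integral_le_of_norm_le_const (Eventually.of_forall (hC n))).trans ?_
    rw [measureReal_def, hm, ENNReal.toReal_ofReal (by positivity)]
  · simp_rw [hT]
    exact tendsto_integral_of_dominated_convergence (fun _ => C)
      (fun n => (mF n).aestronglyMeasurable) (integrable_const _)
      (fun n => Eventually.of_forall (hC n)) (Eventually.of_forall hF)

theorem tendsto_inner_of_inner_eq_integral {m : H → Measure ℝ}
    (hm : ∀ u, m u univ = ENNReal.ofReal (‖u‖ ^ 2)) {F : ℕ → ℝ → ℂ} {f : ℝ → ℂ} {C : ℝ}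
    (mF : ∀ n, Measurable (F n)) (hC : ∀ n x, ‖F n x‖ ≤ C)
    (hF : ∀ x, Tendsto (fun n => F n x) atTop (𝓝 (f x)))
    {T : ℕ → H →L[ℂ] H} (hT : ∀ n u, inner ℂ u (T n u) = ∫ t, F n t ∂(m u))
    {S : H →L[ℂ] H} (hS : ∀ u, inner ℂ u (S u) = ∫ t, f t ∂(m u)) (u v : H) :
    Tendsto (fun n => inner ℂ u (T n v)) atTop (𝓝 (inner ℂ u (S v))) := by
  have fin : ∀ u, IsFiniteMeasure (m u) := fun u => ⟨by rw [hm]; exact ENNReal.ofReal_lt_top⟩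
  have h1 := inner_eq_polarForm (S : H →ₗ[ℂ] H) u v
  simp only [ContinuousLinearMap.coe_coe] at h1
  rw [h1]
  have := polarForm_tendsto (Q := fun n u => inner ℂ u (T n u))
    (Q' := fun u => inner ℂ u (S u)) (l := atTop) (fun w => by
      simp_rw [hT, hS]
      exact tendsto_integral_of_dominated_convergence (fun _ => C)
        (fun n => (mF n).aestronglyMeasurable) (integrable_const _)
        (fun n => Eventually.of_forall (hC n)) (Eventually.of_forall hF)) u v
  refine this.congr fun n => ?_
  exact (inner_eq_polarForm (T n : H →ₗ[ℂ] H) u v).symm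

end BoundedMeasurable

/-! ### The functional calculus of a projection-valued measure. -/

namespace SpectralMeasure

variable {H : Type*} [NormedAddCommGroup H] [InnerProductSpace ℂ H] [CompleteSpace H]
  (P : SpectralMeasure H)

theorem scalar_apply (u : H) {s : Set ℝ} (hs : MeasurableSet s) :
    P.scalar u s = ENNReal.ofReal (inner ℂ u (P.proj s u)).re :=
  Measure.ofMeasurable_apply s hs

theorem scalar_univ (u : H) : P.scalar u univ = ENNReal.ofReal (‖u‖ ^ 2) := by
  rw [P.scalar_apply u MeasurableSet.univ, P.proj_univ, one_apply_eq_self]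
  congr 1
  exact inner_self_eq_norm_sq (𝕜 := ℂ) u

instance (u : H) : IsFiniteMeasure (P.scalar u) :=
  ⟨by rw [scalar_univ]; exact ENNReal.ofReal_lt_top⟩

theorem inner_proj (u : H) {s : Set ℝ} (hs : MeasurableSet s) :
    inner ℂ u (P.proj s u) = (P.scalar u).real s := by
  rw [measureReal_def, P.scalar_apply u hs, ENNReal.toReal_ofReal (P.re_inner_proj_nonneg u hs)]
  have h := (P.isStarProjection s hs).isSelfAdjoint
  have : (starRingEnd ℂ) (inner ℂ u (P.proj s u)) = inner ℂ u (P.proj s u) := by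
    rw [inner_conj_symm, ← ContinuousLinearMap.adjoint_inner_right, h.adjoint_eq]
  exact (Complex.conj_eq_iff_re.1 this).symm

theorem integral_indicator_one (u : H) {s : Set ℝ} (hs : MeasurableSet s) :
    ∫ t, s.indicator (1 : ℝ → ℂ) t ∂(P.scalar u) = inner ℂ u (P.proj s u) := by
  rw [P.inner_proj u hs, MeasureTheory.integral_indicator hs]
  simp

theorem exists_integral {f : ℝ → ℂ} (hf : BddMeas f) :
    ∃ T : H →L[ℂ] H, ∀ u, inner ℂ u (T u) = ∫ t, f t ∂(P.scalar u) := by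
  refine hf.induction (fun s hs => ⟨P.proj s, fun u => (P.integral_indicator_one u hs).symm⟩) ?_ ?_
    fun F f C mF hC hF h => exists_inner_eq_integral_of_tendsto P.scalar_univ mF hC hF h
  · rintro c f _ ⟨T, hT⟩
    exact ⟨c • T, fun u => by simp [hT, integral_const_mul]⟩
  · rintro f g hf hg ⟨T, hT⟩ ⟨S, hS⟩
    exact ⟨T + S, fun u => by
      simp [hT, hS, integral_add (hf.integrable _) (hg.integrable _)]⟩

theorem inner_integral {f : ℝ → ℂ} (hf : BddMeas f) (u : H) :
    inner ℂ u (P.integral f u) = ∫ t, f t ∂(P.scalar u) :=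
  Classical.epsilon_spec (P.exists_integral hf) u

theorem integral_eq_of_inner {f : ℝ → ℂ} {T : H →L[ℂ] H} (hf : BddMeas f)
    (h : ∀ u, inner ℂ u (T u) = ∫ t, f t ∂(P.scalar u)) : P.integral f = T :=
  ext_inner_quadratic fun u => by rw [P.inner_integral hf, h]

theorem integral_indicator {s : Set ℝ} (hs : MeasurableSet s) :
    P.integral (s.indicator 1) = P.proj s :=
  P.integral_eq_of_inner (BddMeas.one.indicator hs) fun u => (P.integral_indicator_one u hs).symm

theorem integral_one : P.integral 1 = 1 := by
  rw [← P.proj_univ, ← P.integral_indicator MeasurableSet.univ, indicator_univ]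

theorem integral_smul {f : ℝ → ℂ} (c : ℂ) (hf : BddMeas f) :
    P.integral (c • f) = c • P.integral f :=
  P.integral_eq_of_inner (hf.smul c) fun u => by
    simp [P.inner_integral hf, integral_const_mul]

theorem integral_add {f g : ℝ → ℂ} (hf : BddMeas f) (hg : BddMeas g) :
    P.integral (f + g) = P.integral f + P.integral g :=
  P.integral_eq_of_inner (hf.add hg) fun u => by
    simp [P.inner_integral hf, P.inner_integral hg,
      MeasureTheory.integral_add (hf.integrable _) (hg.integrable _)]

theorem integral_star {f : ℝ → ℂ} (hf : BddMeas f) :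
    P.integral (star f) = ContinuousLinearMap.adjoint (P.integral f) :=
  P.integral_eq_of_inner hf.star fun u => by
    rw [ContinuousLinearMap.adjoint_inner_right, ← inner_conj_symm, P.inner_integral hf,
      ← integral_conj]
    rfl

theorem tendsto_inner_integral {F : ℕ → ℝ → ℂ} {f : ℝ → ℂ} {C : ℝ}
    (mF : ∀ n, Measurable (F n)) (hC : ∀ n x, ‖F n x‖ ≤ C)
    (hF : ∀ x, Tendsto (fun n => F n x) atTop (𝓝 (f x))) (u v : H) :
    Tendsto (fun n => inner ℂ u (P.integral (F n) v)) atTop (𝓝 (inner ℂ u (P.integral f v))) := by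
  have mf : Measurable f := measurable_of_tendsto_metrizable mF (tendsto_pi_nhds.2 hF)
  have hf : BddMeas f := ⟨mf, C, fun x => le_of_tendsto (hF x).norm (Eventually.of_forall fun n => hC n x)⟩
  exact tendsto_inner_of_inner_eq_integral P.scalar_univ mF hC hF
    (fun n => P.inner_integral ⟨mF n, C, hC n⟩) (P.inner_integral hf) u v

theorem proj_union {s t : Set ℝ} (hs : MeasurableSet s) (ht : MeasurableSet t)
    (h : Disjoint s t) : P.proj (s ∪ t) = P.proj s + P.proj t := by
  rw [← P.integral_indicator (hs.union ht), ← P.integral_indicator hs, ← P.integral_indicator ht,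
    ← P.integral_add (BddMeas.one.indicator hs) (BddMeas.one.indicator ht),
    indicator_union_of_disjoint h]
  rfl

/-- Write `p`, `q` for the two projections. Since `p + q` is idempotent, `pq + qp = 0`.
Multiplication by `p` from the left and from the right gives `pq = -pqp = qp`, hence `2pq = 0`. -/
theorem proj_mul_of_disjoint {s t : Set ℝ} (hs : MeasurableSet s) (ht : MeasurableSet t)
    (h : Disjoint s t) : P.proj s * P.proj t = 0 := by
  have e := (P.isStarProjection _ (hs.union ht)).isIdempotentElem.eq
  have es := (P.isStarProjection _ hs).isIdempotentElem.eq
  have et := (P.isStarProjection _ ht).isIdempotentElem.eq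
  rw [P.proj_union hs ht h] at e
  set p := P.proj s
  set q := P.proj t
  have e1 : p * q + q * p = 0 := by
    have : (p + q) * (p + q) = p * p + (p * q + q * p) + q * q := by noncomm_ring
    rw [this, es, et] at e
    have e' : (p + q) + (p * q + q * p) = (p + q) + 0 := by
      rw [add_zero]
      exact (by abel : (p + q) + (p * q + q * p) = p + (p * q + q * p) + q).trans e
    exact add_left_cancel e'
  have e2 : p * q = -(p * q * p) := by
    have : p * (p * q + q * p) = 0 := by rw [e1, mul_zero]
    rw [mul_add, ← mul_assoc, es, ← mul_assoc] at this
    exact eq_neg_of_add_eq_zero_left this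
  have e3 : q * p = -(p * q * p) := by
    have : (p * q + q * p) * p = 0 := by rw [e1, zero_mul]
    rw [add_mul, mul_assoc q, es] at this
    exact eq_neg_of_add_eq_zero_right this
  have e4 : (2 : ℂ) • (p * q) = 0 := by
    rw [two_smul]
    nth_rewrite 2 [e2]
    rw [← e3, e1]
  simpa using e4

theorem proj_mul {s t : Set ℝ} (hs : MeasurableSet s) (ht : MeasurableSet t) :
    P.proj s * P.proj t = P.proj (s ∩ t) := by
  have e1 : P.proj s = P.proj (s ∩ t) + P.proj (s \ t) := by
    rw [← P.proj_union (hs.inter ht) (hs.diff ht) disjoint_inf_sdiff, inter_union_sdiff]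
  have e2 : P.proj t = P.proj (s ∩ t) + P.proj (t \ s) := by
    rw [inter_comm, ← P.proj_union (ht.inter hs) (ht.diff hs) disjoint_inf_sdiff, inter_union_sdiff]
  rw [e1]
  nth_rewrite 1 [e2]
  rw [add_mul, mul_add, mul_add, (P.isStarProjection _ (hs.inter ht)).isIdempotentElem.eq,
    P.proj_mul_of_disjoint (hs.inter ht) (ht.diff hs) (by
      exact disjoint_sdiff_right.mono_left inter_subset_left),
    P.proj_mul_of_disjoint (hs.diff ht) (hs.inter ht) (by
      exact disjoint_sdiff_left.mono_right inter_subset_right),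
    P.proj_mul_of_disjoint (hs.diff ht) (ht.diff hs) (by
      exact disjoint_sdiff_left.mono_right sdiff_subset)]
  simp

/-- Both factors are reduced to indicators, where multiplicativity is `proj_mul`. In the limit over
the right factor, the left one is moved to the other side of the inner product as an adjoint, so
that weak convergence is enough. -/
theorem integral_mul {f g : ℝ → ℂ} (hf : BddMeas f) (hg : BddMeas g) :
    P.integral (f * g) = P.integral f * P.integral g := by
  have step : ∀ s, MeasurableSet s → ∀ g, BddMeas g →
      P.integral (s.indicator 1 * g) = P.integral (s.indicator 1) * P.integral g := by
    intro s hs g hg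
    have is := BddMeas.one.indicator hs
    refine hg.induction (p := fun g => P.integral (s.indicator 1 * g)
      = P.integral (s.indicator 1) * P.integral g) (fun t ht => ?_) (fun c g hg h => ?_) (fun g g' hg hg' h h' => ?_)
      fun F f C mF hC hF h => ?_
    · have : s.indicator (1 : ℝ → ℂ) * t.indicator 1 = (s ∩ t).indicator 1 := by
        rw [inter_indicator_one]
      rw [this, P.integral_indicator (hs.inter ht), P.integral_indicator hs,
        P.integral_indicator ht, P.proj_mul hs ht]
    · rw [mul_smul_comm, P.integral_smul c (is.mul hg), h, P.integral_smul c hg, mul_smul_comm]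
    · rw [mul_add, P.integral_add (is.mul hg) (is.mul hg'), h, h', P.integral_add hg hg', mul_add]
    · ext v
      refine ext_inner_left ℂ fun u => ?_
      have h1 := P.tendsto_inner_integral (F := fun n => s.indicator 1 * F n)
        (f := s.indicator 1 * f) (C := C) (fun n => is.1.mul (mF n)) (fun n x => ?_)
        (fun x => (hF x).const_mul _) u v
      · simp_rw [h] at h1
        have h2 := P.tendsto_inner_integral mF hC hF
          (ContinuousLinearMap.adjoint (P.integral (s.indicator 1)) u) v
        simp only [mul_apply_eq_comp] at h1 ⊢
        simp only [ContinuousLinearMap.adjoint_inner_left] at h2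
        exact tendsto_nhds_unique h1 h2
      · by_cases hx : x ∈ s
        · simpa [hx] using hC n x
        · simpa [hx] using (norm_nonneg _).trans (hC n x)
  obtain ⟨mg, K, hK⟩ := hg
  have hg : BddMeas g := ⟨mg, K, hK⟩
  refine hf.induction (p := fun f => P.integral (f * g) = P.integral f * P.integral g)
    (fun s hs => step s hs g hg) (fun c f hf h => ?_)
    (fun f f' hf hf' h h' => ?_) fun F f C mF hC hF h => ?_
  · rw [smul_mul_assoc, P.integral_smul c (hf.mul hg), h, P.integral_smul c hf, smul_mul_assoc]
  · rw [add_mul, P.integral_add (hf.mul hg) (hf'.mul hg), h, h', P.integral_add hf hf', add_mul]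
  · ext v
    refine ext_inner_left ℂ fun u => ?_
    have h1 := P.tendsto_inner_integral (F := fun n => F n * g)
      (f := f * g) (C := C * K) (fun n => (mF n).mul mg) (fun n x => ?_)
      (fun x => (hF x).mul_const _) u v
    · simp_rw [h] at h1
      exact tendsto_nhds_unique h1 (P.tendsto_inner_integral mF hC hF u (P.integral g v))
    · rw [Pi.mul_apply, norm_mul]
      exact mul_le_mul (hC n x) (hK x) (norm_nonneg _) ((norm_nonneg _).trans (hC n x))

theorem norm_sq_integral_apply {f : ℝ → ℂ} (hf : BddMeas f) (u : H) :
    ‖P.integral f u‖ ^ 2 = ∫ t, ‖f t‖ ^ 2 ∂(P.scalar u) := by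
  have h1 : inner ℂ (P.integral f u) (P.integral f u) = ∫ t, (star f * f) t ∂(P.scalar u) := by
    rw [← P.inner_integral (hf.star.mul hf), P.integral_mul hf.star hf, P.integral_star hf,
      mul_apply_eq_comp, ContinuousLinearMap.adjoint_inner_right]
  have h2 : ∀ t, (star f * f) t = ((‖f t‖ ^ 2 : ℝ) : ℂ) := by
    intro t
    simp only [Pi.mul_apply, Pi.star_apply, RCLike.star_def, Complex.conj_mul']
    norm_cast
  simp_rw [h2] at h1
  rw [integral_complex_ofReal, inner_self_eq_norm_sq_to_K] at h1
  apply Complex.ofReal_injective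
  rw [← h1]
  norm_cast

theorem norm_integral_le {f : ℝ → ℂ} (mf : Measurable f) {C : ℝ} (hC0 : 0 ≤ C)
    (hC : ∀ x, ‖f x‖ ≤ C) : ‖P.integral f‖ ≤ C := by
  refine ContinuousLinearMap.opNorm_le_bound _ hC0 fun u => ?_
  refine le_of_sq_le_sq ?_ (by positivity)
  rw [P.norm_sq_integral_apply ⟨mf, C, hC⟩]
  have : ∫ t, ‖f t‖ ^ 2 ∂(P.scalar u) ≤ ∫ t, C ^ 2 ∂(P.scalar u) := by
    refine integral_mono_of_nonneg (Eventually.of_forall fun _ => by positivity)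
      (integrable_const _) (Eventually.of_forall fun t => ?_)
    exact pow_le_pow_left₀ (norm_nonneg _) (hC t) 2
  refine this.trans (le_of_eq ?_)
  rw [integral_const, measureReal_def, P.scalar_univ, ENNReal.toReal_ofReal (by positivity)]
  simp only [smul_eq_mul]; ring

theorem integral_neg {f : ℝ → ℂ} (hf : BddMeas f) : P.integral (-f) = -P.integral f := by
  have := P.integral_smul (-1) hf
  simpa using this

theorem integral_sub {f g : ℝ → ℂ} (hf : BddMeas f) (hg : BddMeas g) :
    P.integral (f - g) = P.integral f - P.integral g := by
  have hn : BddMeas (-g) := by simpa using hg.smul (-1)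
  rw [sub_eq_add_neg, P.integral_add hf hn, P.integral_neg hg, sub_eq_add_neg]

theorem tendsto_integral_apply {F : ℕ → ℝ → ℂ} {f : ℝ → ℂ} {C : ℝ}
    (mF : ∀ n, Measurable (F n)) (hC : ∀ n x, ‖F n x‖ ≤ C)
    (hF : ∀ x, Tendsto (fun n => F n x) atTop (𝓝 (f x))) (u : H) :
    Tendsto (fun n => P.integral (F n) u) atTop (𝓝 (P.integral f u)) := by
  have mf : Measurable f := measurable_of_tendsto_metrizable mF (tendsto_pi_nhds.2 hF)
  have hfC : ∀ x, ‖f x‖ ≤ C := fun x => le_of_tendsto (hF x).norm (Eventually.of_forall fun n => hC n x)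
  have hf : BddMeas f := ⟨mf, C, hfC⟩
  have hn : BddMeas (-f) := by simpa using hf.smul (-1)
  rw [tendsto_iff_norm_sub_tendsto_zero]
  have key : Tendsto (fun n => ‖P.integral (F n) u - P.integral f u‖ ^ 2) atTop (𝓝 0) := by
    have e : ∀ n, ‖P.integral (F n) u - P.integral f u‖ ^ 2
        = ∫ t, ‖F n t - f t‖ ^ 2 ∂(P.scalar u) := by
      intro n
      have hFn : BddMeas (F n) := ⟨mF n, C, hC n⟩
      have := P.norm_sq_integral_apply (by simpa [sub_eq_add_neg] using hFn.add hn : BddMeas (F n - f)) u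
      rw [P.integral_sub hFn hf] at this
      simpa using this
    simp_rw [e]
    have : (0 : ℝ) = ∫ t, (0 : ℝ) ∂(P.scalar u) := by simp
    rw [this]
    refine tendsto_integral_of_dominated_convergence (fun _ => (C + C) ^ 2)
      (fun n => (((mF n).sub mf).norm.pow_const 2).aestronglyMeasurable) (integrable_const _)
      (fun n => Eventually.of_forall fun t => ?_) (Eventually.of_forall fun t => ?_)
    · rw [norm_pow, norm_norm]
      exact pow_le_pow_left₀ (norm_nonneg _)
        ((norm_sub_le _ _).trans (add_le_add (hC n t) (hfC t))) 2
    · have := ((hF t).sub_const (f t)).norm.pow 2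
      simpa using this
  have := key.sqrt
  simpa [Real.sqrt_sq] using this

/-- Multiplicativity gives `‖P(s) f(A) u‖² = ∫ 1_s |f|² d⟨P u, u⟩`. Domain conditions on the vector
`f(A) u` thereby become integrability conditions on the measure of `u`. -/
theorem scalar_integral_apply {f : ℝ → ℂ} (hf : BddMeas f) (u : H) :
    P.scalar (P.integral f u)
      = (P.scalar u).withDensity fun t => ENNReal.ofReal (‖f t‖ ^ 2) := by
    ext s hs
    rw [withDensity_apply _ hs, ← ofReal_integral_eq_lintegral_ofReal, P.scalar_apply _ hs]
    · congr 1
      have is := BddMeas.one.indicator hs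
      have h1 : inner ℂ (P.integral f u) (P.proj s (P.integral f u))
          = ((‖P.integral (s.indicator 1 * f) u‖ ^ 2 : ℝ) : ℂ) := by
        rw [P.integral_mul is hf, P.integral_indicator hs, mul_apply_eq_comp]
        set w := P.integral f u
        have hp := P.isStarProjection s hs
        have : P.proj s w = P.proj s (P.proj s w) := by
          conv_lhs => rw [← hp.isIdempotentElem.eq]
          rfl
        rw [this, ← ContinuousLinearMap.adjoint_inner_left, hp.isSelfAdjoint.adjoint_eq,
          inner_self_eq_norm_sq_to_K]
        rw [← this]
        norm_cast
      rw [h1, Complex.ofReal_re, P.norm_sq_integral_apply (is.mul hf), ← MeasureTheory.integral_indicator hs]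
      congr 1
      ext t
      by_cases ht : t ∈ s <;> simp [ht]
    · have : BddMeas (star f * f) := hf.star.mul hf
      have h2 := (this.integrable (P.scalar u)).norm
      refine (h2.congr (Eventually.of_forall fun t => ?_)).restrict
      simp [sq]
    · exact Eventually.of_forall fun t => by positivity

theorem integrable_scalar_integral_iff {f : ℝ → ℂ} (hf : BddMeas f) (u : H) {g : ℝ → ℝ} :
    Integrable g (P.scalar (P.integral f u))
      ↔ Integrable (fun t => ‖f t‖ ^ 2 * g t) (P.scalar u) := by
  rw [P.scalar_integral_apply hf, integrable_withDensity_iff_integrable_smul'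
    (hf.1.norm.pow_const 2).ennreal_ofReal (Eventually.of_forall fun _ => ENNReal.ofReal_lt_top)]
  refine integrable_congr (Eventually.of_forall fun t => ?_)
  simp

theorem integral_scalar_integral {f : ℝ → ℂ} (hf : BddMeas f) (u : H) (g : ℝ → ℂ) :
    ∫ t, g t ∂(P.scalar (P.integral f u)) = ∫ t, (‖f t‖ ^ 2 : ℝ) * g t ∂(P.scalar u) := by
  rw [P.scalar_integral_apply hf, integral_withDensity_eq_integral_toReal_smul
    (hf.1.norm.pow_const 2).ennreal_ofReal (Eventually.of_forall fun _ => ENNReal.ofReal_lt_top)]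
  refine integral_congr_ae (Eventually.of_forall fun t => ?_)
  simp

/-- The truncation of a function at height `n`. -/
def truncate (f : ℝ → ℂ) (n : ℕ) : ℝ → ℂ := {t | ‖f t‖ ≤ n}.indicator f

theorem bddMeas_truncate {f : ℝ → ℂ} (mf : Measurable f) (n : ℕ) : BddMeas (truncate f n) := by
  refine ⟨mf.indicator (measurableSet_le mf.norm measurable_const), n, fun t => ?_⟩
  by_cases h : ‖f t‖ ≤ n
  · rw [truncate, indicator_of_mem (by exact h)]; exact h
  · rw [truncate, indicator_of_notMem (by exact h)]; simp

theorem truncate_eventually (f : ℝ → ℂ) (t : ℝ) : ∀ᶠ n in atTop, truncate f n t = f t := by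
  obtain ⟨N, hN⟩ := exists_nat_ge ‖f t‖
  filter_upwards [eventually_ge_atTop N] with n hn
  have h : t ∈ {t | ‖f t‖ ≤ n} := by
    have : (N : ℝ) ≤ n := by exact_mod_cast hn
    exact hN.trans this
  rw [truncate, indicator_of_mem h]

theorem norm_truncate_le (f : ℝ → ℂ) (n : ℕ) (t : ℝ) : ‖truncate f n t‖ ≤ ‖f t‖ :=
  norm_indicator_le_norm_self _ _

/-- Two truncations at heights above `N` differ by at most `|f - truncate f N|`, whose square
integral tends to `0`. The limit serves as `∫ f dP` applied to `u` for unbounded `f`. -/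
theorem exists_tendsto_integral_truncate {f : ℝ → ℂ} (mf : Measurable f) (u : H)
    (hf : Integrable (fun t => ‖f t‖ ^ 2) (P.scalar u)) :
    ∃ w, Tendsto (fun n => P.integral (truncate f n) u) atTop (𝓝 w) := by
  refine cauchySeq_tendsto_of_complete (cauchySeq_of_le_tendsto_0
    (fun N => √(∫ t, ‖f t - truncate f N t‖ ^ 2 ∂(P.scalar u))) (fun n m N hn hm => ?_) ?_)
  · rw [dist_eq_norm]
    refine Real.le_sqrt_of_sq_le ?_
    rw [← sub_apply, ← P.integral_sub (bddMeas_truncate mf n)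
      (bddMeas_truncate mf m), P.norm_sq_integral_apply]
    · refine integral_mono_of_nonneg (Eventually.of_forall fun _ => by positivity) ?_
        (Eventually.of_forall fun t => ?_)
      · refine hf.mono' (((mf.sub (bddMeas_truncate mf N).1).norm.pow_const 2).aestronglyMeasurable)
          (Eventually.of_forall fun t => ?_)
        rw [norm_pow, norm_norm]
        refine pow_le_pow_left₀ (norm_nonneg _) ?_ 2
        by_cases h : ‖f t‖ ≤ N
        · rw [truncate, indicator_of_mem (by exact h)]; simp
        · rw [truncate, indicator_of_notMem (by exact h)]; simp
      · refine pow_le_pow_left₀ (norm_nonneg _) ?_ 2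
        rw [Pi.sub_apply]
        by_cases h : ‖f t‖ ≤ N
        · have hn' : ‖f t‖ ≤ n := h.trans (by exact_mod_cast hn)
          have hm' : ‖f t‖ ≤ m := h.trans (by exact_mod_cast hm)
          rw [truncate, truncate, indicator_of_mem (by exact hn'), indicator_of_mem (by exact hm')]
          simp
        · rw [truncate, truncate, truncate, indicator_of_notMem (s := {t | ‖f t‖ ≤ N}) (by exact h)]
          by_cases hn' : t ∈ {t | ‖f t‖ ≤ n} <;> by_cases hm' : t ∈ {t | ‖f t‖ ≤ m} <;>
            simp only [indicator_of_mem, indicator_of_notMem, hn', hm', not_false_eq_true] <;> simp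
    · rw [sub_eq_add_neg]
      exact (bddMeas_truncate mf n).add (by simpa using (bddMeas_truncate mf m).smul (-1))
  · have : Tendsto (fun N => ∫ t, ‖f t - truncate f N t‖ ^ 2 ∂(P.scalar u)) atTop
        (𝓝 (∫ t, 0 ∂(P.scalar u))) := by
      refine tendsto_integral_of_dominated_convergence (fun t => (2 * ‖f t‖) ^ 2)
        (fun n => ((mf.sub (bddMeas_truncate mf n).1).norm.pow_const 2).aestronglyMeasurable) ?_
        (fun n => Eventually.of_forall fun t => ?_) (Eventually.of_forall fun t => ?_)
      · simp_rw [mul_pow]; exact hf.const_mul _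
      · rw [norm_pow, norm_norm]
        refine pow_le_pow_left₀ (norm_nonneg _) ((norm_sub_le _ _).trans ?_) 2
        linarith [norm_truncate_le f n t]
      · refine Tendsto.congr' ?_ tendsto_const_nhds
        filter_upwards [truncate_eventually f t] with n hn
        rw [hn]; simp
    simpa using this.sqrt

end SpectralMeasure

end

noncomputable section

/-! ### The spectral theorem for bounded self-adjoint operators. -/

section BoundedSpectralTheorem

open CompactlySupported

variable {H : Type*} [NormedAddCommGroup H] [InnerProductSpace ℂ H] [CompleteSpace H]

/-- A continuous cutoff, equal to `1` on `[-n, n]` and to `0` outside `[-n-1, n+1]`. -/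
def cutoff (n : ℕ) (t : ℝ) : ℝ := max 0 (min 1 (n + 1 - |t|))

theorem continuous_cutoff (n : ℕ) : Continuous (cutoff n) := by unfold cutoff; fun_prop

theorem cutoff_nonneg (n : ℕ) (t : ℝ) : 0 ≤ cutoff n t := le_max_left _ _

theorem cutoff_le_one (n : ℕ) (t : ℝ) : cutoff n t ≤ 1 := max_le zero_le_one (min_le_left _ _)

theorem cutoff_eq_one {n : ℕ} {t : ℝ} (h : |t| ≤ n) : cutoff n t = 1 := by
  unfold cutoff
  rw [min_eq_left (by linarith), max_eq_right zero_le_one]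

theorem cutoff_mono (t : ℝ) : Monotone fun n => cutoff n t := by
  intro n m h
  have : (n : ℝ) ≤ m := by exact_mod_cast h
  exact max_le_max le_rfl (min_le_min le_rfl (by linarith))

theorem cutoff_eventually (t : ℝ) : ∀ᶠ n in atTop, cutoff n t = 1 := by
  obtain ⟨N, hN⟩ := exists_nat_ge |t|
  filter_upwards [eventually_ge_atTop N] with n hn
  have : (N : ℝ) ≤ n := by exact_mod_cast hn
  exact cutoff_eq_one (hN.trans this)

/-- The product of a continuous function with a cutoff. -/
def cutoffMul (n : ℕ) (f : C(ℝ, ℝ)) : C_c(ℝ, ℝ) where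
  toFun t := cutoff n t * f t
  continuous_toFun := (continuous_cutoff n).mul f.continuous
  hasCompactSupport' := by
    refine HasCompactSupport.intro (isCompact_Icc (a := -((n : ℝ) + 1)) (b := n + 1)) fun t ht => ?_
    have : (n : ℝ) + 1 ≤ |t| := by
      by_contra h
      push Not at h
      exact ht (abs_le.1 h.le)
    have e : cutoff n t = 0 := by
      unfold cutoff
      exact max_eq_left ((min_le_right _ _).trans (by linarith))
    simp [e]

@[simp] theorem cutoffMul_apply (n : ℕ) (f : C(ℝ, ℝ)) (t : ℝ) :
    cutoffMul n f t = cutoff n t * f t := rfl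

/-- The positive functional `f ↦ ⟨u, f(R) u⟩`. -/
def cfcFunctional (R : H →L[ℂ] H) (u : H) : C_c(ℝ, ℝ) →ₚ[ℝ] ℝ :=
  PositiveLinearMap.mk₀
    { toFun := fun f => (inner ℂ u (cfc (f : ℝ → ℝ) R u)).re
      map_add' := fun f g => by
        have := cfc_add (a := R) (f : ℝ → ℝ) g f.continuous.continuousOn g.continuous.continuousOn
        have e : ((f + g : C_c(ℝ, ℝ)) : ℝ → ℝ) = fun x => f x + g x := rfl
        rw [e, this]
        simp
      map_smul' := fun c f => by
        have := cfc_smul (a := R) c (f : ℝ → ℝ) f.continuous.continuousOn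
        have e : ((c • f : C_c(ℝ, ℝ)) : ℝ → ℝ) = fun x => c • f x := rfl
        rw [e, this]
        simp }
    (fun f hf => by
      have h : 0 ≤ cfc (f : ℝ → ℝ) R := cfc_nonneg fun x _ => hf x
      rw [ContinuousLinearMap.nonneg_iff_isPositive] at h
      have := h.inner_nonneg_right u
      exact (Complex.le_def.1 this).1)

/-- The spectral measure of `R` at `u`. -/
def cfcMeasure (R : H →L[ℂ] H) (u : H) : Measure ℝ := RealRMK.rieszMeasure (cfcFunctional R u)

theorem inner_cfc_eq_integral {R : H →L[ℂ] H} (u : H) (f : C_c(ℝ, ℝ)) :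
    inner ℂ u (cfc (f : ℝ → ℝ) R u) = ∫ t, ((f t : ℝ) : ℂ) ∂(cfcMeasure R u) := by
  rw [integral_complex_ofReal, cfcMeasure, RealRMK.integral_rieszMeasure]
  have h : IsSelfAdjoint (cfc (f : ℝ → ℝ) R) := cfc_predicate _ _
  have : (starRingEnd ℂ) (inner ℂ u (cfc (f : ℝ → ℝ) R u)) = inner ℂ u (cfc (f : ℝ → ℝ) R u) := by
    rw [inner_conj_symm, ← ContinuousLinearMap.adjoint_inner_right, h.adjoint_eq]
  exact (Complex.conj_eq_iff_re.1 this).symm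

theorem spectrum_abs_le (R : H →L[ℂ] H) {x : ℝ} (hx : x ∈ spectrum ℝ R) : |x| ≤ ‖R‖ := by
  have := spectrum.norm_le_norm_mul_of_mem hx
  refine this.trans ?_
  have h1 : ‖(1 : H →L[ℂ] H)‖ ≤ 1 := ContinuousLinearMap.norm_id_le
  nlinarith [norm_nonneg R]

/-- A cutoff at height `n ≥ ‖R‖` equals `1` on the spectrum, so the functional calculus sends it to
the identity and its integral is `‖u‖²`. Monotone convergence in `n` gives the total mass. -/
theorem cfcMeasure_univ {R : H →L[ℂ] H} (hR : IsSelfAdjoint R) (u : H) :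
    cfcMeasure R u univ = ENNReal.ofReal (‖u‖ ^ 2) := by
  have reg : IsFiniteMeasureOnCompacts (cfcMeasure R u) := by
    unfold cfcMeasure; infer_instance
  have h1 : Tendsto (fun n : ℕ => ∫⁻ t, ENNReal.ofReal (cutoff n t) ∂(cfcMeasure R u)) atTop
      (𝓝 (∫⁻ t, 1 ∂(cfcMeasure R u))) := by
    refine lintegral_tendsto_of_tendsto_of_monotone
      (fun n => (continuous_cutoff n).measurable.ennreal_ofReal.aemeasurable)
      (Eventually.of_forall fun t n m h => ENNReal.ofReal_le_ofReal (cutoff_mono t h))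
      (Eventually.of_forall fun t => ?_)
    refine Tendsto.congr' ?_ tendsto_const_nhds
    filter_upwards [cutoff_eventually t] with n hn
    rw [hn, ENNReal.ofReal_one]
  rw [lintegral_one] at h1
  refine tendsto_nhds_unique h1 (Tendsto.congr' ?_ tendsto_const_nhds)
  obtain ⟨N, hN⟩ := exists_nat_ge ‖R‖
  filter_upwards [eventually_ge_atTop N] with n hn
  have hn' : (N : ℝ) ≤ n := by exact_mod_cast hn
  let f := cutoffMul n 1
  have e1 : cfc (f : ℝ → ℝ) R = 1 := by
    rw [← cfc_const_one ℝ R]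
    refine cfc_congr fun x hx => ?_
    have := spectrum_abs_le R hx
    simp [f, cutoff_eq_one (this.trans (hN.trans hn'))]
  have e2 := inner_cfc_eq_integral (R := R) u f
  rw [e1, one_apply_eq_self, integral_complex_ofReal, inner_self_eq_norm_sq_to_K] at e2
  have e3 : ‖u‖ ^ 2 = ∫ t, f t ∂(cfcMeasure R u) := by
    apply Complex.ofReal_injective
    rw [← e2]
    norm_cast
  rw [e3, ofReal_integral_eq_lintegral_ofReal]
  · simp [f]
  · exact f.continuous.integrable_of_hasCompactSupport f.hasCompactSupport
  · exact Eventually.of_forall fun t => by simp [f, cutoff_nonneg]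

/-- A sequence of compactly supported functions that decreases to the indicator of a closed set. -/
theorem exists_tendsto_indicator_of_isClosed {s : Set ℝ} (hs : IsClosed s) :
    ∃ φ : ℕ → C_c(ℝ, ℝ), (∀ n t, |φ n t| ≤ 1) ∧
      ∀ t, Tendsto (fun n => φ n t) atTop (𝓝 (s.indicator 1 t)) := by
  have hδ : ∀ n : ℕ, (0 : ℝ) < 1 / ((n : ℝ) + 1) := fun n => by positivity
  have hδ0 : Tendsto (fun n : ℕ => (1 : ℝ) / ((n : ℝ) + 1)) atTop (𝓝 0) :=
    tendsto_one_div_add_atTop_nhds_zero_nat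
  have key := thickenedIndicator_tendsto_indicator_closure hδ hδ0 s
  rw [hs.closure_eq] at key
  refine ⟨fun n => cutoffMul n ⟨fun t => (thickenedIndicator (hδ n) s t : ℝ),
    NNReal.continuous_coe.comp (thickenedIndicator (hδ n) s).continuous⟩, fun n t => ?_, fun t => ?_⟩
  · have h1 : (thickenedIndicator (hδ n) s t : ℝ) ≤ 1 := by
      exact_mod_cast thickenedIndicator_le_one (hδ n) s t
    have h0 : (0 : ℝ) ≤ (thickenedIndicator (hδ n) s t : ℝ) := NNReal.coe_nonneg _
    simp only [cutoffMul_apply, ContinuousMap.coe_mk]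
    rw [abs_of_nonneg (mul_nonneg (cutoff_nonneg _ _) h0)]
    exact mul_le_one₀ (cutoff_le_one _ _) h0 h1
  · have h2 := (NNReal.continuous_coe.tendsto _).comp ((tendsto_pi_nhds.1 key) t)
    have h3 : Tendsto (fun n => cutoff n t) atTop (𝓝 1) := by
      refine Tendsto.congr' ?_ tendsto_const_nhds
      filter_upwards [cutoff_eventually t] with n hn
      exact hn.symm
    have h4 := h3.mul h2
    rw [one_mul] at h4
    refine (h4.congr fun n => rfl).trans (le_of_eq ?_)
    by_cases ht : t ∈ s <;> simp [ht]

/-- A π-λ argument. Closed sets are bounded limits of compactly supported continuous functions, for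
which the operator is given by the continuous functional calculus; complements and disjoint unions
preserve the existence of the operator. -/
theorem exists_inner_eq_cfcMeasure {R : H →L[ℂ] H} (hR : IsSelfAdjoint R) {s : Set ℝ}
    (hs : MeasurableSet s) :
    ∃ T : H →L[ℂ] H, ∀ u, inner ℂ u (T u) = ∫ t, s.indicator (1 : ℝ → ℂ) t ∂(cfcMeasure R u) := by
  have hm := cfcMeasure_univ hR
  have fin : ∀ u, IsFiniteMeasure (cfcMeasure R u) :=
    fun u => ⟨by rw [hm]; exact ENNReal.ofReal_lt_top⟩
  induction s, hs using MeasurableSpace.induction_on_inter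
    (borel_eq_generateFrom_isClosed (α := ℝ) ▸ BorelSpace.measurable_eq) isPiSystem_isClosed with
  | empty => exact ⟨0, fun u => by simp⟩
  | basic s hs =>
    obtain ⟨φ, hφ1, hφ⟩ := exists_tendsto_indicator_of_isClosed hs
    refine exists_inner_eq_integral_of_tendsto hm (F := fun n t => ((φ n t : ℝ) : ℂ)) (C := 1)
      (fun n => Complex.continuous_ofReal.measurable.comp (φ n).continuous.measurable)
      (fun n t => by simpa using hφ1 n t) (fun t => ?_)
      fun n => ⟨_, fun u => inner_cfc_eq_integral u (φ n)⟩
    have := (Complex.continuous_ofReal.tendsto _).comp (hφ t)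
    refine this.trans (le_of_eq ?_)
    by_cases ht : t ∈ s <;> simp [ht]
  | compl s hs ih =>
    obtain ⟨T, hT⟩ := ih
    refine ⟨1 - T, fun u => ?_⟩
    have e : ∀ t, sᶜ.indicator (1 : ℝ → ℂ) t = 1 - s.indicator (1 : ℝ → ℂ) t := by
      intro t
      by_cases ht : t ∈ s <;> simp [ht]
    simp_rw [e]
    rw [MeasureTheory.integral_sub (integrable_const _)
      ((BddMeas.one.indicator hs).integrable _), ← hT, sub_apply, inner_sub_right]
    simp [measureReal_def, hm, inner_self_eq_norm_sq_to_K]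
  | iUnion f hd hf ih =>
    choose T hT using ih
    refine exists_inner_eq_integral_of_tendsto hm (C := 1)
      (F := fun n => (⋃ i ∈ Finset.range n, f i).indicator 1)
      (fun n => measurable_one.indicator (Finset.measurableSet_biUnion _ fun i _ => hf i))
      (fun n t => (norm_indicator_le_norm_self _ _).trans (by simp)) (fun t => ?_) fun n => ?_
    · by_cases ht : t ∈ ⋃ i, f i
      · obtain ⟨i, hi⟩ := mem_iUnion.1 ht
        refine Tendsto.congr' ?_ tendsto_const_nhds
        filter_upwards [eventually_gt_atTop i] with n hn
        rw [indicator_of_mem ht, indicator_of_mem]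
        exact mem_biUnion (Finset.mem_coe.2 (Finset.mem_range.2 hn)) hi
      · refine Tendsto.congr (fun n => ?_) tendsto_const_nhds
        rw [indicator_of_notMem ht, indicator_of_notMem]
        intro h
        obtain ⟨i, _, hi⟩ := mem_iUnion₂.1 h
        exact ht (mem_iUnion.2 ⟨i, hi⟩)
    · refine ⟨∑ i ∈ Finset.range n, T i, fun u => ?_⟩
      have e : ∀ t, (⋃ i ∈ Finset.range n, f i).indicator (1 : ℝ → ℂ) t
          = ∑ i ∈ Finset.range n, (f i).indicator (1 : ℝ → ℂ) t := by
        intro t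
        rw [Finset.indicator_biUnion]
        intro i _ j _ hij
        exact hd hij
      simp_rw [e]
      rw [integral_finsetSum _ fun i _ => (BddMeas.one.indicator (hf i)).integrable _]
      simp [hT]

/-- This is the passage from continuous functions to indicators in the left factor of a product. It
is used twice, with `S = φ(R)` and then with `S = T t`, and yields `T s * T t = T (s ∩ t)`. -/
theorem inner_comp_eq_integral_of_forall_cfc {R : H →L[ℂ] H} (hR : IsSelfAdjoint R)
    {T : Set ℝ → H →L[ℂ] H} (hT : ∀ s, MeasurableSet s →
      ∀ u, inner ℂ u (T s u) = ∫ t, s.indicator (1 : ℝ → ℂ) t ∂(cfcMeasure R u))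
    {S : H →L[ℂ] H} {g : ℝ → ℂ} (hg : BddMeas g)
    (h : ∀ (φ : C_c(ℝ, ℝ)) (u : H), inner ℂ u (cfc (φ : ℝ → ℝ) R (S u))
      = ∫ t, (φ t : ℂ) * g t ∂(cfcMeasure R u))
    (h1 : ∀ u, inner ℂ u (S u) = ∫ t, g t ∂(cfcMeasure R u))
    {s : Set ℝ} (hs : MeasurableSet s) (u : H) :
    inner ℂ u (T s (S u)) = ∫ t, s.indicator (1 : ℝ → ℂ) t * g t ∂(cfcMeasure R u) := by
  have hm := cfcMeasure_univ hR
  have fin : ∀ u, IsFiniteMeasure (cfcMeasure R u) :=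
    fun u => ⟨by rw [hm]; exact ENNReal.ofReal_lt_top⟩
  obtain ⟨K, hK⟩ := hg.2
  have lim : ∀ (F : ℕ → ℝ → ℂ) (f : ℝ → ℂ), (∀ n, Measurable (F n)) → (∀ n t, ‖F n t‖ ≤ 1) →
      (∀ t, Tendsto (fun n => F n t) atTop (𝓝 (f t))) →
      Tendsto (fun n => ∫ t, F n t * g t ∂(cfcMeasure R u)) atTop
        (𝓝 (∫ t, f t * g t ∂(cfcMeasure R u))) := by
    intro F f mF hF hlim
    refine tendsto_integral_of_dominated_convergence (fun _ => K)
      (fun n => ((mF n).mul hg.1).aestronglyMeasurable) (integrable_const _)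
      (fun n => Eventually.of_forall fun t => ?_)
      (Eventually.of_forall fun t => (hlim t).mul_const _)
    rw [norm_mul]
    nlinarith [hF n t, hK t, norm_nonneg (F n t), norm_nonneg (g t)]
  induction s, hs using MeasurableSpace.induction_on_inter
    (borel_eq_generateFrom_isClosed (α := ℝ) ▸ BorelSpace.measurable_eq) isPiSystem_isClosed with
  | empty =>
    have : T ∅ = 0 := ext_inner_quadratic fun u => by rw [hT ∅ MeasurableSet.empty]; simp
    simp [this]
  | basic s hs =>
    obtain ⟨φ, hφ1, hφ⟩ := exists_tendsto_indicator_of_isClosed hs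
    have hs' : MeasurableSet s := IsClosed.measurableSet hs
    have mφ : ∀ n, Measurable fun t => ((φ n t : ℝ) : ℂ) :=
      fun n => Complex.continuous_ofReal.measurable.comp (φ n).continuous.measurable
    have bφ : ∀ n t, ‖((φ n t : ℝ) : ℂ)‖ ≤ 1 := fun n t => by simpa using hφ1 n t
    have lφ : ∀ t, Tendsto (fun n => ((φ n t : ℝ) : ℂ)) atTop (𝓝 (s.indicator 1 t)) := by
      intro t
      have := (Complex.continuous_ofReal.tendsto _).comp (hφ t)
      refine this.trans (le_of_eq ?_)
      by_cases ht : t ∈ s <;> simp [ht]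
    have a1 := tendsto_inner_of_inner_eq_integral hm (C := 1) mφ bφ lφ
      (fun n u => inner_cfc_eq_integral u (φ n)) (hT s hs') u (S u)
    simp_rw [h] at a1
    exact tendsto_nhds_unique a1 (lim _ _ mφ bφ lφ)
  | compl s hs ih =>
    have e : T sᶜ = 1 - T s := ext_inner_quadratic fun u => by
      rw [hT _ hs.compl, sub_apply, inner_sub_right, hT s hs]
      have e : ∀ t, sᶜ.indicator (1 : ℝ → ℂ) t = 1 - s.indicator (1 : ℝ → ℂ) t := by
        intro t
        by_cases ht : t ∈ s <;> simp [ht]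
      simp_rw [e]
      rw [MeasureTheory.integral_sub (integrable_const _)
        ((BddMeas.one.indicator hs).integrable _)]
      simp [measureReal_def, hm, inner_self_eq_norm_sq_to_K]
    have e' : ∀ t, sᶜ.indicator (1 : ℝ → ℂ) t * g t = g t - s.indicator (1 : ℝ → ℂ) t * g t := by
      intro t
      by_cases ht : t ∈ s <;> simp [ht]
    simp_rw [e']
    have int : Integrable (fun t => s.indicator (1 : ℝ → ℂ) t * g t) (cfcMeasure R u) :=
      ((BddMeas.one.indicator hs).mul hg).integrable _
    rw [MeasureTheory.integral_sub (hg.integrable _) int, e, sub_apply, inner_sub_right, ih,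
      one_apply_eq_self, h1]
  | iUnion f hd hf ih =>
    have hF : ∀ t, Tendsto (fun n => (⋃ i ∈ Finset.range n, f i).indicator (1 : ℝ → ℂ) t) atTop
        (𝓝 ((⋃ i, f i).indicator 1 t)) := by
      intro t
      by_cases ht : t ∈ ⋃ i, f i
      · obtain ⟨i, hi⟩ := mem_iUnion.1 ht
        refine Tendsto.congr' ?_ tendsto_const_nhds
        filter_upwards [eventually_gt_atTop i] with n hn
        rw [indicator_of_mem ht, indicator_of_mem]
        exact mem_biUnion (Finset.mem_coe.2 (Finset.mem_range.2 hn)) hi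
      · refine Tendsto.congr (fun n => ?_) tendsto_const_nhds
        rw [indicator_of_notMem ht, indicator_of_notMem]
        intro h
        obtain ⟨i, _, hi⟩ := mem_iUnion₂.1 h
        exact ht (mem_iUnion.2 ⟨i, hi⟩)
    have mF : ∀ n, Measurable ((⋃ i ∈ Finset.range n, f i).indicator (1 : ℝ → ℂ)) :=
      fun n => measurable_one.indicator (Finset.measurableSet_biUnion _ fun i _ => hf i)
    have bF : ∀ n t, ‖(⋃ i ∈ Finset.range n, f i).indicator (1 : ℝ → ℂ) t‖ ≤ 1 :=
      fun n t => (norm_indicator_le_norm_self _ _).trans (by simp)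
    have e : ∀ n t, (⋃ i ∈ Finset.range n, f i).indicator (1 : ℝ → ℂ) t
        = ∑ i ∈ Finset.range n, (f i).indicator (1 : ℝ → ℂ) t := by
      intro n t
      rw [Finset.indicator_biUnion]
      intro i _ j _ hij
      exact hd hij
    have a1 := tendsto_inner_of_inner_eq_integral hm (C := 1) mF bF hF
      (T := fun n => ∑ i ∈ Finset.range n, T (f i)) (fun n u => by
        simp_rw [e]
        rw [integral_finsetSum _ fun i _ => (BddMeas.one.indicator (hf i)).integrable _]
        simp [hT _ (hf _)])
      (hT _ (MeasurableSet.iUnion hf)) u (S u)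
    refine tendsto_nhds_unique a1 ((lim _ _ mF bF hF).congr fun n => ?_)
    simp_rw [e, Finset.sum_mul]
    have int : ∀ i, Integrable (fun t => (f i).indicator (1 : ℝ → ℂ) t * g t) (cfcMeasure R u) :=
      fun i => ((BddMeas.one.indicator (hf i)).mul hg).integrable _
    rw [integral_finsetSum _ fun i _ => int i]
    simp [sum_apply, ih]

/-- The spectral theorem for bounded self-adjoint operators. -/
theorem exists_spectralMeasure_of_isSelfAdjoint {R : H →L[ℂ] H} (hR : IsSelfAdjoint R) :
    ∃ E : SpectralMeasure H, ∀ f : C_c(ℝ, ℝ), ∀ u,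
      inner ℂ u (cfc (f : ℝ → ℝ) R u) = ∫ t, ((f t : ℝ) : ℂ) ∂(E.scalar u) := by
  classical
  have hm := cfcMeasure_univ hR
  have fin : ∀ u, IsFiniteMeasure (cfcMeasure R u) :=
    fun u => ⟨by rw [hm]; exact ENNReal.ofReal_lt_top⟩
  choose! T hT using fun (s : Set ℝ) (hs : MeasurableSet s) => exists_inner_eq_cfcMeasure hR hs
  have bφ : ∀ φ : C_c(ℝ, ℝ), BddMeas fun t => ((φ t : ℝ) : ℂ) := by
    intro φ
    obtain ⟨C, hC⟩ := φ.hasCompactSupport.exists_bound_of_continuous φ.continuous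
    exact ⟨Complex.continuous_ofReal.measurable.comp φ.continuous.measurable, C,
      fun t => by simpa using hC t⟩
  have real : ∀ s, MeasurableSet s → ∀ u,
      inner ℂ u (T s u) = (((cfcMeasure R u).real s : ℝ) : ℂ) := by
    intro s hs u
    rw [hT s hs, MeasureTheory.integral_indicator hs]
    simp
  have sa : ∀ s, MeasurableSet s → IsSelfAdjoint (T s) := by
    intro s hs
    refine (ContinuousLinearMap.isSelfAdjoint_iff' ..).2 (ext_inner_quadratic fun u => ?_)
    rw [ContinuousLinearMap.adjoint_inner_right, ← inner_conj_symm, real s hs, Complex.conj_ofReal]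
  -- The lemma gives the form of `T s φ(R)`; taking adjoints gives that of `φ(R) T s`, which is the
  -- hypothesis for its second use.
  have step1 : ∀ s, MeasurableSet s → ∀ (φ : C_c(ℝ, ℝ)) u,
      inner ℂ u (cfc (φ : ℝ → ℝ) R (T s u))
        = ∫ t, (φ t : ℂ) * s.indicator (1 : ℝ → ℂ) t ∂(cfcMeasure R u) := by
    intro s hs φ u
    have h := inner_comp_eq_integral_of_forall_cfc hR hT (bφ φ) (S := cfc (φ : ℝ → ℝ) R)
      (fun ψ u => by
        rw [← mul_apply_eq_comp, ← cfc_mul (ψ : ℝ → ℝ) (φ : ℝ → ℝ) R ψ.continuous.continuousOn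
          φ.continuous.continuousOn]
        have := inner_cfc_eq_integral (R := R) u (ψ * φ)
        simp only [CompactlySupportedContinuousMap.mul_apply, Complex.ofReal_mul] at this
        exact this)
      (fun u => inner_cfc_eq_integral u φ) hs u
    have hφ : IsSelfAdjoint (cfc (φ : ℝ → ℝ) R) := cfc_predicate _ _
    rw [← hφ.adjoint_eq, ContinuousLinearMap.adjoint_inner_right, ← inner_conj_symm,
      ← (sa s hs).adjoint_eq, ContinuousLinearMap.adjoint_inner_left, h, ← integral_conj]
    congr 1
    ext t
    by_cases ht : t ∈ s <;> simp [ht]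
  have mul : ∀ s t, MeasurableSet s → MeasurableSet t → T s * T t = T (s ∩ t) := by
    intro s t hs ht
    refine ext_inner_quadratic fun u => ?_
    rw [mul_apply_eq_comp, inner_comp_eq_integral_of_forall_cfc hR hT (BddMeas.one.indicator ht)
      (step1 t ht) (hT t ht) hs, hT _ (hs.inter ht)]
    congr 1
    ext x
    by_cases hx : x ∈ s <;> by_cases hy : x ∈ t <;> simp [hx, hy]
  have proj : ∀ s, MeasurableSet s → IsStarProjection (T s) := fun s hs =>
    ⟨by have := mul s s hs hs; rwa [inter_self] at this, sa s hs⟩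
  have norm_sq : ∀ s, MeasurableSet s → ∀ u, ‖T s u‖ ^ 2 = (cfcMeasure R u).real s := by
    intro s hs u
    apply Complex.ofReal_injective
    have e : T s u = (T s * T s) u := by rw [mul s s hs hs, inter_self]
    rw [← real s hs u]
    nth_rewrite 2 [e]
    rw [mul_apply_eq_comp]
    nth_rewrite 2 [← (sa s hs).adjoint_eq]
    rw [ContinuousLinearMap.adjoint_inner_right, inner_self_eq_norm_sq_to_K]
    norm_cast
  have union : ∀ s t, MeasurableSet s → MeasurableSet t → Disjoint s t →
      T (s ∪ t) = T s + T t := by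
    intro s t hs ht h
    refine ext_inner_quadratic fun u => ?_
    rw [add_apply, inner_add_right, real s hs, real t ht, real _ (hs.union ht),
      measureReal_union h ht]
    push_cast; rfl
  have empty : T ∅ = 0 := ext_inner_quadratic fun u => by
    rw [hT ∅ MeasurableSet.empty]; simp
  let E : SpectralMeasure H :=
    { proj := T
      isStarProjection := proj
      proj_univ := ext_inner_quadratic fun u => by
        rw [real _ MeasurableSet.univ, measureReal_def, hm, ENNReal.toReal_ofReal (by positivity),
          one_apply_eq_self, inner_self_eq_norm_sq_to_K]
        norm_cast
      hasSum := fun f hf hd u => by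
        have hU := MeasurableSet.iUnion hf
        have mF : ∀ F : Finset ℕ, MeasurableSet (⋃ i ∈ F, f i) :=
          fun F => Finset.measurableSet_biUnion _ fun i _ => hf i
        have sum : ∀ F : Finset ℕ, ∑ i ∈ F, T (f i) u = T (⋃ i ∈ F, f i) u := by
          intro F
          induction F using Finset.induction_on with
          | empty => simp [empty]
          | insert a F ha ih =>
            rw [Finset.sum_insert ha, ih, Finset.set_biUnion_insert, union _ _ (hf a) (mF F)]
            · rfl
            · exact disjoint_iUnion₂_right.2 fun i hi => hd (by rintro rfl; exact ha hi)
        have meas : HasSum (fun i => (cfcMeasure R u).real (f i))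
            ((cfcMeasure R u).real (⋃ i, f i)) := by
          have h1 : HasSum (fun i => cfcMeasure R u (f i)) (cfcMeasure R u (⋃ i, f i)) := by
            rw [measure_iUnion hd hf]
            exact ENNReal.summable.hasSum
          have h2 := ENNReal.hasSum_toReal (f := fun i => cfcMeasure R u (f i))
            (by rw [← measure_iUnion hd hf]; exact measure_ne_top _ _)
          rw [← ENNReal.tsum_toReal_eq fun i => measure_ne_top _ _] at h2
          rw [measureReal_def, measure_iUnion hd hf]
          exact h2
        -- The squared norm of the remainder is the scalar measure of what is left of the union, so
        -- countable additivity of that measure gives convergence in norm.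
        have key : Tendsto (fun F : Finset ℕ => ‖∑ i ∈ F, T (f i) u - T (⋃ i, f i) u‖ ^ 2) atTop
            (𝓝 0) := by
          have e : ∀ F : Finset ℕ, ‖∑ i ∈ F, T (f i) u - T (⋃ i, f i) u‖ ^ 2
              = (cfcMeasure R u).real (⋃ i, f i) - ∑ i ∈ F, (cfcMeasure R u).real (f i) := by
            intro F
            have sub : (⋃ i ∈ F, f i) ⊆ ⋃ i, f i := iUnion₂_subset fun i _ => subset_iUnion f i
            have e1 := union _ _ (mF F) (hU.diff (mF F)) disjoint_sdiff_right
            rw [union_sdiff_cancel sub] at e1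
            rw [sum, e1, add_apply, sub_add_cancel_left, norm_neg, norm_sq _ (hU.diff (mF F)),
              measureReal_sdiff sub (mF F), measureReal_biUnion_finset (fun i _ j _ hij => hd hij)
              fun i _ => hf i]
          simp_rw [e]
          have := (tendsto_const_nhds (x := (cfcMeasure R u).real (⋃ i, f i))).sub meas
          simpa using this
        rw [HasSum, tendsto_iff_norm_sub_tendsto_zero]
        have := key.sqrt
        simpa [Real.sqrt_sq] using this }
  refine ⟨E, fun f u => ?_⟩
  have : E.scalar u = cfcMeasure R u := by
    ext s hs
    rw [E.scalar_apply u hs]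
    change ENNReal.ofReal (inner ℂ u (T s u)).re = _
    rw [real s hs, Complex.ofReal_re, measureReal_def, ENNReal.ofReal_toReal (measure_ne_top _ _)]
  rw [this]
  exact inner_cfc_eq_integral u f

end BoundedSpectralTheorem

end

noncomputable section

set_option linter.unusedSectionVars false

/-! ### The spectral theorem for non-negative self-adjoint operators. -/

section UnboundedSpectralTheorem

open CompactlySupported

variable {H : Type*} [NormedAddCommGroup H] [InnerProductSpace ℂ H] [CompleteSpace H]

/-- Self-adjointness of a relation with non-negative quadratic form. -/
structure IsNonnegSelfAdjointGraph (G : Submodule ℂ (H × H)) : Prop where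
  mem_iff : ∀ x y, (x, y) ∈ G ↔ ∀ a b, (a, b) ∈ G → inner ℂ b x = inner ℂ a y
  nonneg : ∀ a b, (a, b) ∈ G → 0 ≤ (inner ℂ a b).re

namespace IsNonnegSelfAdjointGraph

variable {G : Submodule ℂ (H × H)}

theorem isClosed (hG : IsNonnegSelfAdjointGraph G) : IsClosed (G : Set (H × H)) := by
  have : (G : Set (H × H))
      = ⋂ q : G, {z : H × H | inner ℂ (q : H × H).2 z.1 = inner ℂ (q : H × H).1 z.2} := by
    ext ⟨x, y⟩
    simp only [SetLike.mem_coe, mem_iInter, mem_ofPred_eq, hG.mem_iff x y, Subtype.forall,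
      Prod.forall]
  rw [this]
  exact isClosed_iInter fun q => isClosed_eq (by fun_prop) (by fun_prop)

/-- The map `(u, Au) ↦ u + Au`. -/
def sumMap (G : Submodule ℂ (H × H)) : G →L[ℂ] H :=
  (ContinuousLinearMap.fst ℂ H H + ContinuousLinearMap.snd ℂ H H).comp G.subtypeL

theorem sumMap_apply (q : G) : sumMap G q = (q : H × H).1 + (q : H × H).2 := rfl

/-- The cross term in `‖a + b‖²` is `2 Re ⟨a, b⟩ ≥ 0`. This lower bound makes `1 + A` injective with
closed range. -/
theorem norm_sq_le (hG : IsNonnegSelfAdjointGraph G) {a b : H} (h : (a, b) ∈ G) :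
    ‖a‖ ^ 2 + ‖b‖ ^ 2 ≤ ‖a + b‖ ^ 2 := by
  have := hG.nonneg a b h
  rw [@norm_add_sq ℂ]
  simp only [RCLike.re_to_complex]
  linarith

theorem norm_le_sumMap (hG : IsNonnegSelfAdjointGraph G) (q : G) : ‖q‖ ≤ ‖sumMap G q‖ := by
  obtain ⟨⟨a, b⟩, h⟩ := q
  have := hG.norm_sq_le h
  rw [sumMap_apply]
  change max ‖a‖ ‖b‖ ≤ ‖a + b‖
  refine max_le ?_ ?_ <;> refine le_of_sq_le_sq ?_ (norm_nonneg _) <;>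
    nlinarith [sq_nonneg ‖a‖, sq_nonneg ‖b‖]

theorem injective_sumMap (hG : IsNonnegSelfAdjointGraph G) : Function.Injective (sumMap G) := by
  rw [injective_iff_map_eq_zero]
  intro q hq
  have := hG.norm_le_sumMap q
  rw [hq, norm_zero] at this
  exact norm_le_zero_iff.1 this

/-- The range of `1 + A` is closed. A vector `z` orthogonal to it satisfies `(z, -z) ∈ G` by
self-adjointness, and then `-‖z‖² ≥ 0` by non-negativity. -/
theorem surjective_sumMap (hG : IsNonnegSelfAdjointGraph G) :
    Function.Surjective (sumMap G) := by
  have : CompleteSpace G := hG.isClosed.completeSpace_coe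
  have anti : AntilipschitzWith 1 (sumMap G) :=
    ContinuousLinearMap.antilipschitz_of_bound _ fun q => by
      simpa using hG.norm_le_sumMap q
  have cl : IsClosed ((sumMap G).range : Set H) :=
    anti.isClosed_range (sumMap G).uniformContinuous
  have : CompleteSpace (sumMap G).range := cl.completeSpace_coe
  have : (sumMap G).range = ⊤ := by
    rw [← Submodule.orthogonal_eq_bot_iff, Submodule.eq_bot_iff]
    intro z hz
    rw [Submodule.mem_orthogonal] at hz
    have hz' : (z, -z) ∈ G := by
      rw [hG.mem_iff]
      intro a b hab
      have := hz (a + b) ⟨⟨(a, b), hab⟩, rfl⟩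
      rw [inner_add_left] at this
      rw [inner_neg_right]
      linear_combination this
    have := hG.nonneg _ _ hz'
    rw [inner_neg_right, inner_self_eq_norm_sq_to_K] at this
    have h2 : ((((‖z‖ : ℝ) : ℂ)) ^ 2).re = ‖z‖ ^ 2 := by norm_cast
    simp only [Complex.coe_algebraMap, Complex.neg_re, h2] at this
    have h3 : ‖z‖ = 0 := by nlinarith [norm_nonneg z]
    exact norm_eq_zero.1 h3
  exact LinearMap.range_eq_top.1 this

/-- `R` is `(1 + A)⁻¹`, so that `A R w = w - R w`; both bounds on `R` and its symmetry are read off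
from the graph. -/
theorem exists_resolvent (hG : IsNonnegSelfAdjointGraph G) : ∃ R : H →L[ℂ] H,
    IsSelfAdjoint R ∧ 0 ≤ R ∧ ‖R‖ ≤ 1 ∧ (∀ w, (R w, w - R w) ∈ G) ∧
    (∀ a b, (a, b) ∈ G → R (a + b) = a) := by
  let e : G ≃ₗ[ℂ] H := LinearEquiv.ofBijective (sumMap G : G →ₗ[ℂ] H)
    ⟨hG.injective_sumMap, hG.surjective_sumMap⟩
  have he : ∀ q, e q = (q : H × H).1 + (q : H × H).2 := fun q => rfl
  let R0 : H →ₗ[ℂ] H := (LinearMap.fst ℂ H H ∘ₗ G.subtype) ∘ₗ (e.symm : H →ₗ[ℂ] G)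
  have hR0 : ∀ w, R0 w = (e.symm w : H × H).1 := fun w => rfl
  have bound : ∀ w, ‖R0 w‖ ≤ 1 * ‖w‖ := by
    intro w
    have h1 := hG.norm_le_sumMap (e.symm w)
    have h2 : sumMap G (e.symm w) = w := e.apply_symm_apply w
    rw [h2] at h1
    rw [one_mul]
    exact (le_max_left _ _).trans h1
  let R := R0.mkContinuous 1 bound
  have hR : ∀ w, R w = R0 w := fun w => rfl
  have h1 : ∀ w, (R w, w - R w) ∈ G := by
    intro w
    have h2 : (e.symm w : H × H).1 + (e.symm w : H × H).2 = w := by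
      rw [← he]; exact e.apply_symm_apply w
    have h3 : w - R w = (e.symm w : H × H).2 := by
      rw [hR, hR0]; nth_rewrite 1 [← h2]; abel
    rw [h3]
    exact (e.symm w).2
  have h2 : ∀ a b, (a, b) ∈ G → R (a + b) = a := by
    intro a b hab
    rw [hR, hR0]
    have : a + b = e ⟨(a, b), hab⟩ := rfl
    rw [this, e.symm_apply_apply]
  have sym : ∀ x y, inner ℂ (R x) y = inner ℂ x (R y) := by
    intro x y
    have := (hG.mem_iff _ _).1 (h1 y) _ _ (h1 x)
    rw [inner_sub_left, inner_sub_right] at this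
    linear_combination -this
  have sa : IsSelfAdjoint R := by
    rw [ContinuousLinearMap.isSelfAdjoint_iff_isSymmetric]
    exact sym
  refine ⟨R, sa, ?_, R0.mkContinuous_norm_le zero_le_one bound, h1, h2⟩
  rw [ContinuousLinearMap.nonneg_iff_isPositive, ContinuousLinearMap.isPositive_def']
  refine ⟨sa, fun w => ?_⟩
  rw [ContinuousLinearMap.reApplyInnerSelf_apply]
  have h3 := hG.nonneg _ _ (h1 w)
  rw [inner_sub_right, Complex.sub_re] at h3
  have h4 : 0 ≤ (inner ℂ (R w) (R w)).re := inner_self_nonneg (𝕜 := ℂ)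
  simp only [RCLike.re_to_complex]
  linarith

end IsNonnegSelfAdjointGraph

/-- The image of a projection-valued measure under a Borel map. -/
def SpectralMeasure.map (E : SpectralMeasure H) {κ : ℝ → ℝ} (hκ : Measurable κ) :
    SpectralMeasure H where
  proj s := E.proj (κ ⁻¹' s)
  isStarProjection s hs := E.isStarProjection _ (hκ hs)
  proj_univ := E.proj_univ
  hasSum s hs hd u := by
    rw [preimage_iUnion]
    exact E.hasSum _ (fun i => hκ (hs i)) (fun i j hij => (hd hij).preimage κ) u

theorem SpectralMeasure.scalar_map (E : SpectralMeasure H) {κ : ℝ → ℝ} (hκ : Measurable κ) (u : H) :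
    (E.map hκ).scalar u = (E.scalar u).map κ := by
  ext s hs
  rw [Measure.map_apply hκ hs, SpectralMeasure.scalar_apply _ _ hs,
    SpectralMeasure.scalar_apply _ _ (hκ hs)]
  rfl

/-- The identity on `[0, 1]`, extended by `0`. -/
def unitId : ℝ → ℂ := (Icc (0 : ℝ) 1).indicator fun t => (t : ℂ)

theorem bddMeas_unitId : BddMeas unitId := by
  refine ⟨Complex.continuous_ofReal.measurable.indicator measurableSet_Icc, 1, fun t => ?_⟩
  by_cases h : t ∈ Icc (0 : ℝ) 1
  · rw [unitId, indicator_of_mem h, Complex.norm_real, Real.norm_eq_abs, abs_of_nonneg h.1]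
    exact h.2
  · rw [unitId, indicator_of_notMem h]; simp

theorem exists_spectralMeasure_of_contraction {R : H →L[ℂ] H} (hR : IsSelfAdjoint R)
    (h0 : 0 ≤ R) (h1 : ‖R‖ ≤ 1) :
    ∃ E : SpectralMeasure H, E.integral unitId = R ∧ ∀ u, E.scalar u (Icc 0 1)ᶜ = 0 := by
  obtain ⟨E, hE⟩ := exists_spectralMeasure_of_isSelfAdjoint hR
  have spec : ∀ x ∈ spectrum ℝ R, x ∈ Icc (0 : ℝ) 1 := fun x hx =>
    ⟨spectrum_nonneg_of_nonneg h0 hx, (le_abs_self x).trans ((spectrum_abs_le R hx).trans h1)⟩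
  have null : ∀ u, E.scalar u (Icc 0 1)ᶜ = 0 := by
    intro u
    obtain ⟨φ, hφ1, hφ⟩ := exists_tendsto_indicator_of_isClosed (isClosed_Icc (a := (0 : ℝ)) (b := 1))
    -- This function vanishes exactly on `[0, 1]`, which contains the spectrum, so the functional
    -- calculus kills it and its integral is zero. The bound `1` allows the cutoffs to be removed by
    -- dominated convergence.
    let d : C(ℝ, ℝ) := ⟨fun t => min 1 (Metric.infDist t (Icc (0 : ℝ) 1)),
      continuous_const.min (Metric.continuous_infDist_pt _)⟩
    have hd0 : ∀ t, 0 ≤ d t := fun t => le_min zero_le_one Metric.infDist_nonneg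
    have int0 : ∀ n : ℕ, ∫ t, cutoffMul n d t ∂(E.scalar u) = 0 := by
      intro n
      have e1 : cfc (cutoffMul n d : ℝ → ℝ) R = 0 := by
        rw [← cfc_const_zero ℝ R]
        refine cfc_congr fun x hx => ?_
        simp [d, Metric.infDist_zero_of_mem (spec x hx)]
      have := hE (cutoffMul n d) u
      rw [e1, integral_complex_ofReal] at this
      simpa using this.symm
    have int : ∫ t, d t ∂(E.scalar u) = 0 := by
      refine tendsto_nhds_unique (tendsto_integral_of_dominated_convergence (fun _ => 1)
        (F := fun n t => cutoffMul n d t)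
        (fun n => (cutoffMul n d).continuous.aestronglyMeasurable) (integrable_const _)
        (fun n => Eventually.of_forall fun t => ?_) (Eventually.of_forall fun t => ?_))
        ((tendsto_const_nhds (x := (0 : ℝ))).congr fun n => (int0 n).symm)
      · rw [cutoffMul_apply, Real.norm_eq_abs, abs_of_nonneg (mul_nonneg (cutoff_nonneg _ _) (hd0 t))]
        exact mul_le_one₀ (cutoff_le_one _ _) (hd0 t) (min_le_left _ _)
      · refine Tendsto.congr' ?_ tendsto_const_nhds
        filter_upwards [cutoff_eventually t] with n hn
        rw [cutoffMul_apply, hn, one_mul]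
    rw [integral_eq_zero_iff_of_nonneg hd0 (Integrable.of_bound d.continuous.aestronglyMeasurable 1
      (Eventually.of_forall fun t => by
        rw [Real.norm_eq_abs, abs_of_nonneg (hd0 t)]; exact min_le_left _ _))] at int
    refine measure_mono_null (fun t ht => ?_) int
    have hpos : 0 < Metric.infDist t (Icc (0 : ℝ) 1) :=
      (isClosed_Icc.notMem_iff_infDist_pos ⟨0, by simp⟩).1 ht
    exact (lt_min zero_lt_one hpos).ne'
  refine ⟨E, E.integral_eq_of_inner bddMeas_unitId fun u => ?_, null⟩
  let φ := cutoffMul 1 ⟨id, continuous_id⟩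
  have e1 : cfc (φ : ℝ → ℝ) R = R := by
    nth_rewrite 2 [← cfc_id ℝ R]
    refine cfc_congr fun x hx => ?_
    have := spec x hx
    have : |x| ≤ (1 : ℕ) := by rw [abs_of_nonneg this.1]; simpa using this.2
    simp [φ, cutoff_eq_one this]
  rw [← e1, hE φ u]
  refine integral_congr_ae ?_
  filter_upwards [compl_mem_ae_iff.2 (null u)] with t ht
  rw [compl_compl] at ht
  have : |t| ≤ (1 : ℕ) := by rw [abs_of_nonneg ht.1]; simpa using ht.2
  simp [φ, cutoff_eq_one this, unitId, indicator_of_mem ht]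

/-- The spectral theorem for non-negative self-adjoint operators. -/
theorem exists_isResolutionOf {A : H →ₗ.[ℂ] H} (hA : IsNonnegSelfAdjointGraph A.graph) :
    ∃ P : SpectralMeasure H, P.IsResolutionOf A := by
  obtain ⟨R, hR, hR0, hR1, hmem, hinv⟩ := hA.exists_resolvent
  obtain ⟨E, hE, hnull⟩ := exists_spectralMeasure_of_contraction hR hR0 hR1
  have inj : ∀ w, R w = 0 → w = 0 := by
    intro w hw
    have := hmem w
    rw [hw, sub_zero] at this
    exact A.graph_fst_eq_zero_snd this rfl
  -- The identity function vanishes at `0`, so `R` kills the range of `E {0}`; but `R` is injective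
  -- because `A` is single-valued.
  have zero : E.proj {0} = 0 := by
    have m0 := measurableSet_singleton (0 : ℝ)
    have h := E.integral_mul bddMeas_unitId (BddMeas.one.indicator m0)
    have e : unitId * ({0} : Set ℝ).indicator 1 = (0 : ℂ) • 1 := by
      ext t
      by_cases ht : t ∈ ({0} : Set ℝ)
      · simp only [mem_singleton_iff] at ht
        simp [ht, unitId]
      · simp only [mem_singleton_iff] at ht
        simp [ht]
    rw [e, E.integral_smul 0 BddMeas.one, zero_smul, E.integral_indicator m0, hE] at h
    ext u
    exact inj _ (by rw [← mul_apply_eq_comp, ← h]; rfl)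
  -- The inverse of `λ ↦ 1 / (1 + λ)`, which carries the spectrum of `R` back to that of `A`. Its
  -- value at `0` is immaterial, as `E {0} = 0`.
  let κ : ℝ → ℝ := fun r => 1 / r - 1
  have hκ : Measurable κ := (measurable_const.div measurable_id).sub_const 1
  have scal : ∀ w, E.scalar (R w) = (E.scalar w).withDensity fun t => ENNReal.ofReal (‖unitId t‖ ^ 2) := by
    intro w
    rw [← hE]
    exact E.scalar_integral_apply bddMeas_unitId w
  refine ⟨E.map hκ, fun u => ⟨fun hu => ?_, fun hu => ?_⟩, fun u => ?_⟩
  · obtain ⟨y, hy⟩ := LinearPMap.mem_domain_iff.1 hu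
    rw [← hinv u y hy, E.scalar_map hκ, integrable_map_measure
      (by fun_prop) hκ.aemeasurable, ← hE, E.integrable_scalar_integral_iff bddMeas_unitId]
    refine Integrable.of_bound (((bddMeas_unitId.1.norm.pow_const 2).mul
      ((measurable_id.pow_const 2).comp hκ)).aestronglyMeasurable) 1 (Eventually.of_forall fun t => ?_)
    by_cases ht : t ∈ Icc (0 : ℝ) 1
    · rw [unitId, indicator_of_mem ht]
      rcases eq_or_ne t 0 with rfl | h0
      · simp
      · have : ‖(t : ℂ)‖ ^ 2 * (((fun t => t ^ 2) ∘ κ) t) = (1 - t) ^ 2 := by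
          simp only [Complex.norm_real, Real.norm_eq_abs, sq_abs, Function.comp, κ]
          field_simp
        rw [this, Real.norm_eq_abs, abs_of_nonneg (sq_nonneg _)]
        nlinarith [ht.1, ht.2]
    · rw [unitId, indicator_of_notMem ht]; simp
  · rw [E.scalar_map hκ, integrable_map_measure (by fun_prop) hκ.aemeasurable] at hu
    -- In the spectral variable of `R`, `1 / r` stands for `1 + A`. It is square integrable since `1
    -- / r = κ + 1`, so `w = (1 + A) u` is available as a limit of truncations, and `u = R w` lies
    -- in the domain.
    let f : ℝ → ℂ := (Ioc (0 : ℝ) 1).indicator fun r => ((1 / r : ℝ) : ℂ)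
    have mf : Measurable f := (Complex.continuous_ofReal.measurable.comp
      (measurable_const.div measurable_id)).indicator measurableSet_Ioc
    have f2 : Integrable (fun t => ‖f t‖ ^ 2) (E.scalar u) := by
      refine ((hu.const_mul 2).add (integrable_const 2)).mono'
        (mf.norm.pow_const 2).aestronglyMeasurable (Eventually.of_forall fun t => ?_)
      rw [norm_pow, norm_norm]
      by_cases ht : t ∈ Ioc (0 : ℝ) 1
      · simp only [f, indicator_of_mem ht, Complex.norm_real, Real.norm_eq_abs, sq_abs, Pi.add_apply,
          Function.comp, κ]
        nlinarith [sq_nonneg (1 / t - 2)]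
      · simp only [f, indicator_of_notMem ht, Pi.add_apply, Function.comp, κ]
        have : (0 : ℝ) ≤ (1 / t - 1) ^ 2 := sq_nonneg _
        simp only [norm_zero]
        linarith [sq_nonneg (1 / t - 1)]
    obtain ⟨w, hw⟩ := E.exists_tendsto_integral_truncate mf u f2
    have hRw : R w = u := by
      refine tendsto_nhds_unique ((R.continuous.tendsto w).comp hw) ?_
      have l1 := E.tendsto_integral_apply (F := fun n => unitId * SpectralMeasure.truncate f n)
        (f := (Ioc (0 : ℝ) 1).indicator 1) (C := 1)
        (fun n => bddMeas_unitId.1.mul (SpectralMeasure.bddMeas_truncate mf n).1) (fun n t => ?_)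
        (fun t => ?_) u
      · have e2 : E.integral ((Ioc (0 : ℝ) 1).indicator 1) u = u := by
          rw [E.integral_indicator measurableSet_Ioc]
          have e3 : E.proj (Icc 0 1)ᶜ = 0 := ext_inner_quadratic fun v => by
            rw [E.inner_proj v measurableSet_Icc.compl, measureReal_def, hnull]; simp
          have e4 : E.proj (Icc (0 : ℝ) 1) = E.proj {0} + E.proj (Ioc 0 1) := by
            rw [← E.proj_union (measurableSet_singleton _) measurableSet_Ioc (by simp)]
            congr 1
            rw [singleton_union, Ioc_insert_left zero_le_one]
          have e5 := E.proj_union (measurableSet_Icc (a := (0 : ℝ)) (b := 1)) measurableSet_Icc.compl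
            disjoint_compl_right
          rw [union_compl_self, E.proj_univ, e3, add_zero, e4, zero, zero_add] at e5
          rw [← e5]; rfl
        rw [e2] at l1
        refine l1.congr fun n => ?_
        rw [E.integral_mul bddMeas_unitId (SpectralMeasure.bddMeas_truncate mf n), hE]
        rfl
      · rw [Pi.mul_apply, norm_mul]
        refine (mul_le_mul_of_nonneg_left (SpectralMeasure.norm_truncate_le f n t)
          (norm_nonneg _)).trans ?_
        by_cases ht : t ∈ Ioc (0 : ℝ) 1
        · simp only [f, unitId, indicator_of_mem ht, indicator_of_mem (Ioc_subset_Icc_self ht),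
            Complex.norm_real, Real.norm_eq_abs, abs_of_pos ht.1, abs_of_pos (one_div_pos.2 ht.1)]
          rw [mul_one_div_cancel ht.1.ne']
        · simp [f, indicator_of_notMem ht]
      · refine Tendsto.congr' ?_ tendsto_const_nhds
        filter_upwards [SpectralMeasure.truncate_eventually f t] with n hn
        rw [Pi.mul_apply, hn]
        by_cases ht : t ∈ Ioc (0 : ℝ) 1
        · simp only [f, unitId, indicator_of_mem ht, indicator_of_mem (Ioc_subset_Icc_self ht)]
          have := ht.1.ne'
          push_cast
          rw [mul_one_div_cancel (by exact_mod_cast this)]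
          rfl
        · simp [f, indicator_of_notMem ht]
    rw [← hRw]
    exact LinearPMap.mem_domain_of_mem_graph (hmem w)
  · obtain ⟨u, hu⟩ := u
    obtain ⟨y, hy⟩ := LinearPMap.mem_domain_iff.1 hu
    have hy' : A ⟨u, hu⟩ = y := by
      obtain ⟨z, hz1, hz2⟩ := (LinearPMap.mem_graph_iff A).1 hy
      have : z = ⟨u, hu⟩ := Subtype.ext hz1
      rw [← this, hz2]
    have hw := hinv u y hy
    -- With `u = R w` and `A u = w - R w`, both sides are integrals over the spectral measure of
    -- `w`, with the integrands `r (1 - r)` and `r² κ(r)`, which agree on `[0, 1]`.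
    set w := u + y with hwdef
    have hyw : y = w - R w := by rw [hw, hwdef]; abel
    simp only
    rw [hy', hyw, ← hw, E.scalar_map hκ, integral_map hκ.aemeasurable
      (Complex.continuous_ofReal.measurable.aestronglyMeasurable)]
    nth_rewrite 1 2 3 [← hE]
    rw [E.integral_scalar_integral bddMeas_unitId]
    have hn : BddMeas (1 - unitId) := by
      rw [sub_eq_add_neg]
      exact BddMeas.one.add (by simpa using bddMeas_unitId.smul (-1))
    have e1 : w - E.integral unitId w = E.integral (1 - unitId) w := by
      rw [E.integral_sub BddMeas.one bddMeas_unitId, E.integral_one]; rfl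
    rw [e1, ← ContinuousLinearMap.adjoint_inner_right, ← E.integral_star bddMeas_unitId,
      ← mul_apply_eq_comp, ← E.integral_mul bddMeas_unitId.star hn,
      E.inner_integral (bddMeas_unitId.star.mul hn)]
    refine integral_congr_ae (Eventually.of_forall fun t => ?_)
    by_cases ht : t ∈ Icc (0 : ℝ) 1
    · simp only [Pi.mul_apply, Pi.star_apply, Pi.sub_apply, Pi.one_apply, unitId,
        indicator_of_mem ht, κ, Complex.norm_real, Real.norm_eq_abs, sq_abs, RCLike.star_def,
        Complex.conj_ofReal]
      norm_cast
      rcases eq_or_ne t 0 with rfl | h0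
      · simp
      · field_simp
    · simp [unitId, indicator_of_notMem ht]

theorem LinearPMap.mem_graph_neg_iff (Δ : H →ₗ.[ℂ] H) (x y : H) :
    (x, y) ∈ (-Δ).graph ↔ (x, -y) ∈ Δ.graph := by
  simp only [LinearPMap.mem_graph_iff, LinearPMap.neg_apply]
  constructor
  · rintro ⟨z, hz, hy⟩
    exact ⟨z, hz, by rw [← hy, neg_neg]⟩
  · rintro ⟨z, hz, hy⟩
    exact ⟨z, hz, by
      have hy' : Δ z = -y := hy
      change -Δ z = y
      rw [hy', neg_neg]⟩

theorem isNonnegSelfAdjointGraph_neg {Δ : H →ₗ.[ℂ] H} (h : IsSelfAdjoint Δ)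
    (h' : ∀ u : Δ.domain, (inner ℂ (u : H) (Δ u)).re ≤ 0) :
    IsNonnegSelfAdjointGraph (-Δ).graph := by
  have mem := Δ.mem_graph_neg_iff
  have key := LinearPMap.adjoint_graph_eq_graph_adjoint h.dense_domain
  rw [LinearPMap.isSelfAdjoint_def.1 h] at key
  refine ⟨fun x y => ?_, fun a b hab => ?_⟩
  · rw [mem, key, Submodule.mem_adjoint_iff]
    constructor
    · intro H a b hab
      have := H a (-b) ((mem a b).1 hab)
      simp only [inner_neg_left, inner_neg_right] at this
      linear_combination -this
    · intro H a b hab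
      have := H a (-b) ((mem a (-b)).2 (by rwa [neg_neg]))
      simp only [inner_neg_left, inner_neg_right] at this ⊢
      linear_combination -this
  · rw [mem] at hab
    obtain ⟨z, hz1, hz2⟩ := (LinearPMap.mem_graph_iff Δ).1 hab
    have := h' z
    rw [hz1, hz2, inner_neg_right, Complex.neg_re] at this
    linarith

theorem tendsto_inner_of_quadratic {V : Type*} [AddCommGroup V] [Module ℂ V] (ι : V →ₗ[ℂ] H)
    (T : ℕ → V →ₗ[ℂ] H) (S : V →ₗ[ℂ] H)
    (h : ∀ u, Tendsto (fun n => inner ℂ (ι u) (T n u)) atTop (𝓝 (inner ℂ (ι u) (S u)))) (x y : V) :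
    Tendsto (fun n => inner ℂ (ι x) (T n y)) atTop (𝓝 (inner ℂ (ι x) (S y))) := by
  rw [inner_map_eq_polarForm ι S]
  exact (polarForm_tendsto h x y).congr fun n => (inner_map_eq_polarForm ι (T n) x y).symm

/-- A resolution gives only the quadratic form of `A`. Truncations of `λ` approximate that form on
the domain, polarization extends this to the sesquilinear form, and density of the domain then
identifies `A f(A) v` with `(λ f)(A) v`. -/
theorem SpectralMeasure.IsResolutionOf.mem_graph {P : SpectralMeasure H} {A : H →ₗ.[ℂ] H}
    (hP : P.IsResolutionOf A) (hA : Dense (A.domain : Set H)) {f : ℝ → ℂ} (hf : BddMeas f)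
    (hf' : BddMeas fun t => (t : ℂ) * f t) (v : H) :
    (P.integral f v, P.integral (fun t => (t : ℂ) * f t) v) ∈ A.graph := by
  have hD : P.integral f v ∈ A.domain := by
    rw [hP.1, P.integrable_scalar_integral_iff hf]
    have := ((hf'.mul hf'.star).integrable (P.scalar v)).norm
    refine this.congr (Eventually.of_forall fun t => ?_)
    simp only [Pi.mul_apply, Pi.star_apply, norm_mul, norm_star, Complex.norm_real, Real.norm_eq_abs]
    rw [← sq_abs t]
    ring
  rw [LinearPMap.mem_graph_iff]
  refine ⟨⟨_, hD⟩, rfl, ?_⟩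
  let χ : ℕ → ℝ → ℂ := SpectralMeasure.truncate fun t => (t : ℂ)
  have mid : Measurable fun t : ℝ => (t : ℂ) := Complex.continuous_ofReal.measurable
  have hχ : ∀ n, BddMeas (χ n) := SpectralMeasure.bddMeas_truncate mid
  have lim : ∀ u : A.domain, Tendsto (fun n => inner ℂ (u : H) (P.integral (χ n) (u : H))) atTop
      (𝓝 (inner ℂ (u : H) (A u))) := by
    intro u
    have sq : Integrable (fun t : ℝ => t ^ 2) (P.scalar (u : H)) := (hP.1 (u : H)).1 u.2
    have int : Integrable (fun t : ℝ => 1 + t ^ 2) (P.scalar (u : H)) := (integrable_const 1).add sq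
    rw [hP.2 u]
    simp_rw [P.inner_integral (hχ _)]
    refine tendsto_integral_of_dominated_convergence (fun t => 1 + t ^ 2)
      (fun n => (hχ n).1.aestronglyMeasurable)
      int (fun n => Eventually.of_forall fun t => ?_)
      (Eventually.of_forall fun t => ?_)
    · refine (SpectralMeasure.norm_truncate_le _ n t).trans ?_
      rw [Complex.norm_real, Real.norm_eq_abs]
      nlinarith [sq_abs t, sq_nonneg (|t| - 1), abs_nonneg t]
    · refine Tendsto.congr' ?_ tendsto_const_nhds
      filter_upwards [SpectralMeasure.truncate_eventually (fun t : ℝ => (t : ℂ)) t] with n hn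
      exact hn.symm
  have lim2 : ∀ x u : A.domain, Tendsto (fun n => inner ℂ (x : H) (P.integral (χ n) (u : H))) atTop
      (𝓝 (inner ℂ (x : H) (A u))) := by
    intro x u
    exact tendsto_inner_of_quadratic A.domain.subtype
      (fun n => (P.integral (χ n) : H →ₗ[ℂ] H) ∘ₗ A.domain.subtype) A.toFun lim x u
  refine hA.eq_of_inner_right ℂ fun x hx => ?_
  refine tendsto_nhds_unique (lim2 ⟨x, hx⟩ ⟨_, hD⟩) ?_
  obtain ⟨C, hC⟩ := hf'.2
  have l2 := P.tendsto_inner_integral (F := fun n => χ n * f) (C := C)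
    (f := fun t => (t : ℂ) * f t) (fun n => (hχ n).1.mul hf.1) (fun n t => ?_) (fun t => ?_) x v
  · refine l2.congr fun n => ?_
    rw [P.integral_mul (hχ n) hf]
    rfl
  · refine le_trans ?_ (hC t)
    rw [Pi.mul_apply, norm_mul, norm_mul]
    exact mul_le_mul_of_nonneg_right (SpectralMeasure.norm_truncate_le _ n t) (norm_nonneg _)
  · refine Tendsto.congr' ?_ tendsto_const_nhds
    filter_upwards [SpectralMeasure.truncate_eventually (fun t : ℝ => (t : ℂ)) t] with n hn
    simp only [χ, Pi.mul_apply, hn]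

end UnboundedSpectralTheorem

end

noncomputable section

/-! ### Consequences of the doubling condition. -/

section Doubling

variable {X : Type*} [MetricSpace X] [MeasurableSpace X] {μ : Measure X}

theorem IsDoubling.sigmaFinite (hμ : IsDoubling μ) : SigmaFinite μ := by
  rcases isEmpty_or_nonempty X with hX | ⟨⟨x⟩⟩
  · have : μ = 0 := Measure.eq_zero_of_isEmpty μ
    rw [this]; infer_instance
  · refine ⟨⟨⟨fun n => Metric.ball x (n + 1), fun _ => trivial,
      fun n => (hμ.1 x (n + 1) (by positivity)).2, ?_⟩⟩⟩
    refine eq_univ_of_forall fun y => mem_iUnion.2 ?_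
    obtain ⟨n, hn⟩ := exists_nat_gt (dist y x)
    exact ⟨n, Metric.mem_ball.2 (by linarith)⟩

theorem IsDoubling.isOpenPosMeasure (hμ : IsDoubling μ) : μ.IsOpenPosMeasure where
  open_pos U hU hne h0 := by
    obtain ⟨x, hx⟩ := hne
    obtain ⟨r, hr, hs⟩ := Metric.isOpen_iff.1 hU x hx
    exact (hμ.1 x r hr).1.ne' (measure_mono_null hs h0)

/-- By Zorn's lemma. The alternative `x = y` is needed only for `ε ≤ 0`. -/
theorem exists_maximal_separated {X : Type*} [MetricSpace X] (ε : ℝ) : ∃ N : Set X,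
    (∀ x ∈ N, ∀ y ∈ N, x ≠ y → ε ≤ dist x y) ∧ ∀ x, ∃ y ∈ N, dist x y < ε ∨ x = y := by
  obtain ⟨N, hN⟩ := zorn_subset {N : Set X | ∀ x ∈ N, ∀ y ∈ N, x ≠ y → ε ≤ dist x y} (by
    intro c hc hchain
    refine ⟨⋃₀ c, ?_, fun s hs => subset_sUnion_of_mem hs⟩
    rintro x ⟨s, hs, hx⟩ y ⟨t, ht, hy⟩ hxy
    rcases hchain.total hs ht with h | h
    · exact hc ht x (h hx) y hy hxy
    · exact hc hs x hx y (h hy) hxy)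
  refine ⟨N, hN.prop, fun x => ?_⟩
  by_contra! hcon
  have hx : x ∉ N := fun hx => (hcon x hx).2 rfl
  have : insert x N ⊆ N := by
    refine hN.le_of_ge ?_ (subset_insert x N)
    rintro a (rfl | ha) b (rfl | hb) hab
    · exact absurd rfl hab
    · exact (hcon b hb).1
    · rw [dist_comm]; exact (hcon a ha).1
    · exact hN.prop a ha b hb hab
  exact hx (this (mem_insert x N))

/-- The half-radius balls around a maximal `ε`-separated set are disjoint and of positive measure,
so σ-finiteness makes the set countable. -/
theorem IsDoubling.secondCountableTopology [OpensMeasurableSpace X] (hμ : IsDoubling μ) :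
    SecondCountableTopology X := by
  have := hμ.sigmaFinite
  refine Metric.secondCountable_of_almost_dense_set fun ε hε => ?_
  obtain ⟨N, hN, hmax⟩ := exists_maximal_separated (X := X) ε
  refine ⟨N, ?_, fun x => ?_⟩
  · have := Measure.countable_meas_pos_of_disjoint_iUnion (μ := μ)
      (As := fun x : N => Metric.ball (x : X) (ε / 2)) (fun _ => measurableSet_ball)
      (fun x y hxy => Metric.ball_disjoint_ball (by
        have := hN x x.2 y y.2 (fun h => hxy (Subtype.ext h))
        linarith))
    have e : {i : N | 0 < μ (Metric.ball (i : X) (ε / 2))} = univ :=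
      eq_univ_of_forall fun i => (hμ.1 i (ε / 2) (by positivity)).1
    rw [e, countable_univ_iff] at this
    exact this
  · obtain ⟨y, hy, h | rfl⟩ := hmax x
    · exact ⟨y, hy, h.le⟩
    · exact ⟨x, hy, by simpa using hε.le⟩

/-- Balls of radius `2^k` have measure at most `C^k` times that of the unit ball. With `2^N > C`,
the dyadic shells contribute a geometric series of ratio `C / 2^N`. -/
theorem IsDoubling.exists_integrable_decay [BorelSpace X] (hμ : IsDoubling μ) :
    ∃ N : ℕ, ∀ x : X, Integrable (fun z => ((1 + dist x z) ^ N)⁻¹) μ := by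
  obtain ⟨hball, C, hC, hdoub⟩ := hμ
  obtain ⟨N, hN⟩ := pow_unbounded_of_one_lt C (one_lt_two)
  refine ⟨N, fun x => ?_⟩
  have growth : ∀ k : ℕ, μ (Metric.ball x (2 ^ k))
      ≤ ENNReal.ofReal C ^ k * μ (Metric.ball x 1) := by
    intro k
    induction k with
    | zero => simp
    | succ k ih =>
      rw [pow_succ' 2, pow_succ', mul_assoc]
      exact (hdoub x (2 ^ k) (by positivity)).trans (mul_le_mul_right ih _)
  have cont : Continuous fun z => ((1 + dist x z) ^ N)⁻¹ :=
    Continuous.inv₀ (by fun_prop) fun z => by positivity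
  refine ⟨cont.aestronglyMeasurable, ?_⟩
  rw [hasFiniteIntegral_iff_ofReal (Eventually.of_forall fun z => by positivity)]
  let c : ℕ → ENNReal := fun k => ENNReal.ofReal (2 ^ N * ((2 ^ N)⁻¹) ^ k)
  have pt : ∀ z, ENNReal.ofReal ((1 + dist x z) ^ N)⁻¹
      ≤ ∑' k, (Metric.ball x (2 ^ k)).indicator (fun _ => c k) z := by
    intro z
    suffices h : ∃ k : ℕ, dist z x < 2 ^ k ∧ ((1 + dist x z) ^ N)⁻¹ ≤ 2 ^ N * ((2 ^ N)⁻¹) ^ k by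
      obtain ⟨k, hk, hle⟩ := h
      refine le_trans ?_ (ENNReal.le_tsum k)
      rw [indicator_of_mem (Metric.mem_ball.2 hk)]
      exact ENNReal.ofReal_le_ofReal hle
    rw [dist_comm z x]
    rcases lt_or_ge (dist x z) 1 with h | h
    · refine ⟨0, by simpa using h, ?_⟩
      have h1 : (1 : ℝ) ≤ (1 + dist x z) ^ N := one_le_pow₀ (by linarith [dist_nonneg (x := x) (y := z)])
      have h2 : (1 : ℝ) ≤ 2 ^ N := one_le_pow₀ one_le_two
      simpa using (inv_le_one_of_one_le₀ h1).trans h2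
    · obtain ⟨k, hk1, hk2⟩ := exists_nat_pow_near h (one_lt_two (α := ℝ))
      refine ⟨k + 1, hk2, ?_⟩
      have h3 : ((2 : ℝ) ^ k) ^ N ≤ (1 + dist x z) ^ N :=
        pow_le_pow_left₀ (by positivity) (by linarith) N
      have h4 : (2 : ℝ) ^ N * ((2 ^ N)⁻¹) ^ (k + 1) = (((2 : ℝ) ^ k) ^ N)⁻¹ := by
        rw [pow_succ, ← pow_mul, mul_comm k N, pow_mul, inv_pow]
        field_simp
      rw [h4]
      exact inv_anti₀ (by positivity) h3
  refine (lintegral_mono pt).trans_lt ?_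
  rw [lintegral_tsum fun k => (measurable_const.indicator measurableSet_ball).aemeasurable]
  simp_rw [lintegral_indicator_const measurableSet_ball]
  have le : ∀ k, c k * μ (Metric.ball x (2 ^ k))
      ≤ ENNReal.ofReal (2 ^ N) * μ (Metric.ball x 1) * ENNReal.ofReal (C / 2 ^ N) ^ k := by
    intro k
    refine (mul_le_mul_right (growth k) _).trans (le_of_eq ?_)
    have : c k = ENNReal.ofReal (2 ^ N) * ENNReal.ofReal ((2 ^ N)⁻¹) ^ k := by
      simp only [c]
      rw [ENNReal.ofReal_mul (by positivity),
        ENNReal.ofReal_pow (show (0 : ℝ) ≤ (2 ^ N)⁻¹ by positivity)]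
    rw [this, div_eq_mul_inv, ENNReal.ofReal_mul hC.le, mul_pow]
    ring
  refine (ENNReal.tsum_le_tsum le).trans_lt ?_
  rw [ENNReal.tsum_mul_left, ENNReal.tsum_geometric]
  refine ENNReal.mul_lt_top (ENNReal.mul_lt_top ENNReal.ofReal_lt_top (hball x 1 one_pos).2) ?_
  rw [ENNReal.inv_lt_top, tsub_pos_iff_lt, ENNReal.ofReal_lt_one, div_lt_one (by positivity)]
  exact hN

end Doubling

/-! ### Stretched exponentials against powers. -/

section ExponentialBounds

theorem exists_rpow_mul_exp_neg_le {a q : ℝ} (ha : 0 < a) (hq : 0 ≤ q) :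
    ∃ C : ℝ, ∀ s : ℝ, 0 ≤ s → s ^ q * Real.exp (-a * s) ≤ C := by
  have h := tendsto_rpow_mul_exp_neg_mul_atTop_nhds_zero q a ha
  obtain ⟨M, hM⟩ := eventually_atTop.1 (h.eventually (gt_mem_nhds zero_lt_one))
  have cont : ContinuousOn (fun s : ℝ => s ^ q * Real.exp (-a * s)) (Icc 0 (max M 0)) := by
    refine Continuous.continuousOn ?_
    exact (Real.continuous_rpow_const hq).mul (by fun_prop)
  obtain ⟨C, hC⟩ := isCompact_Icc.exists_bound_of_continuousOn cont
  refine ⟨max C 1, fun s hs => ?_⟩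
  rcases le_total s (max M 0) with h1 | h1
  · exact ((le_abs_self _).trans (hC s ⟨hs, h1⟩)).trans (le_max_left _ _)
  · exact (hM s ((le_max_left _ _).trans h1)).le.trans (le_max_right _ _)

theorem exists_exp_neg_le_inv_pow {a b : ℝ} (ha : 0 < a) (hb : 0 < b) (N : ℕ) :
    ∃ C : ℝ, 0 < C ∧ ∀ r : ℝ, 0 ≤ r → Real.exp (-(a * r ^ b)) ≤ C * ((1 + r) ^ N)⁻¹ := by
  obtain ⟨C, hC⟩ := exists_rpow_mul_exp_neg_le ha (div_nonneg N.cast_nonneg hb.le : 0 ≤ (N : ℝ) / b)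
  refine ⟨2 ^ N * (1 + |C|), by positivity, fun r hr => ?_⟩
  rw [← div_eq_mul_inv, le_div_iff₀ (by positivity)]
  have h1 := hC (r ^ b) (by positivity)
  rw [← Real.rpow_mul hr, mul_div_cancel₀ _ hb.ne', Real.rpow_natCast, neg_mul] at h1
  have hE : Real.exp (-(a * r ^ b)) ≤ 1 := Real.exp_le_one_iff.2 (by
    have := Real.rpow_nonneg hr b
    nlinarith [mul_nonneg ha.le this])
  have hE0 := Real.exp_pos (-(a * r ^ b))
  have h2 : (1 + r) ^ N ≤ 2 ^ N * (1 + r ^ N) := by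
    rcases le_total r 1 with h | h
    · calc (1 + r) ^ N ≤ 2 ^ N := pow_le_pow_left₀ (by positivity) (by linarith) N
        _ ≤ 2 ^ N * (1 + r ^ N) := le_mul_of_one_le_right (by positivity) (by
          have := pow_nonneg hr N; linarith)
    · calc (1 + r) ^ N ≤ (2 * r) ^ N := pow_le_pow_left₀ (by positivity) (by linarith) N
        _ = 2 ^ N * r ^ N := mul_pow _ _ _
        _ ≤ 2 ^ N * (1 + r ^ N) := mul_le_mul_of_nonneg_left (by linarith) (by positivity)
  calc Real.exp (-(a * r ^ b)) * (1 + r) ^ N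
      ≤ Real.exp (-(a * r ^ b)) * (2 ^ N * (1 + r ^ N)) := mul_le_mul_of_nonneg_left h2 hE0.le
    _ = 2 ^ N * (Real.exp (-(a * r ^ b)) + r ^ N * Real.exp (-(a * r ^ b))) := by ring
    _ ≤ 2 ^ N * (1 + |C|) :=
        mul_le_mul_of_nonneg_left (add_le_add hE (h1.trans (le_abs_self C))) (by positivity)

end ExponentialBounds

/-! ### The bilinear pairing on `L²` and measurable families of `L²` functions. -/

section Bilinear

variable {X : Type*} [MeasurableSpace X] {μ : Measure X}

/-- The bilinear pairing `∫ f g` on `L²`. -/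
def bilin (f g : Lp ℂ 2 μ) : ℂ := inner ℂ (star f) g

theorem bilin_eq_integral (f g : Lp ℂ 2 μ) : bilin f g = ∫ x, f x * g x ∂μ := by
  rw [bilin, L2.inner_def]
  refine integral_congr_ae ?_
  filter_upwards [Lp.coeFn_star f] with x hx
  rw [hx]
  simp [mul_comm]

theorem bilin_comm (f g : Lp ℂ 2 μ) : bilin f g = bilin g f := by
  rw [bilin_eq_integral, bilin_eq_integral]
  simp_rw [mul_comm]

theorem Lp.norm_star_L2 (f : Lp ℂ 2 μ) : ‖star f‖ = ‖f‖ := by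
  rw [Lp.norm_def, Lp.norm_def]
  congr 1
  refine eLpNorm_congr_norm_ae ?_
  filter_upwards [Lp.coeFn_star f] with x hx
  rw [hx]; simp

theorem norm_bilin_le (f g : Lp ℂ 2 μ) : ‖bilin f g‖ ≤ ‖f‖ * ‖g‖ := by
  rw [bilin, ← Lp.norm_star_L2 f]
  exact norm_inner_le_norm _ _

theorem bilin_star (f g : Lp ℂ 2 μ) : bilin (star f) g = inner ℂ f g := by
  rw [bilin, star_star]

/-- The pairing as a continuous bilinear map. -/
def bilinCLM (f : Lp ℂ 2 μ) : Lp ℂ 2 μ →L[ℂ] ℂ := innerSL ℂ (star f)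

theorem bilin_add_right (f g g' : Lp ℂ 2 μ) : bilin f (g + g') = bilin f g + bilin f g' :=
  inner_add_right _ _ _

theorem bilin_sub_right (f g g' : Lp ℂ 2 μ) : bilin f (g - g') = bilin f g - bilin f g' :=
  inner_sub_right _ _ _

theorem bilin_smul_right (c : ℂ) (f g : Lp ℂ 2 μ) : bilin f (c • g) = c * bilin f g :=
  inner_smul_right _ _ _

theorem bilin_sub_left (f f' g : Lp ℂ 2 μ) : bilin (f - f') g = bilin f g - bilin f' g := by
  rw [bilin_comm, bilin_sub_right, bilin_comm g, bilin_comm g]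

theorem continuous_bilin : Continuous fun q : Lp ℂ 2 μ × Lp ℂ 2 μ => bilin q.1 q.2 := by
  rw [continuous_iff_continuousAt]
  rintro ⟨f, g⟩
  rw [ContinuousAt, tendsto_iff_norm_sub_tendsto_zero]
  have bound : ∀ q : Lp ℂ 2 μ × Lp ℂ 2 μ,
      ‖bilin q.1 q.2 - bilin f g‖ ≤ ‖q.1 - f‖ * ‖q.2‖ + ‖f‖ * ‖q.2 - g‖ := by
    intro q
    have : bilin q.1 q.2 - bilin f g = bilin (q.1 - f) q.2 + bilin f (q.2 - g) := by
      rw [bilin_sub_left, bilin_sub_right]; ring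
    rw [this]
    exact (norm_add_le _ _).trans (add_le_add (norm_bilin_le _ _) (norm_bilin_le _ _))
  refine squeeze_zero (fun _ => norm_nonneg _) bound ?_
  have : Continuous fun q : Lp ℂ 2 μ × Lp ℂ 2 μ => ‖q.1 - f‖ * ‖q.2‖ + ‖f‖ * ‖q.2 - g‖ := by
    fun_prop
  have := this.tendsto (f, g)
  simpa using this

theorem eq_of_bilin {f g : Lp ℂ 2 μ} (h : ∀ w, bilin w f = bilin w g) : f = g :=
  ext_inner_left ℂ fun v => by rw [← bilin_star, h, bilin_star]

theorem eq_of_bilin_denseSeq [SecondCountableTopology (Lp ℂ 2 μ)] {f g : Lp ℂ 2 μ}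
    (h : ∀ n, bilin (TopologicalSpace.denseSeq (Lp ℂ 2 μ) n) f
      = bilin (TopologicalSpace.denseSeq (Lp ℂ 2 μ) n) g) : f = g := by
  refine eq_of_bilin fun w => ?_
  have c : ∀ f : Lp ℂ 2 μ, Continuous fun w => bilin w f := fun f =>
    continuous_bilin.comp (continuous_id.prodMk continuous_const)
  have := (TopologicalSpace.denseRange_denseSeq (Lp ℂ 2 μ)).equalizer (c f) (c g) (funext h)
  exact congrFun this w

/-- The class in `L²` of a real function. -/
def sectionLp (μ : Measure X) (f : X → ℝ) : Lp ℂ 2 μ := by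
  classical
  exact if h : MemLp (fun z => (f z : ℂ)) 2 μ then h.toLp else 0

theorem coeFn_sectionLp {f : X → ℝ} (h : MemLp (fun z => (f z : ℂ)) 2 μ) :
    sectionLp μ f =ᵐ[μ] fun z => (f z : ℂ) := by
  unfold sectionLp
  rw [dif_pos h]
  exact h.coeFn_toLp

theorem bilin_sectionLp {f : X → ℝ} (h : MemLp (fun z => (f z : ℂ)) 2 μ) (g : Lp ℂ 2 μ) :
    bilin (sectionLp μ f) g = ∫ z, (f z : ℂ) * g z ∂μ := by
  rw [bilin_eq_integral]
  refine integral_congr_ae ?_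
  filter_upwards [coeFn_sectionLp h] with z hz
  rw [hz]

theorem norm_sq_L2 (f : Lp ℂ 2 μ) : ‖f‖ ^ 2 = ∫ x, ‖f x‖ ^ 2 ∂μ := by
  have h : inner ℂ f f = ∫ x, ((‖f x‖ ^ 2 : ℝ) : ℂ) ∂μ := by
    rw [L2.inner_def]
    refine integral_congr_ae (Eventually.of_forall fun x => ?_)
    simp only [inner_self_eq_norm_sq_to_K]
    norm_cast
  rw [integral_complex_ofReal, inner_self_eq_norm_sq_to_K] at h
  apply Complex.ofReal_injective
  rw [← h]
  norm_cast

theorem norm_sq_sectionLp_sub {f : X → ℝ} (h : MemLp (fun z => (f z : ℂ)) 2 μ) (g : Lp ℂ 2 μ) :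
    ‖sectionLp μ f - g‖ ^ 2 = ∫ z, ‖(f z : ℂ) - g z‖ ^ 2 ∂μ := by
  rw [norm_sq_L2]
  refine integral_congr_ae ?_
  filter_upwards [Lp.coeFn_sub (sectionLp μ f) g, coeFn_sectionLp h] with z h1 h2
  rw [h1, Pi.sub_apply, h2]

/-- An open set is a countable union of balls, and preimages of balls are described by distances.
For maps into `L²` the distances are integrals with a parameter, which are measurable by Fubini. -/
theorem measurable_of_forall_dist {α β : Type*} [MeasurableSpace α] [PseudoMetricSpace β]
    [SecondCountableTopology β] [MeasurableSpace β] [BorelSpace β] {F : α → β}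
    (h : ∀ b, Measurable fun a => dist (F a) b) : Measurable F := by
  refine measurable_of_isOpen fun U hU => ?_
  obtain ⟨s, -, hs, hsU⟩ := TopologicalSpace.isOpen_biUnion_countable U (fun b : β =>
    Metric.ball b (Metric.infDist b Uᶜ)) fun _ _ => Metric.isOpen_ball
  rcases eq_empty_or_nonempty Uᶜ with he | hne
  · rw [compl_empty_iff.1 he]; exact MeasurableSet.univ
  have e : U = ⋃ b ∈ s, Metric.ball b (Metric.infDist b Uᶜ) := by
    rw [hsU]
    refine Subset.antisymm (fun b hb => ?_) (iUnion₂_subset fun b hb c hc => ?_)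
    · refine mem_iUnion₂.2 ⟨b, hb, Metric.mem_ball_self ?_⟩
      exact (hU.isClosed_compl.notMem_iff_infDist_pos hne).1 (by simpa using hb)
    · by_contra hcU
      have := Metric.infDist_le_dist_of_mem (x := b) (show c ∈ Uᶜ from hcU)
      rw [Metric.mem_ball, dist_comm] at hc
      linarith
  rw [e, preimage_iUnion₂]
  exact MeasurableSet.biUnion hs fun b _ => measurableSet_lt (h b) measurable_const

theorem measurable_sectionLp {Y : Type*} [MeasurableSpace Y] [SFinite μ]
    [SecondCountableTopology (Lp ℂ 2 μ)] [MeasurableSpace (Lp ℂ 2 μ)] [BorelSpace (Lp ℂ 2 μ)]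
    {F : Y → X → ℝ} (hF : Measurable fun q : Y × X => F q.1 q.2)
    (h : ∀ y, MemLp (fun z => (F y z : ℂ)) 2 μ) : Measurable fun y => sectionLp μ (F y) := by
  refine measurable_of_forall_dist fun b => ?_
  have hb := (Lp.stronglyMeasurable b).measurable
  have e : ∀ y, dist (sectionLp μ (F y)) b = √(∫ z, ‖(F y z : ℂ) - b z‖ ^ 2 ∂μ) := by
    intro y
    rw [dist_eq_norm, ← norm_sq_sectionLp_sub (h y), Real.sqrt_sq (norm_nonneg _)]
  simp_rw [e]
  refine Measurable.sqrt ?_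
  have m : Measurable fun q : Y × X => ‖(F q.1 q.2 : ℂ) - b q.2‖ ^ 2 :=
    (((Complex.continuous_ofReal.measurable.comp hF).sub (hb.comp measurable_snd)).norm).pow_const 2
  exact (m.stronglyMeasurable.integral_prod_right (ν := μ)).measurable

end Bilinear

end

noncomputable section

set_option linter.unusedSectionVars false

/-! ### The symbol of the heat semigroup without null space. -/

section HeatFunction

/-- The function `e^{-ts}` on `(0, ∞)`, extended by `0`. -/
def heatFn (t : ℝ) : ℝ → ℂ := (Ioi 0).indicator fun s => Complex.exp (-((t : ℂ) * (s : ℂ)))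

theorem heatFn_of_pos (t : ℝ) {s : ℝ} (hs : 0 < s) :
    heatFn t s = Complex.exp (-((t : ℂ) * (s : ℂ))) :=
  indicator_of_mem (show s ∈ Ioi 0 from hs) _

theorem heatFn_of_nonpos (t : ℝ) {s : ℝ} (hs : s ≤ 0) : heatFn t s = 0 :=
  indicator_of_notMem (show s ∉ Ioi 0 from not_lt.2 hs) _

theorem norm_exp_neg_mul (t s : ℝ) :
    ‖Complex.exp (-((t : ℂ) * (s : ℂ)))‖ = Real.exp (-(t * s)) := by
  rw [Complex.norm_exp]
  norm_cast

theorem measurable_heatFn (t : ℝ) : Measurable (heatFn t) :=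
  Measurable.indicator (by fun_prop) measurableSet_Ioi

theorem norm_heatFn_le {t : ℝ} (ht : 0 ≤ t) (s : ℝ) : ‖heatFn t s‖ ≤ 1 := by
  rcases lt_or_ge 0 s with hs | hs
  · rw [heatFn_of_pos t hs, norm_exp_neg_mul]
    exact Real.exp_le_one_iff.2 (by nlinarith [mul_nonneg ht hs.le])
  · rw [heatFn_of_nonpos t hs]; simp

theorem bddMeas_heatFn {t : ℝ} (ht : 0 ≤ t) : BddMeas (heatFn t) :=
  ⟨measurable_heatFn t, 1, norm_heatFn_le ht⟩

theorem heatFn_mul (s t : ℝ) : heatFn s * heatFn t = heatFn (s + t) := by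
  ext r
  rw [Pi.mul_apply]
  rcases lt_or_ge 0 r with hr | hr
  · rw [heatFn_of_pos _ hr, heatFn_of_pos _ hr, heatFn_of_pos _ hr, ← Complex.exp_add]
    congr 1
    push_cast
    ring
  · rw [heatFn_of_nonpos _ hr, heatFn_of_nonpos _ hr, heatFn_of_nonpos _ hr, zero_mul]

theorem star_heatFn (t : ℝ) : star (heatFn t) = heatFn t := by
  ext r
  rw [Pi.star_apply]
  rcases lt_or_ge 0 r with hr | hr
  · rw [heatFn_of_pos _ hr, RCLike.star_def, ← Complex.exp_conj]
    simp
  · rw [heatFn_of_nonpos _ hr, star_zero]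

end HeatFunction

/-! ### The heat kernel: decay, ultracontractivity, symmetry, semigroup law. -/

variable {X : Type*} [MetricSpace X] [MeasurableSpace X] {μ : Measure X}

theorem dense_integrable_L2 {X : Type*} [MeasurableSpace X] {μ : Measure X} :
    Dense {f : Lp ℂ 2 μ | Integrable f μ} := by
  have h2 : Fact ((2 : ENNReal) ≠ ⊤) := ⟨by norm_num⟩
  refine (Lp.simpleFunc.denseRange (E := ℂ) (μ := μ) (p := 2) (by norm_num)).mono ?_
  rintro _ ⟨s, rfl⟩
  have := (SimpleFunc.memLp_iff_integrable (p := 2) (by norm_num) (by norm_num)).1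
    (Lp.simpleFunc.memLp s)
  exact this.congr (Lp.simpleFunc.toSimpleFunc_eq_toFun s)

/-- A real kernel of the heat semigroup `∫_{(0,∞)} e^{-tλ} dP(λ)` with sub-Gaussian bounds. -/
structure IsRealHeatKernel (P : SpectralMeasure (Lp ℂ 2 μ)) (k : ℝ → X → X → ℝ)
    (d γ c₁ c₂ : ℝ) : Prop where
  doubling : IsDoubling μ
  d_pos : 0 < d
  γ_pos : 0 < γ
  c₁_pos : 0 < c₁
  c₂_pos : 0 < c₂
  measurable : ∀ t, 0 < t → Measurable fun q : X × X => k t q.1 q.2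
  kernel : ∀ t, 0 < t → ∀ u : Lp ℂ 2 μ, ∀ᵐ x ∂μ,
    P.integral (heatFn t) u x = ∫ y, (k t x y : ℂ) * u y ∂μ
  bound : ∀ t, 0 < t → ∀ x y, |k t x y|
    ≤ c₁ * t ^ (-(d / (d + 1))) * Real.exp (-(c₂ * ((dist x y) ^ (d + 1) / t) ^ γ))

namespace IsRealHeatKernel

variable {P : SpectralMeasure (Lp ℂ 2 μ)} {k : ℝ → X → X → ℝ} {d γ c₁ c₂ : ℝ}

theorem semigroup (P : SpectralMeasure (Lp ℂ 2 μ)) {s t : ℝ} (hs : 0 ≤ s) (ht : 0 ≤ t)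
    (u : Lp ℂ 2 μ) :
    P.integral (heatFn s) (P.integral (heatFn t) u) = P.integral (heatFn (s + t)) u := by
  rw [← heatFn_mul, P.integral_mul (bddMeas_heatFn hs) (bddMeas_heatFn ht), mul_apply_eq_comp]

theorem inner_heat (P : SpectralMeasure (Lp ℂ 2 μ)) {t : ℝ} (ht : 0 ≤ t) (f g : Lp ℂ 2 μ) :
    inner ℂ (P.integral (heatFn t) f) g = inner ℂ f (P.integral (heatFn t) g) := by
  rw [← ContinuousLinearMap.adjoint_inner_right, ← P.integral_star (bddMeas_heatFn ht), star_heatFn]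

/-- The sup of the heat kernel bound at time `t`. -/
def height (d c₁ t : ℝ) : ℝ := c₁ * t ^ (-(d / (d + 1)))

variable (hk : IsRealHeatKernel P k d γ c₁ c₂)
include hk

theorem height_pos {t : ℝ} (ht : 0 < t) : 0 < height d c₁ t :=
  mul_pos hk.c₁_pos (Real.rpow_pos_of_pos ht _)

theorem abs_le_height {t : ℝ} (ht : 0 < t) (x y : X) : |k t x y| ≤ height d c₁ t := by
  refine (hk.bound t ht x y).trans ?_
  refine mul_le_of_le_one_right (hk.height_pos ht).le (Real.exp_le_one_iff.2 ?_)
  have : 0 ≤ ((dist x y) ^ (d + 1) / t) ^ γ := by positivity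
  have := hk.c₂_pos
  simp only [Left.neg_nonpos_iff]
  positivity

variable [BorelSpace X]

/-- A stretched exponential beats the polynomial volume growth of a doubling space; rows and columns
of the kernel are therefore in `L²`. -/
theorem exists_decay : ∃ N : ℕ, (∀ x : X, Integrable (fun z => ((1 + dist x z) ^ N)⁻¹) μ) ∧
    ∀ t, 0 < t → ∃ A : ℝ, 0 ≤ A ∧ ∀ x y, |k t x y| ≤ A * ((1 + dist x y) ^ N)⁻¹ := by
  obtain ⟨N, hN⟩ := hk.doubling.exists_integrable_decay
  refine ⟨N, hN, fun t ht => ?_⟩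
  have hd1 : 0 < d + 1 := by linarith [hk.d_pos]
  obtain ⟨C, hC0, hC⟩ := exists_exp_neg_le_inv_pow (a := c₂ * (t ^ γ)⁻¹) (b := (d + 1) * γ)
    (mul_pos hk.c₂_pos (inv_pos.2 (Real.rpow_pos_of_pos ht _))) (mul_pos hd1 hk.γ_pos) N
  have hh := hk.height_pos ht
  refine ⟨height d c₁ t * C, by positivity, fun x y => (hk.bound t ht x y).trans ?_⟩
  have e : c₂ * ((dist x y) ^ (d + 1) / t) ^ γ = c₂ * (t ^ γ)⁻¹ * dist x y ^ ((d + 1) * γ) := by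
    rw [Real.div_rpow (by positivity) ht.le, ← Real.rpow_mul dist_nonneg]
    field_simp
  rw [e, mul_assoc (height d c₁ t)]
  exact mul_le_mul_of_nonneg_left (hC _ dist_nonneg) hh.le

theorem memLp_row {t : ℝ} (ht : 0 < t) (x : X) : MemLp (fun z => (k t x z : ℂ)) 2 μ := by
  obtain ⟨N, hN, hA⟩ := hk.exists_decay
  obtain ⟨A, hA0, hA⟩ := hA t ht
  have m : Measurable fun z => (k t x z : ℂ) :=
    Complex.continuous_ofReal.measurable.comp ((hk.measurable t ht).comp measurable_prodMk_left)
  rw [memLp_two_iff_integrable_sq_norm m.aestronglyMeasurable]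
  refine ((hN x).const_mul (A ^ 2)).mono' (m.norm.pow_const 2).aestronglyMeasurable
    (Eventually.of_forall fun z => ?_)
  have h1 : ((1 + dist x z) ^ N)⁻¹ ≤ 1 :=
    inv_le_one_of_one_le₀ (one_le_pow₀ (by linarith [dist_nonneg (x := x) (y := z)]))
  have h0 : 0 ≤ ((1 + dist x z) ^ N)⁻¹ := by positivity
  rw [norm_pow, norm_norm, Complex.norm_real, Real.norm_eq_abs]
  calc |k t x z| ^ 2 ≤ (A * ((1 + dist x z) ^ N)⁻¹) ^ 2 := pow_le_pow_left₀ (abs_nonneg _) (hA x z) 2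
    _ = A ^ 2 * ((1 + dist x z) ^ N)⁻¹ * ((1 + dist x z) ^ N)⁻¹ := by ring
    _ ≤ A ^ 2 * ((1 + dist x z) ^ N)⁻¹ := mul_le_of_le_one_right (by positivity) h1

theorem memLp_col {t : ℝ} (ht : 0 < t) (y : X) : MemLp (fun z => (k t z y : ℂ)) 2 μ := by
  obtain ⟨N, hN, hA⟩ := hk.exists_decay
  obtain ⟨A, hA0, hA⟩ := hA t ht
  have m : Measurable fun z => (k t z y : ℂ) :=
    Complex.continuous_ofReal.measurable.comp ((hk.measurable t ht).comp measurable_prodMk_right)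
  rw [memLp_two_iff_integrable_sq_norm m.aestronglyMeasurable]
  refine ((hN y).const_mul (A ^ 2)).mono' (m.norm.pow_const 2).aestronglyMeasurable
    (Eventually.of_forall fun z => ?_)
  have h1 : ((1 + dist y z) ^ N)⁻¹ ≤ 1 :=
    inv_le_one_of_one_le₀ (one_le_pow₀ (by linarith [dist_nonneg (x := y) (y := z)]))
  have h0 : 0 ≤ ((1 + dist y z) ^ N)⁻¹ := by positivity
  rw [norm_pow, norm_norm, Complex.norm_real, Real.norm_eq_abs]
  have := hA z y
  rw [dist_comm] at this
  calc |k t z y| ^ 2 ≤ (A * ((1 + dist y z) ^ N)⁻¹) ^ 2 := pow_le_pow_left₀ (abs_nonneg _) this 2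
    _ = A ^ 2 * ((1 + dist y z) ^ N)⁻¹ * ((1 + dist y z) ^ N)⁻¹ := by ring
    _ ≤ A ^ 2 * ((1 + dist y z) ^ N)⁻¹ := mul_le_of_le_one_right (by positivity) h1

theorem heat_apply {t : ℝ} (ht : 0 < t) (u : Lp ℂ 2 μ) :
    ∀ᵐ x ∂μ, P.integral (heatFn t) u x = bilin (sectionLp μ (k t x)) u := by
  filter_upwards [hk.kernel t ht u] with x hx
  rw [hx, bilin_sectionLp (hk.memLp_row ht x)]

theorem heat_star {t : ℝ} (ht : 0 < t) (u : Lp ℂ 2 μ) :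
    P.integral (heatFn t) (star u) = star (P.integral (heatFn t) u) := by
  refine Lp.ext ?_
  filter_upwards [hk.kernel t ht u, hk.kernel t ht (star u),
    Lp.coeFn_star (P.integral (heatFn t) u)] with x h1 h2 h3
  rw [h2, h3, Pi.star_apply, h1, RCLike.star_def, ← integral_conj]
  refine integral_congr_ae ?_
  filter_upwards [Lp.coeFn_star u] with y hy
  rw [hy]
  simp

/-- Self-adjointness combined with the reality of the kernel. The bilinear pairing is preferred to
the inner product since this symmetry, unlike self-adjointness, passes to combinations with complex
coefficients. -/
theorem bilin_heat {t : ℝ} (ht : 0 < t) (f g : Lp ℂ 2 μ) :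
    bilin f (P.integral (heatFn t) g) = bilin (P.integral (heatFn t) f) g := by
  rw [bilin, bilin, ← hk.heat_star ht, inner_heat P ht.le]

theorem norm_heat_apply_le {t : ℝ} (ht : 0 < t) {g : Lp ℂ 2 μ} (hg : Integrable g μ) :
    ∀ᵐ x ∂μ, ‖P.integral (heatFn t) g x‖ ≤ height d c₁ t * ∫ y, ‖g y‖ ∂μ := by
  filter_upwards [hk.kernel t ht g] with x hx
  rw [hx, ← integral_const_mul]
  refine norm_integral_le_of_norm_le (hg.norm.const_mul _) (Eventually.of_forall fun y => ?_)
  rw [norm_mul, Complex.norm_real, Real.norm_eq_abs]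
  exact mul_le_mul_of_nonneg_right (hk.abs_le_height ht x y) (norm_nonneg _)

/-- The `T T*` argument for the map from `L¹` to `L²`: `‖e^{tΔ} g‖² = ⟨g, e^{2tΔ} g⟩`, and the
kernel at time `2t` is bounded by its height. -/
theorem norm_sq_heat_le {t : ℝ} (ht : 0 < t) {g : Lp ℂ 2 μ} (hg : Integrable g μ) :
    ‖P.integral (heatFn t) g‖ ^ 2 ≤ height d c₁ (2 * t) * (∫ y, ‖g y‖ ∂μ) ^ 2 := by
  have h2t : 0 < 2 * t := by linarith
  have e : ((‖P.integral (heatFn t) g‖ ^ 2 : ℝ) : ℂ) = inner ℂ g (P.integral (heatFn (2 * t)) g) := by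
    rw [two_mul, ← semigroup P ht.le ht.le, ← inner_heat P ht.le, inner_self_eq_norm_sq_to_K]
    norm_cast
  have n : ‖P.integral (heatFn t) g‖ ^ 2 = ‖inner ℂ g (P.integral (heatFn (2 * t)) g)‖ := by
    rw [← e, Complex.norm_real, Real.norm_eq_abs, abs_of_nonneg (by positivity)]
  rw [n, L2.inner_def]
  have : height d c₁ (2 * t) * (∫ y, ‖g y‖ ∂μ) ^ 2
      = ∫ x, (height d c₁ (2 * t) * ∫ y, ‖g y‖ ∂μ) * ‖g x‖ ∂μ := by
    rw [integral_const_mul]; ring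
  rw [this]
  refine norm_integral_le_of_norm_le (hg.norm.const_mul _) ?_
  filter_upwards [hk.norm_heat_apply_le h2t hg] with x hx
  refine (norm_inner_le_norm _ _).trans ?_
  rw [mul_comm]
  exact mul_le_mul_of_nonneg_right hx (norm_nonneg _)

/-- `e^{tΔ}` maps `L²` to `L^∞`. -/
theorem norm_heat_apply_le_L2 {t : ℝ} (ht : 0 < t) (f : Lp ℂ 2 μ) :
    ∀ᵐ x ∂μ, ‖P.integral (heatFn t) f x‖ ≤ √(height d c₁ (2 * t)) * ‖f‖ := by
  have := hk.doubling.sigmaFinite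
  set F := P.integral (heatFn t) f with hF
  have sm : StronglyMeasurable F := Lp.stronglyMeasurable F
  have key : 0 ≤ᵐ[μ] fun x => √(height d c₁ (2 * t)) * ‖f‖ - ‖F x‖ := by
    have int : ∀ s, MeasurableSet s → μ s < ⊤ → IntegrableOn (fun x => ‖F x‖) s μ := by
      intro s hs hμs
      have : IsFiniteMeasure (μ.restrict s) := ⟨by simpa using hμs⟩
      exact (MemLp.integrable (q := 2) (by norm_num) ((Lp.memLp F).restrict s)).norm
    refine ae_nonneg_of_forall_setIntegral_nonneg_of_sigmaFinite (fun s hs hμs => ?_)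
      fun s hs hμs => ?_
    · exact (integrableOn_const hμs.ne).sub (int s hs hμs)
    · have intc : IntegrableOn (fun _ : X => √(height d c₁ (2 * t)) * ‖f‖) s μ :=
        integrableOn_const hμs.ne
      rw [integral_sub intc (int s hs hμs), sub_nonneg, setIntegral_const]
      -- The conjugate phase of `F` on `s`, with `0 / 0 = 0`. Pairing with it gives `∫_s |F|`, while
      -- its `L¹` norm is at most `μ(s)`; symmetry and the bound from `L¹` to `L²` then control the
      -- mean of `|F|` over every set of finite measure.
      let φ : X → ℂ := s.indicator fun x => (starRingEnd ℂ) (F x) / (‖F x‖ : ℂ)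
      have mφ : Measurable φ := by
        refine Measurable.indicator ?_ hs
        exact (Complex.continuous_conj.measurable.comp sm.measurable).div
          (Complex.continuous_ofReal.measurable.comp sm.measurable.norm)
      have nφ : ∀ x, ‖φ x‖ ≤ s.indicator 1 x := by
        intro x
        by_cases hx : x ∈ s
        · simp only [φ, indicator_of_mem hx, norm_div, RCLike.norm_conj, Complex.norm_real, norm_norm]
          exact div_self_le_one _
        · simp [φ, indicator_of_notMem hx]
      have hφ : MemLp φ 2 μ := by
        refine MemLp.mono (memLp_indicator_const 2 hs (1 : ℝ) (Or.inr hμs.ne))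
          mφ.aestronglyMeasurable (Eventually.of_forall fun x => (nφ x).trans (le_of_eq ?_))
        by_cases hx : x ∈ s <;> simp [hx]
      have hφ1 : Integrable φ μ := by
        refine Integrable.mono' ((integrable_indicator_iff hs).2 (integrableOn_const hμs.ne (C := (1 : ℝ))))
          mφ.aestronglyMeasurable (Eventually.of_forall nφ)
      let g : Lp ℂ 2 μ := hφ.toLp φ
      have hg : g =ᵐ[μ] φ := hφ.coeFn_toLp
      have hgi : Integrable g μ := hφ1.congr hg.symm
      have g1 : ∫ y, ‖g y‖ ∂μ ≤ μ.real s := by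
        have : ∫ y, ‖g y‖ ∂μ = ∫ y, ‖φ y‖ ∂μ := by
          refine integral_congr_ae ?_
          filter_upwards [hg] with y hy
          rw [hy]
        rw [this]
        refine (integral_mono hφ1.norm ((integrable_indicator_iff hs).2
          (integrableOn_const hμs.ne (C := (1 : ℝ)))) nφ).trans (le_of_eq ?_)
        rw [integral_indicator hs]
        simp
      have e1 : bilin g F = ((∫ x in s, ‖F x‖ ∂μ : ℝ) : ℂ) := by
        rw [bilin_eq_integral, ← integral_complex_ofReal, ← integral_indicator hs]
        refine integral_congr_ae ?_
        filter_upwards [hg] with x hx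
        rw [hx]
        by_cases hxs : x ∈ s
        · simp only [φ, indicator_of_mem hxs]
          rcases eq_or_ne (F x) 0 with h0 | h0
          · simp [h0]
          · have : (‖F x‖ : ℂ) ≠ 0 := by exact_mod_cast norm_ne_zero_iff.2 h0
            field_simp
            rw [mul_comm, Complex.mul_conj']
        · simp [φ, indicator_of_notMem hxs]
      have e2 : ‖bilin g F‖ = ∫ x in s, ‖F x‖ ∂μ := by
        rw [e1, Complex.norm_real, Real.norm_eq_abs, abs_of_nonneg]
        exact integral_nonneg fun _ => norm_nonneg _
      rw [← e2, hF, hk.bilin_heat ht]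
      refine (norm_bilin_le _ _).trans ?_
      have e3 : ‖P.integral (heatFn t) g‖ ≤ √(height d c₁ (2 * t)) * μ.real s := by
        have h1 := hk.norm_sq_heat_le ht hgi
        have hh := (hk.height_pos (show 0 < 2 * t by linarith)).le
        refine le_of_sq_le_sq (h1.trans ?_) (by positivity)
        rw [mul_pow, Real.sq_sqrt hh]
        exact mul_le_mul_of_nonneg_left
          (pow_le_pow_left₀ (integral_nonneg fun _ => norm_nonneg _) g1 2) hh
      rw [smul_eq_mul]
      calc _ ≤ √(height d c₁ (2 * t)) * μ.real s * ‖f‖ := mul_le_mul_of_nonneg_right e3 (norm_nonneg _)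
        _ = _ := by ring
  filter_upwards [key] with x hx
  exact sub_nonneg.1 hx

theorem secondCountable_L2 : SecondCountableTopology (Lp ℂ 2 μ) := by
  have := hk.doubling.sigmaFinite
  have := hk.doubling.secondCountableTopology
  have : Fact ((2 : ENNReal) ≠ ⊤) := ⟨by norm_num⟩
  infer_instance

/-- The row at `x` represents `f ↦ e^{tΔ} f(x)`, so its norm is bounded by the norm of the map from
`L²` to `L^∞`. A countable dense sequence of test functions gives one null set for all `f`, and the
conjugate of the row is the extremal choice. -/
theorem norm_row_le {t : ℝ} (ht : 0 < t) :
    ∀ᵐ x ∂μ, ‖sectionLp μ (k t x)‖ ≤ √(height d c₁ (2 * t)) := by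
  have := hk.secondCountable_L2
  let D := TopologicalSpace.denseSeq (Lp ℂ 2 μ)
  have h : ∀ᵐ x ∂μ, ∀ n, ‖bilin (sectionLp μ (k t x)) (D n)‖ ≤ √(height d c₁ (2 * t)) * ‖D n‖ := by
    rw [ae_all_iff]
    intro n
    filter_upwards [hk.heat_apply ht (D n), hk.norm_heat_apply_le_L2 ht (D n)] with x h1 h2
    rwa [h1] at h2
  filter_upwards [h] with x hx
  have all : ∀ f, ‖bilin (sectionLp μ (k t x)) f‖ ≤ √(height d c₁ (2 * t)) * ‖f‖ := by
    intro f
    have cl : IsClosed {f : Lp ℂ 2 μ |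
        ‖bilin (sectionLp μ (k t x)) f‖ ≤ √(height d c₁ (2 * t)) * ‖f‖} :=
      isClosed_le ((continuous_bilin.comp (continuous_const.prodMk continuous_id)).norm) (by fun_prop)
    have := (TopologicalSpace.denseRange_denseSeq (Lp ℂ 2 μ)).closure_range
    have sub : closure (range D) ⊆ _ := cl.closure_subset_iff.2 (range_subset_iff.2 hx)
    rw [this] at sub
    exact sub (mem_univ f)
  have h2 := all (star (sectionLp μ (k t x)))
  rw [bilin, Lp.norm_star_L2, inner_self_eq_norm_sq_to_K, Lp.norm_star_L2] at h2
  rcases (norm_nonneg (sectionLp μ (k t x))).eq_or_lt with h0 | h0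
  · rw [← h0]; positivity
  · have : ‖(((‖sectionLp μ (k t x)‖ : ℝ) : ℂ)) ^ 2‖ = ‖sectionLp μ (k t x)‖ ^ 2 := by
      rw [norm_pow, Complex.norm_real, norm_norm]
    have h3 : ‖sectionLp μ (k t x)‖ ^ 2 ≤ √(height d c₁ (2 * t)) * ‖sectionLp μ (k t x)‖ := by
      rw [← this]; exact h2
    rw [sq] at h3
    exact le_of_mul_le_mul_right h3 h0

/-- The heat kernel is symmetric, in the sense that almost all rows and columns agree. -/
theorem row_eq_col {t : ℝ} (ht : 0 < t) :
    ∀ᵐ y ∂μ, sectionLp μ (k t y) = sectionLp μ (fun z => k t z y) := by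
  have := hk.doubling.sigmaFinite
  have := hk.secondCountable_L2
  have h2 : Fact ((2 : ENNReal) ≠ ⊤) := ⟨by norm_num⟩
  -- Countability yields a common null set; integrability is needed for Fubini below.
  obtain ⟨S, hSsub, hSc, hSd⟩ := (dense_integrable_L2 (μ := μ)).exists_countable_dense_subset
  have h : ∀ᵐ y ∂μ, ∀ f ∈ S, bilin (sectionLp μ (k t y)) f
      = bilin (sectionLp μ (fun z => k t z y)) f := by
    rw [ae_ball_iff hSc]
    intro f hf
    have hfi : Integrable f μ := hSsub hf
    have mk : Measurable fun q : X × X => (k t q.1 q.2 : ℂ) :=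
      Complex.continuous_ofReal.measurable.comp (hk.measurable t ht)
    have bk : ∀ x y, ‖(k t x y : ℂ)‖ ≤ height d c₁ t := fun x y => by
      rw [Complex.norm_real]; exact hk.abs_le_height ht x y
    let J : X → ℂ := fun y => ∫ x, (k t x y : ℂ) * f x ∂μ
    have eqJ : ∀ y, bilin (sectionLp μ (fun z => k t z y)) f = J y := fun y =>
      bilin_sectionLp (hk.memLp_col ht y) f
    -- Both functions are integrated over a set `s` of finite measure: symmetry moves the heat
    -- operator from `f` to the indicator of `s`, and Fubini exchanges the integrals on the side of
    -- `J`.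
    have key : (fun y => P.integral (heatFn t) f y - J y) =ᵐ[μ] 0 := by
      have prodint : ∀ s, MeasurableSet s → μ s < ⊤ →
          Integrable (fun q : X × X => (k t q.1 q.2 : ℂ) * f q.1) (μ.prod (μ.restrict s)) := by
        intro s hs hμs
        have : IsFiniteMeasure (μ.restrict s) := ⟨by simpa using hμs⟩
        have h1 : Integrable (fun q : X × X => f q.1 * (1 : ℂ)) (μ.prod (μ.restrict s)) :=
          hfi.mul_prod (integrable_const (1 : ℂ))
        simp only [mul_one] at h1
        exact h1.bdd_mul mk.aestronglyMeasurable (Eventually.of_forall fun q => bk q.1 q.2)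
      have intJ : ∀ s, MeasurableSet s → μ s < ⊤ → IntegrableOn J s μ := fun s hs hμs =>
        (prodint s hs hμs).integral_prod_right
      have intE : ∀ s, MeasurableSet s → μ s < ⊤ → IntegrableOn (P.integral (heatFn t) f) s μ := by
        intro s hs hμs
        have : IsFiniteMeasure (μ.restrict s) := ⟨by simpa using hμs⟩
        exact MemLp.integrable (q := 2) (by norm_num) ((Lp.memLp _).restrict s)
      refine ae_eq_zero_of_forall_setIntegral_eq_of_sigmaFinite
        (fun s hs hμs => (intE s hs hμs).sub (intJ s hs hμs)) fun s hs hμs => ?_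
      rw [integral_sub (intE s hs hμs) (intJ s hs hμs), sub_eq_zero]
      let g : Lp ℂ 2 μ := indicatorConstLp 2 hs hμs.ne (1 : ℂ)
      have hg : g =ᵐ[μ] s.indicator fun _ => (1 : ℂ) := indicatorConstLp_coeFn
      have gset : ∀ F : X → ℂ, ∫ x, g x * F x ∂μ = ∫ x in s, F x ∂μ := by
        intro F
        rw [← integral_indicator hs]
        refine integral_congr_ae ?_
        filter_upwards [hg] with x hx
        rw [hx]
        by_cases hxs : x ∈ s <;> simp [hxs]
      have a1 : ∫ y in s, P.integral (heatFn t) f y ∂μ = bilin f (P.integral (heatFn t) g) := by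
        rw [hk.bilin_heat ht, bilin_comm, bilin_eq_integral, gset]
      rw [a1, bilin_eq_integral]
      have a2 : ∫ y in s, J y ∂μ = ∫ x, ∫ y in s, (k t x y : ℂ) * f x ∂μ ∂μ :=
        (integral_integral_swap (prodint s hs hμs)).symm
      rw [a2]
      refine integral_congr_ae ?_
      filter_upwards [hk.kernel t ht g] with x hx
      rw [hx, mul_comm, ← integral_mul_const]
      simp_rw [mul_comm _ (g _), mul_assoc]
      exact gset _
    filter_upwards [key, hk.heat_apply ht f] with y h1 h3
    rw [eqJ, ← h3]
    exact sub_eq_zero.1 h1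
  filter_upwards [h] with y hy
  refine eq_of_bilin fun w => ?_
  have c : ∀ f : Lp ℂ 2 μ, Continuous fun w => bilin w f := fun f =>
    continuous_bilin.comp (continuous_id.prodMk continuous_const)
  have : EqOn (fun w => bilin w (sectionLp μ (k t y)))
      (fun w => bilin w (sectionLp μ (fun z => k t z y))) univ := by
    rw [← hSd.closure_eq]
    refine EqOn.closure (fun f hf => ?_) (c _) (c _)
    rw [bilin_comm, hy f hf, bilin_comm]
  exact this (mem_univ w)

/-- The semigroup law, tested against a dense sequence. The kernel identity evaluates rows, and
`row_eq_col` passes to columns, whence the exceptional null set of `y`. -/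
theorem heat_col {s t : ℝ} (hs : 0 < s) (ht : 0 < t) :
    ∀ᵐ y ∂μ, P.integral (heatFn s) (sectionLp μ (fun z => k t z y))
      = sectionLp μ (fun z => k (s + t) z y) := by
  have := hk.secondCountable_L2
  have hst : 0 < s + t := by linarith
  have h : ∀ᵐ y ∂μ, ∀ n,
      P.integral (heatFn t) (P.integral (heatFn s) (TopologicalSpace.denseSeq (Lp ℂ 2 μ) n)) y
        = bilin (sectionLp μ (k t y))
          (P.integral (heatFn s) (TopologicalSpace.denseSeq (Lp ℂ 2 μ) n)) ∧
      P.integral (heatFn (s + t)) (TopologicalSpace.denseSeq (Lp ℂ 2 μ) n) y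
        = bilin (sectionLp μ (k (s + t) y)) (TopologicalSpace.denseSeq (Lp ℂ 2 μ) n) := by
    rw [ae_all_iff]
    exact fun n => (hk.heat_apply ht _).and (hk.heat_apply hst _)
  filter_upwards [h, hk.row_eq_col ht, hk.row_eq_col hst] with y hy h1 h2
  rw [← h1, ← h2]
  refine eq_of_bilin_denseSeq fun n => ?_
  rw [hk.bilin_heat hs, bilin_comm, ← (hy n).1, semigroup P ht.le hs.le, add_comm t s, (hy n).2,
    bilin_comm]

end IsRealHeatKernel

end

noncomputable section

set_option linter.unusedSectionVars false

/-! ### Kernels of operators placed between two heat operators. -/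

section Sandwich

variable {X : Type*} [MetricSpace X] [MeasurableSpace X] {μ : Measure X}

/-- The kernel of `e^{tΔ} T e^{tΔ}`, where `k t` is the heat kernel. -/
def sandwich (μ : Measure X) (k : ℝ → X → X → ℝ) (t : ℝ) (T : Lp ℂ 2 μ →L[ℂ] Lp ℂ 2 μ)
    (x y : X) : ℂ :=
  bilin (sectionLp μ (k t x)) (T (sectionLp μ fun z => k t z y))

/-- The functional `T ↦ sandwich T x y`. -/
def sandwichCLM (μ : Measure X) (k : ℝ → X → X → ℝ) (t : ℝ) (x y : X) :
    (Lp ℂ 2 μ →L[ℂ] Lp ℂ 2 μ) →L[ℂ] ℂ :=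
  (bilinCLM (sectionLp μ (k t x))).comp
    (ContinuousLinearMap.apply ℂ (Lp ℂ 2 μ) (sectionLp μ fun z => k t z y))

/-- Symmetry with respect to the bilinear pairing. -/
def IsBilinSymm (T : Lp ℂ 2 μ →L[ℂ] Lp ℂ 2 μ) : Prop :=
  ∀ f g, bilin f (T g) = bilin (T f) g

namespace IsBilinSymm

variable {S T : Lp ℂ 2 μ →L[ℂ] Lp ℂ 2 μ}

theorem add (hS : IsBilinSymm S) (hT : IsBilinSymm T) : IsBilinSymm (S + T) := fun f g => by
  rw [add_apply, add_apply, bilin_add_right, bilin_comm (S f + T f), bilin_add_right,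
    hS, hT, bilin_comm g, bilin_comm g]

theorem smul (c : ℂ) (hT : IsBilinSymm T) : IsBilinSymm (c • T) := fun f g => by
  rw [smul_apply, smul_apply, bilin_smul_right, bilin_comm (c • T f), bilin_smul_right, hT,
    bilin_comm g]

theorem hasSum {ι : Type*} {S : ι → Lp ℂ 2 μ →L[ℂ] Lp ℂ 2 μ} (hS : ∀ i, IsBilinSymm (S i))
    (hT : HasSum S T) : IsBilinSymm T := by
  intro f g
  have h1 := hT.mapL ((bilinCLM f).comp (ContinuousLinearMap.apply ℂ (Lp ℂ 2 μ) g))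
  have h2 := hT.mapL ((bilinCLM g).comp (ContinuousLinearMap.apply ℂ (Lp ℂ 2 μ) f))
  have e : ∀ i, bilin f (S i g) = bilin g (S i f) := fun i => by rw [hS i, bilin_comm]
  rw [bilin_comm (T f)]
  refine h1.unique (h2.congr_fun ?_)
  exact e

end IsBilinSymm

/-- Dominated convergence: for `x` within distance `1` of `x₀`, the weights centred at `x` and at
`x₀` differ by a factor of at most `2^N`. -/
theorem continuous_sectionLp [BorelSpace X] {F : X → X → ℝ} (hF : Continuous fun q : X × X => F q.1 q.2)
    {N : ℕ} (hN : ∀ x : X, Integrable (fun z => ((1 + dist x z) ^ N)⁻¹) μ)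
    {A : ℝ} (hA0 : 0 ≤ A) (hA : ∀ x y, |F x y| ≤ A * ((1 + dist x y) ^ N)⁻¹)
    (hL : ∀ x, MemLp (fun z => (F x z : ℂ)) 2 μ) :
    Continuous fun x => sectionLp μ (F x) := by
  rw [continuous_iff_continuousAt]
  intro x₀
  rw [ContinuousAt, tendsto_iff_norm_sub_tendsto_zero]
  have cF : ∀ x, Continuous (F x) := fun x => hF.comp (continuous_const.prodMk continuous_id)
  have key : Tendsto (fun x => ‖sectionLp μ (F x) - sectionLp μ (F x₀)‖ ^ 2) (𝓝 x₀) (𝓝 0) := by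
    have e : ∀ x, ‖sectionLp μ (F x) - sectionLp μ (F x₀)‖ ^ 2 = ∫ z, |F x z - F x₀ z| ^ 2 ∂μ := by
      intro x
      rw [norm_sq_sectionLp_sub (hL x)]
      refine integral_congr_ae ?_
      filter_upwards [coeFn_sectionLp (hL x₀)] with z hz
      rw [hz, ← Complex.ofReal_sub, Complex.norm_real, Real.norm_eq_abs]
    simp_rw [e]
    have z0 : (0 : ℝ) = ∫ z, (0 : ℝ) ∂μ := by simp
    rw [z0]
    refine tendsto_integral_filter_of_dominated_convergence
      (fun z => (A * (2 ^ N + 1)) ^ 2 * ((1 + dist x₀ z) ^ N)⁻¹)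
      (Eventually.of_forall fun x => (((cF x).sub (cF x₀)).abs.pow 2).aestronglyMeasurable)
      ?_ ((hN x₀).const_mul _) (Eventually.of_forall fun z => ?_)
    · filter_upwards [Metric.ball_mem_nhds x₀ one_pos] with x hx
      refine Eventually.of_forall fun z => ?_
      rw [Metric.mem_ball] at hx
      set D := ((1 + dist x₀ z) ^ N)⁻¹ with hD
      have hD0 : 0 ≤ D := by positivity
      have hD1 : D ≤ 1 :=
        inv_le_one_of_one_le₀ (one_le_pow₀ (by linarith [dist_nonneg (x := x₀) (y := z)]))
      have h1 : ((1 + dist x z) ^ N)⁻¹ ≤ 2 ^ N * D := by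
        rw [hD, ← div_eq_mul_inv, inv_eq_one_div, div_le_div_iff₀ (by positivity) (by positivity),
          one_mul, ← mul_pow]
        refine pow_le_pow_left₀ (by positivity) ?_ N
        have := dist_triangle x₀ x z
        rw [dist_comm x₀ x] at this
        linarith [dist_nonneg (x := x) (y := z)]
      have h2 : |F x z - F x₀ z| ≤ A * (2 ^ N + 1) * D := by
        have a1 := (hA x z).trans (mul_le_mul_of_nonneg_left h1 hA0)
        have a2 := hA x₀ z
        have := abs_sub (F x z) (F x₀ z)
        have e : A * (2 ^ N + 1) * D = A * (2 ^ N * D) + A * D := by ring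
        rw [e]
        exact this.trans (add_le_add a1 a2)
      rw [norm_pow, Real.norm_eq_abs, abs_abs]
      calc |F x z - F x₀ z| ^ 2 ≤ (A * (2 ^ N + 1) * D) ^ 2 := pow_le_pow_left₀ (abs_nonneg _) h2 2
        _ = (A * (2 ^ N + 1)) ^ 2 * D * D := by ring
        _ ≤ (A * (2 ^ N + 1)) ^ 2 * D := mul_le_of_le_one_right (by positivity) hD1
    · have c1 : Continuous fun x => F x z := hF.comp (continuous_id.prodMk continuous_const)
      have := ((c1.sub (continuous_const (y := F x₀ z))).pow 2).tendsto x₀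
      simp_rw [sq_abs]
      refine this.trans (le_of_eq ?_)
      simp
  have := key.sqrt
  simpa [Real.sqrt_sq] using this

namespace IsRealHeatKernel

variable {P : SpectralMeasure (Lp ℂ 2 μ)} {k : ℝ → X → X → ℝ} {d γ c₁ c₂ : ℝ}
  (hk : IsRealHeatKernel P k d γ c₁ c₂) [BorelSpace X]
include hk

theorem isBilinSymm_heat {t : ℝ} (ht : 0 < t) : IsBilinSymm (P.integral (heatFn t)) :=
  hk.bilin_heat ht

theorem measurable_sandwich {t : ℝ} (ht : 0 < t) (T : Lp ℂ 2 μ →L[ℂ] Lp ℂ 2 μ) :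
    Measurable fun q : X × X => sandwich μ k t T q.1 q.2 := by
  have := hk.doubling.sigmaFinite
  have := hk.secondCountable_L2
  let _ : MeasurableSpace (Lp ℂ 2 μ) := borel _
  have : BorelSpace (Lp ℂ 2 μ) := ⟨rfl⟩
  have m1 : Measurable fun x => sectionLp μ (k t x) :=
    measurable_sectionLp (hk.measurable t ht) (hk.memLp_row ht)
  have m2 : Measurable fun y => sectionLp μ (fun z => k t z y) :=
    measurable_sectionLp (F := fun y z => k t z y) ((hk.measurable t ht).comp measurable_swap)
      (hk.memLp_col ht)
  exact continuous_bilin.measurable.comp ((m1.comp measurable_fst).prodMk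
    (T.continuous.measurable.comp (m2.comp measurable_snd)))

theorem continuous_sandwich {t : ℝ} (ht : 0 < t)
    (hc : Continuous fun q : X × X => k t q.1 q.2) (T : Lp ℂ 2 μ →L[ℂ] Lp ℂ 2 μ) :
    Continuous fun q : X × X => sandwich μ k t T q.1 q.2 := by
  obtain ⟨N, hN, hA⟩ := hk.exists_decay
  obtain ⟨A, hA0, hA⟩ := hA t ht
  have m1 : Continuous fun x => sectionLp μ (k t x) :=
    continuous_sectionLp hc hN hA0 hA (hk.memLp_row ht)
  have m2 : Continuous fun y => sectionLp μ (fun z => k t z y) :=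
    continuous_sectionLp (F := fun y z => k t z y) (hc.comp continuous_swap) hN hA0
      (fun y z => by rw [dist_comm]; exact hA z y) (hk.memLp_col ht)
  exact continuous_bilin.comp ((m1.comp continuous_fst).prodMk
    (T.continuous.comp (m2.comp continuous_snd)))

theorem sandwich_ae_left {t : ℝ} (ht : 0 < t) (T : Lp ℂ 2 μ →L[ℂ] Lp ℂ 2 μ) (y : X) :
    (fun x => sandwich μ k t T x y)
      =ᵐ[μ] P.integral (heatFn t) (T (sectionLp μ fun z => k t z y)) := by
  filter_upwards [hk.heat_apply ht (T (sectionLp μ fun z => k t z y))] with x hx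
  exact hx.symm

theorem sandwich_ae_right {t : ℝ} (ht : 0 < t) {T : Lp ℂ 2 μ →L[ℂ] Lp ℂ 2 μ}
    (hT : IsBilinSymm T) (x : X) :
    (fun y => sandwich μ k t T x y) =ᵐ[μ] P.integral (heatFn t) (T (sectionLp μ (k t x))) := by
  filter_upwards [hk.heat_apply ht (T (sectionLp μ (k t x))), hk.row_eq_col ht] with y h1 h2
  rw [h1, sandwich, hT, bilin_comm, h2]

theorem sandwich_apply {t : ℝ} (ht : 0 < t) {T : Lp ℂ 2 μ →L[ℂ] Lp ℂ 2 μ} (hT : IsBilinSymm T)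
    (u : Lp ℂ 2 μ) : ∀ᵐ x ∂μ, P.integral (heatFn t) (T (P.integral (heatFn t) u)) x
      = ∫ y, sandwich μ k t T x y * u y ∂μ := by
  filter_upwards [hk.heat_apply ht (T (P.integral (heatFn t) u))] with x hx
  rw [hx, hT, hk.bilin_heat ht, bilin_eq_integral]
  refine integral_congr_ae ?_
  filter_upwards [hk.sandwich_ae_right ht hT x] with y hy
  rw [hy]

/-- The semigroup law `e^{tΔ} e^{sΔ} e^{tΔ} = e^{(s+2t)Δ}` at the level of kernels. Fubini combines
the exceptional sets, since the set of pairs where it holds is measurable. -/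
theorem sandwich_heat {s t : ℝ} (hs : 0 < s) (ht : 0 < t) :
    ∀ᵐ q ∂(μ.prod μ), sandwich μ k t (P.integral (heatFn s)) q.1 q.2 = k (s + t + t) q.1 q.2 := by
  have := hk.doubling.sigmaFinite
  have hst : 0 < s + t := by linarith
  have hstt : 0 < s + t + t := by linarith
  have hm : MeasurableSet {q : X × X | sandwich μ k t (P.integral (heatFn s)) q.1 q.2
      = ((k (s + t + t) q.1 q.2 : ℝ) : ℂ)} := measurableSet_eq_fun (hk.measurable_sandwich ht _)
    (Complex.continuous_ofReal.measurable.comp (hk.measurable _ hstt))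
  refine (Measure.ae_prod_iff_ae_ae hm).2 ?_
  filter_upwards [hk.heat_col hst ht, hk.row_eq_col ht, hk.row_eq_col hstt] with x h1 h2 h3
  filter_upwards [hk.sandwich_ae_right ht (hk.isBilinSymm_heat hs) x,
    coeFn_sectionLp (hk.memLp_row hstt x)] with y h4 h5
  rw [h4, semigroup P ht.le hs.le, h2, add_comm t s, h1, ← h3, h5]

/-- Cauchy–Schwarz with the `L²` norms of row and column. The exceptional set depends only on these
norms, and so not on `T`. -/
theorem norm_sandwich_le {t : ℝ} (ht : 0 < t) :
    ∀ᵐ q ∂(μ.prod μ), ∀ T, ‖sandwich μ k t T q.1 q.2‖ ≤ ‖T‖ * height d c₁ (2 * t) := by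
  have := hk.doubling.sigmaFinite
  have hcol : ∀ᵐ y ∂μ, ‖sectionLp μ (fun z => k t z y)‖ ≤ √(height d c₁ (2 * t)) := by
    filter_upwards [hk.norm_row_le ht, hk.row_eq_col ht] with y h1 h2
    rwa [← h2]
  filter_upwards [Measure.quasiMeasurePreserving_fst.ae (hk.norm_row_le ht),
    Measure.quasiMeasurePreserving_snd.ae hcol] with q h1 h2 T
  refine (norm_bilin_le _ _).trans ?_
  have h3 := (T.le_opNorm (sectionLp μ fun z => k t z q.2)).trans
    (mul_le_mul_of_nonneg_left h2 (norm_nonneg _))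
  refine (mul_le_mul h1 h3 (norm_nonneg _) (Real.sqrt_nonneg _)).trans (le_of_eq ?_)
  have := Real.mul_self_sqrt (hk.height_pos (show 0 < 2 * t by linarith)).le
  linear_combination ‖T‖ * this

end IsRealHeatKernel

end Sandwich

/-! ### Chebyshev polynomials in `e^{-tλ}`. -/

section ChebyshevHeat

/-- The function `v^i T_m(2v - 1)` with `v = e^{-ts}` on `(0, ∞)`, extended by `0`. -/
def chebHeat (t : ℝ) (i m : ℕ) : ℝ → ℂ := (Ioi 0).indicator fun s =>
  (((Real.exp (-(t * s))) ^ i * (Polynomial.Chebyshev.T ℝ m).eval (2 * Real.exp (-(t * s)) - 1) : ℝ) : ℂ)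

theorem chebHeat_of_pos (t : ℝ) (i m : ℕ) {s : ℝ} (hs : 0 < s) : chebHeat t i m s
    = (((Real.exp (-(t * s))) ^ i
      * (Polynomial.Chebyshev.T ℝ m).eval (2 * Real.exp (-(t * s)) - 1) : ℝ) : ℂ) :=
  indicator_of_mem (show s ∈ Ioi 0 from hs) _

theorem chebHeat_of_nonpos (t : ℝ) (i m : ℕ) {s : ℝ} (hs : s ≤ 0) : chebHeat t i m s = 0 :=
  indicator_of_notMem (show s ∉ Ioi 0 from not_lt.2 hs) _

theorem abs_eval_chebyshev_le (m : ℤ) {x : ℝ} (h : |x| ≤ 1) :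
    |(Polynomial.Chebyshev.T ℝ m).eval x| ≤ 1 := by
  obtain ⟨h1, h2⟩ := abs_le.1 h
  rw [← Real.cos_arccos h1 h2, Polynomial.Chebyshev.T_real_cos]
  exact Real.abs_cos_le_one _

theorem norm_chebHeat_le {t : ℝ} (ht : 0 ≤ t) (i m : ℕ) (s : ℝ) : ‖chebHeat t i m s‖ ≤ 1 := by
  rcases lt_or_ge 0 s with hs | hs
  · have h1 : Real.exp (-(t * s)) ≤ 1 := Real.exp_le_one_iff.2 (by nlinarith [mul_nonneg ht hs.le])
    have h0 := Real.exp_pos (-(t * s))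
    rw [chebHeat_of_pos t i m hs, Complex.norm_real, Real.norm_eq_abs, abs_mul]
    refine mul_le_one₀ ?_ (abs_nonneg _) (abs_eval_chebyshev_le m ?_)
    · rw [abs_of_nonneg (by positivity)]
      exact pow_le_one₀ h0.le h1
    · rw [abs_le]; constructor <;> linarith
  · rw [chebHeat_of_nonpos t i m hs]; simp

theorem bddMeas_chebHeat {t : ℝ} (ht : 0 ≤ t) (i m : ℕ) : BddMeas (chebHeat t i m) := by
  refine ⟨Measurable.indicator (Continuous.measurable ?_) measurableSet_Ioi, 1, norm_chebHeat_le ht i m⟩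
  fun_prop

theorem chebHeat_zero (t : ℝ) (i : ℕ) : chebHeat t i 0 = heatFn (i * t) := by
  ext s
  rcases lt_or_ge 0 s with hs | hs
  · rw [chebHeat_of_pos t i 0 hs, heatFn_of_pos _ hs]
    simp only [Nat.cast_zero, Polynomial.Chebyshev.T_zero, Polynomial.eval_one, mul_one]
    rw [← Real.exp_nat_mul]
    push_cast
    congr 1
    ring
  · rw [chebHeat_of_nonpos _ _ _ hs, heatFn_of_nonpos _ hs]

theorem chebHeat_one (t : ℝ) (i : ℕ) :
    chebHeat t i 1 = (2 : ℂ) • chebHeat t (i + 1) 0 + (-1 : ℂ) • chebHeat t i 0 := by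
  ext s
  rw [Pi.add_apply, Pi.smul_apply, Pi.smul_apply]
  rcases lt_or_ge 0 s with hs | hs
  · simp only [chebHeat_of_pos t _ _ hs]
    simp only [Nat.cast_zero, Nat.cast_one, Polynomial.Chebyshev.T_zero, Polynomial.Chebyshev.T_one,
      Polynomial.eval_one, Polynomial.eval_X, smul_eq_mul]
    push_cast
    ring
  · simp only [chebHeat_of_nonpos t _ _ hs]; simp

/-- The three-term recursion `T_{m+2}(x) = 2x T_{m+1}(x) - T_m(x)` at `x = 2v - 1`, with the factor
`v` moved into the exponent `i`. The coefficients have total size `7`. -/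
theorem chebHeat_add_two (t : ℝ) (i m : ℕ) :
    chebHeat t i (m + 2) = (4 : ℂ) • chebHeat t (i + 1) (m + 1)
      + ((-2 : ℂ) • chebHeat t i (m + 1) + (-1 : ℂ) • chebHeat t i m) := by
  ext s
  simp only [Pi.add_apply, Pi.smul_apply]
  rcases lt_or_ge 0 s with hs | hs
  · simp only [chebHeat_of_pos t _ _ hs]
    have e : (((m + 2 : ℕ) : ℤ)) = (m : ℤ) + 2 := by push_cast; ring
    have e' : (((m + 1 : ℕ) : ℤ)) = (m : ℤ) + 1 := by push_cast; ring
    rw [e, e', Polynomial.Chebyshev.T_add_two]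
    simp only [Polynomial.eval_sub, Polynomial.eval_mul, Polynomial.eval_X, Polynomial.eval_ofNat,
      smul_eq_mul]
    push_cast
    ring
  · simp only [chebHeat_of_nonpos t _ _ hs]; simp

end ChebyshevHeat

/-! ### Chebyshev combinations of heat operators and their kernels. -/

section ChebyshevOperators

variable {X : Type*} [MetricSpace X] [MeasurableSpace X] {μ : Measure X}

theorem sandwich_add (k : ℝ → X → X → ℝ) (t : ℝ) (S T : Lp ℂ 2 μ →L[ℂ] Lp ℂ 2 μ) (x y : X) :
    sandwich μ k t (S + T) x y = sandwich μ k t S x y + sandwich μ k t T x y :=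
  map_add (sandwichCLM μ k t x y) S T

theorem sandwich_smul (k : ℝ → X → X → ℝ) (t : ℝ) (c : ℂ) (T : Lp ℂ 2 μ →L[ℂ] Lp ℂ 2 μ)
    (x y : X) : sandwich μ k t (c • T) x y = c * sandwich μ k t T x y :=
  map_smul (sandwichCLM μ k t x y) c T

variable (P : SpectralMeasure (Lp ℂ 2 μ))

theorem integral_chebHeat_one {t : ℝ} (ht : 0 ≤ t) (i : ℕ) : P.integral (chebHeat t i 1)
    = (2 : ℂ) • P.integral (chebHeat t (i + 1) 0) + (-1 : ℂ) • P.integral (chebHeat t i 0) := by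
  have b := bddMeas_chebHeat ht
  rw [chebHeat_one, P.integral_add ((b _ _).smul _) ((b _ _).smul _), P.integral_smul _ (b _ _),
    P.integral_smul _ (b _ _)]

theorem integral_chebHeat_add_two {t : ℝ} (ht : 0 ≤ t) (i m : ℕ) :
    P.integral (chebHeat t i (m + 2)) = (4 : ℂ) • P.integral (chebHeat t (i + 1) (m + 1))
      + ((-2 : ℂ) • P.integral (chebHeat t i (m + 1)) + (-1 : ℂ) • P.integral (chebHeat t i m)) := by
  have b := bddMeas_chebHeat ht
  rw [chebHeat_add_two, P.integral_add ((b _ _).smul _) (((b _ _).smul _).add ((b _ _).smul _)),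
    P.integral_add ((b _ _).smul _) ((b _ _).smul _), P.integral_smul _ (b _ _),
    P.integral_smul _ (b _ _), P.integral_smul _ (b _ _)]

variable {P} {k : ℝ → X → X → ℝ} {d γ c₁ c₂ : ℝ} (hk : IsRealHeatKernel P k d γ c₁ c₂)
  [BorelSpace X]
include hk

/-- For `i ≥ 1` the recursion ends in heat operators at positive times, which are symmetric. -/
theorem IsRealHeatKernel.isBilinSymm_chebHeat {t : ℝ} (ht : 0 < t) (m : ℕ) :
    ∀ i : ℕ, 1 ≤ i → IsBilinSymm (P.integral (chebHeat t i m)) := by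
  induction m using Nat.twoStepInduction with
  | zero =>
    intro i hi
    rw [chebHeat_zero]
    exact hk.isBilinSymm_heat (by positivity)
  | one =>
    intro i hi
    rw [integral_chebHeat_one P ht.le, chebHeat_zero, chebHeat_zero]
    exact ((hk.isBilinSymm_heat (by positivity)).smul _).add
      ((hk.isBilinSymm_heat (by positivity)).smul _)
  | more m h0 h1 =>
    intro i hi
    rw [integral_chebHeat_add_two P ht.le]
    exact ((h1 (i + 1) (by omega)).smul _).add (((h1 i hi).smul _).add ((h0 i hi).smul _))

/-- The recursion expresses the kernel through heat kernels at times between `t` and `(i + m + 2)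
t`. The off-diagonal factor at the largest time and the height at time `t` dominate them all, and
the coefficients grow at most like `7^m` because `6 · 7 + 1 ≤ 7²`. -/
theorem IsRealHeatKernel.norm_sandwich_chebHeat_le {t : ℝ} (ht : 0 < t) {x y : X}
    (h : ∀ i : ℕ, 1 ≤ i →
      sandwich μ k t (P.integral (heatFn (i * t))) x y = k (i * t + t + t) x y) (m : ℕ) :
    ∀ i : ℕ, 1 ≤ i → ‖sandwich μ k t (P.integral (chebHeat t i m)) x y‖
      ≤ 7 ^ m * (height d c₁ t
        * Real.exp (-(c₂ * ((dist x y) ^ (d + 1) / t / ((i + m : ℕ) + 2 : ℝ)) ^ γ))) := by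
  have hd := hk.d_pos
  have hγ := hk.γ_pos
  have hc := hk.c₂_pos
  have hH := hk.height_pos ht
  set E : ℕ → ℝ := fun j => height d c₁ t
    * Real.exp (-(c₂ * ((dist x y) ^ (d + 1) / t / ((j : ℝ) + 2)) ^ γ)) with hE
  have E0 : ∀ j, 0 ≤ E j := fun j => mul_nonneg hH.le (Real.exp_pos _).le
  have Emono : Monotone E := by
    intro a b hab
    have hab' : (a : ℝ) ≤ b := by exact_mod_cast hab
    refine mul_le_mul_of_nonneg_left (Real.exp_le_exp.2 (neg_le_neg
      (mul_le_mul_of_nonneg_left (Real.rpow_le_rpow (by positivity) ?_ hγ.le) hc.le))) hH.le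
    gcongr
  have base : ∀ i : ℕ, 1 ≤ i → ‖sandwich μ k t (P.integral (chebHeat t i 0)) x y‖ ≤ E i := by
    intro i hi
    have hi0 : (0 : ℝ) ≤ i := by positivity
    rw [chebHeat_zero, h i hi, Complex.norm_real, Real.norm_eq_abs]
    have e : (i : ℝ) * t + t + t = t * (i + 2) := by ring
    have ht' : t ≤ t * (i + 2) := by nlinarith
    rw [e]
    refine (hk.bound _ (by positivity) x y).trans ?_
    simp only [hE, div_div]
    refine mul_le_mul_of_nonneg_right ?_ (Real.exp_pos _).le
    refine mul_le_mul_of_nonneg_left ?_ hk.c₁_pos.le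
    exact Real.rpow_le_rpow_of_nonpos ht ht' (by rw [neg_nonpos]; positivity)
  induction m using Nat.twoStepInduction with
  | zero => intro i hi; simpa using base i hi
  | one =>
    intro i hi
    rw [integral_chebHeat_one P ht.le, sandwich_add, sandwich_smul, sandwich_smul]
    have b1 := base (i + 1) (by omega)
    have b2 := (base i hi).trans (Emono (Nat.le_succ i))
    refine (norm_add_le _ _).trans ?_
    rw [norm_mul, norm_mul, norm_neg, norm_one, Complex.norm_ofNat]
    change _ ≤ 7 ^ 1 * E (i + 1)
    rw [Nat.succ_eq_add_one] at b2
    linarith [E0 (i + 1)]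
  | more m h0 h1 =>
    intro i hi
    rw [integral_chebHeat_add_two P ht.le, sandwich_add, sandwich_add, sandwich_smul, sandwich_smul,
      sandwich_smul]
    have b1 : _ ≤ 7 ^ (m + 1) * E (i + 1 + (m + 1)) := h1 (i + 1) (by omega)
    have b2 : _ ≤ 7 ^ (m + 1) * E (i + (m + 1)) := h1 i hi
    have b3 : _ ≤ 7 ^ m * E (i + m) := h0 i hi
    have e1 : E (i + 1 + (m + 1)) ≤ E (i + (m + 2)) := Emono (by omega)
    have e2 : E (i + (m + 1)) ≤ E (i + (m + 2)) := Emono (by omega)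
    have e3 : E (i + m) ≤ E (i + (m + 2)) := Emono (by omega)
    have p0 : (0 : ℝ) < 7 ^ m := by positivity
    have b1' := b1.trans (mul_le_mul_of_nonneg_left e1 (by positivity))
    have b2' := b2.trans (mul_le_mul_of_nonneg_left e2 (by positivity))
    have b3' := b3.trans (mul_le_mul_of_nonneg_left e3 (by positivity))
    have hp := mul_nonneg p0.le (E0 (i + (m + 2)))
    refine (norm_add_le _ _).trans ((add_le_add le_rfl (norm_add_le _ _)).trans ?_)
    rw [norm_mul, norm_mul, norm_mul, norm_neg, norm_neg, norm_one, Complex.norm_ofNat,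
      Complex.norm_ofNat]
    change _ ≤ 7 ^ (m + 2) * E (i + (m + 2))
    rw [pow_succ] at b1' b2'
    have e7 : (7 : ℝ) ^ (m + 2) * E (i + (m + 2)) = 49 * (7 ^ m * E (i + (m + 2))) := by ring
    rw [e7]
    linarith

end ChebyshevOperators

/-- The competition between the growth of Chebyshev coefficients and the decay of the heat kernel
results in a polynomial bound. -/
theorem exists_min_pow_mul_exp_le {γ c : ℝ} (hγ : 0 < γ) (hc : 0 < c) (N : ℕ) :
    ∃ (M : ℕ) (C : ℝ), 0 < C ∧ ∀ (m : ℕ) (r : ℝ), 0 < r →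
      min 1 (7 ^ m * Real.exp (-(c * (r / (m + 3)) ^ γ))) ≤ C * (m + 1 : ℝ) ^ M * (r ^ N)⁻¹ := by
  -- With `a = m + 3`, beyond `r ≥ a^K` the condition `K ≥ 2` gives `r / a ≥ r^(1/2)` and `K ≥ 4/γ`
  -- gives `m ≤ r^(γ/4)`.
  obtain ⟨K, hK⟩ := exists_nat_ge (max 2 (4 / γ))
  have hK2 : (2 : ℝ) ≤ K := (le_max_left _ _).trans hK
  have hK4 : 4 / γ ≤ K := (le_max_right _ _).trans hK
  have hl7 : 0 < Real.log 7 := Real.log_pos (by norm_num)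
  -- The exponent is such that `s = r^(γ/2)` turns `s^(2N/γ)` into `r^N`.
  obtain ⟨C, hC⟩ := exists_rpow_mul_exp_neg_le (a := c / 2) (q := 2 * N / γ) (by positivity) (by positivity)
  -- the range of large `r` splits once more, at a threshold making the exponential win
  obtain ⟨A, hA⟩ : ∃ A : ℝ, 1 ≤ A ∧ ∀ s : ℝ, A ≤ s → Real.log 7 * s ^ (γ / 4) ≤ c / 2 * s ^ (γ / 2) := by
    have h1 : Tendsto (fun s : ℝ => s ^ (γ / 4)) atTop atTop := tendsto_rpow_atTop (by positivity)
    obtain ⟨A, hA⟩ := ((h1.eventually_ge_atTop (2 * Real.log 7 / c)).and (eventually_ge_atTop 1)).exists_forall_of_atTop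
    refine ⟨max A 1, le_max_right _ _, fun s hs => ?_⟩
    have hs1 : 0 < s := by linarith [le_max_right A 1]
    obtain ⟨h2, -⟩ := hA s ((le_max_left _ _).trans hs)
    have e : s ^ (γ / 2) = s ^ (γ / 4) * s ^ (γ / 4) := by
      rw [← Real.rpow_add hs1]; congr 1; ring
    rw [e, ← mul_assoc]
    refine mul_le_mul_of_nonneg_right ?_ (by positivity)
    rw [div_le_iff₀ hc] at h2
    linarith
  have C0 : 0 ≤ C := le_trans (by positivity) (hC 1 zero_le_one)
  refine ⟨K * N, A ^ N * 3 ^ (K * N) + C, by have := hA.1; positivity, fun m r hr => ?_⟩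
  have hA1 := hA.1
  set a : ℝ := m + 3 with ha
  have ha3 : 3 ≤ a := by rw [ha]; linarith [(Nat.cast_nonneg m : (0 : ℝ) ≤ m)]
  have ham : a ≤ 3 * (m + 1) := by rw [ha]; linarith [(Nat.cast_nonneg m : (0 : ℝ) ≤ m)]
  have hm1 : (1 : ℝ) ≤ (m + 1 : ℝ) ^ (K * N) := one_le_pow₀ (by linarith [(Nat.cast_nonneg m : (0 : ℝ) ≤ m)])
  rw [← div_eq_mul_inv, le_div_iff₀ (by positivity)]
  -- For small `r` the bound `1` suffices, since `r^N` is at most polynomial in `m`. For large `r`,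
  -- half of the exponent absorbs `7^m` and the other half absorbs `r^N`.
  rcases le_or_gt r (A * a ^ K) with hle | hgt
  · calc min 1 (7 ^ m * Real.exp (-(c * (r / a) ^ γ))) * r ^ N ≤ 1 * (A * a ^ K) ^ N := by
          gcongr
          exact min_le_left _ _
      _ ≤ A ^ N * (3 * (m + 1)) ^ (K * N) := by
          rw [one_mul, mul_pow, ← pow_mul]
          gcongr
      _ = A ^ N * 3 ^ (K * N) * (m + 1) ^ (K * N) := by rw [mul_pow]; ring
      _ ≤ _ := by
          gcongr
          linarith
  · have haK : 1 ≤ a ^ K := one_le_pow₀ (by linarith)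
    have hrA : A ≤ r := by nlinarith
    have hra : a ^ K ≤ r := by nlinarith
    have hra' : a ^ (K : ℝ) ≤ r := by rwa [Real.rpow_natCast]
    have h1a : (1 : ℝ) ≤ a := by linarith
    -- consequences of `r ≥ a ^ K`
    have k1 : r ^ (1 / 2 : ℝ) ≤ r / a := by
      have : a ≤ r ^ (1 / 2 : ℝ) := by
        calc a = (a ^ (2 : ℝ)) ^ (1 / 2 : ℝ) := by rw [← Real.rpow_mul (by linarith)]; norm_num
          _ ≤ r ^ (1 / 2 : ℝ) := by
            refine Real.rpow_le_rpow (by positivity) ?_ (by norm_num)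
            exact (Real.rpow_le_rpow_of_exponent_le h1a hK2).trans hra'
      rw [le_div_iff₀ (by linarith)]
      calc r ^ (1 / 2 : ℝ) * a ≤ r ^ (1 / 2 : ℝ) * r ^ (1 / 2 : ℝ) := by gcongr
        _ = r := by rw [← Real.rpow_add hr]; norm_num
    have k2 : (m : ℝ) ≤ r ^ (γ / 4) := by
      have : a ≤ r ^ (γ / 4) := by
        calc a = (a ^ (4 / γ)) ^ (γ / 4) := by
              rw [← Real.rpow_mul (by linarith), show 4 / γ * (γ / 4) = 1 by field_simp, Real.rpow_one]
          _ ≤ r ^ (γ / 4) := by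
            refine Real.rpow_le_rpow (by positivity) ?_ (by positivity)
            exact (Real.rpow_le_rpow_of_exponent_le h1a hK4).trans hra'
      rw [ha] at this
      linarith
    have k3 : r ^ (γ / 2) ≤ (r / a) ^ γ := by
      calc r ^ (γ / 2) = (r ^ (1 / 2 : ℝ)) ^ γ := by
            rw [← Real.rpow_mul hr.le]; congr 1; ring
        _ ≤ _ := Real.rpow_le_rpow (by positivity) k1 hγ.le
    have k4 : (7 : ℝ) ^ m * Real.exp (-(c * (r / a) ^ γ)) ≤ Real.exp (-(c / 2 * r ^ (γ / 2))) := by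
      have e7 : (7 : ℝ) ^ m = Real.exp (m * Real.log 7) := by
        rw [Real.exp_nat_mul, Real.exp_log (by norm_num)]
      rw [e7, ← Real.exp_add, Real.exp_le_exp]
      have h1 := hA.2 r hrA
      have h2 := mul_le_mul_of_nonneg_left k3 hc.le
      have h3 := mul_le_mul_of_nonneg_right k2 hl7.le
      linarith
    have k5 := hC (r ^ (γ / 2)) (by positivity)
    have e5 : (r ^ (γ / 2)) ^ (2 * N / γ : ℝ) = r ^ N := by
      rw [← Real.rpow_mul hr.le, ← Real.rpow_natCast]
      congr 1
      field_simp
    rw [e5] at k5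
    calc min 1 (7 ^ m * Real.exp (-(c * (r / a) ^ γ))) * r ^ N
        ≤ Real.exp (-(c / 2 * r ^ (γ / 2))) * r ^ N := by
          gcongr
          exact (min_le_right _ _).trans k4
      _ ≤ C := by rw [mul_comm]; refine le_trans (le_of_eq ?_) k5; ring_nf
      _ ≤ (A ^ N * 3 ^ (K * N) + C) * 1 := by
          have : 0 ≤ A ^ N * 3 ^ (K * N) := by positivity
          linarith
      _ ≤ _ := by gcongr

theorem SpectralMeasure.integral_finset_sum {H : Type*} [NormedAddCommGroup H]
    [InnerProductSpace ℂ H] [CompleteSpace H] (P : SpectralMeasure H) {ι : Type*} {g : ι → ℝ → ℂ}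
    (hg : ∀ i, BddMeas (g i)) (S : Finset ι) : BddMeas (∑ i ∈ S, g i) ∧
      P.integral (∑ i ∈ S, g i) = ∑ i ∈ S, P.integral (g i) := by
  classical
  induction S using Finset.induction_on with
  | empty =>
    have b0 : BddMeas 0 := by simpa using BddMeas.one.smul 0
    refine ⟨by simpa using b0, ?_⟩
    simpa using P.integral_smul 0 BddMeas.one
  | insert a S ha ih =>
    rw [Finset.sum_insert ha, Finset.sum_insert ha, P.integral_add (hg a) ih.1, ih.2]
    exact ⟨(hg a).add ih.1, rfl⟩

/-- Uniformly absolutely convergent series may be integrated term by term. -/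
theorem SpectralMeasure.hasSum_integral {H : Type*} [NormedAddCommGroup H] [InnerProductSpace ℂ H]
    [CompleteSpace H] (P : SpectralMeasure H) {ι : Type*} [Countable ι] {g : ι → ℝ → ℂ} {b : ι → ℝ}
    (hg : ∀ i, BddMeas (g i)) (hb : Summable b) (h : ∀ i s, ‖g i s‖ ≤ b i) :
    HasSum (fun i => P.integral (g i)) (P.integral fun s => ∑' i, g i s) := by
  have hs : ∀ s, Summable fun i => ‖g i s‖ := fun s =>
    hb.of_nonneg_of_le (fun _ => norm_nonneg _) fun i => h i s
  have mg : Measurable fun s => ∑' i, g i s := by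
    refine measurable_of_tendsto_metrizable' (atTop : Filter (Finset ι))
      (f := fun S s => ∑ i ∈ S, g i s) (fun S => Finset.measurable_fun_sum S fun i _ => (hg i).1) ?_
    exact tendsto_pi_nhds.2 fun s => (hs s).of_norm.hasSum
  have tail : ∀ (S : Finset ι) s, ‖(∑ i ∈ S, g i s) - ∑' i, g i s‖ ≤ (∑' i, b i) - ∑ i ∈ S, b i := by
    intro S s
    have e1 := (hs s).of_norm.sum_add_tsum_compl (s := S)
    have e2 := hb.sum_add_tsum_compl (s := S)
    rw [← e1, ← e2, sub_add_cancel_left, norm_neg, add_sub_cancel_left]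
    refine (norm_tsum_le_tsum_norm ((hs s).subtype _)).trans ?_
    exact ((hs s).subtype _).tsum_le_tsum (fun i => h i s) (hb.subtype _)
  have bS := fun S : Finset ι => P.integral_finset_sum hg S
  have bg : BddMeas fun s => ∑' i, g i s := by
    refine ⟨mg, (∑' i, b i) - ∑ i ∈ ∅, b i, fun s => ?_⟩
    simpa using tail ∅ s
  rw [HasSum, tendsto_iff_norm_sub_tendsto_zero]
  have lim : Tendsto (fun S : Finset ι => (∑' i, b i) - ∑ i ∈ S, b i) atTop (𝓝 0) := by
    simpa using (tendsto_const_nhds (x := ∑' i, b i)).sub hb.hasSum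
  refine squeeze_zero (fun _ => norm_nonneg _) (fun S => ?_) lim
  rw [← (bS S).2, ← P.integral_sub (bS S).1 bg]
  refine P.norm_integral_le ((bS S).1.1.sub mg) ?_ fun s => ?_
  · exact (norm_nonneg _).trans (tail S 0)
  · simpa using tail S s

end

noncomputable section

/-! ### Rapidly convergent Chebyshev expansions of localized symbols. -/

section ChebyshevSeries

/-- The function `θ ↦ τ` with `e^{-τ} = (1 + cos θ) / 2`. -/
def cosTime (θ : ℝ) : ℝ := -Real.log ((1 + Real.cos θ) / 2)

/-- The set where `1/2 ≤ cosTime θ ≤ 2`. -/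
def cosBand : Set ℝ := {θ | (1 + Real.cos θ) / 2 ∈ Icc (Real.exp (-2)) (Real.exp (-(1 / 2)))}

theorem isClosed_cosBand : IsClosed cosBand :=
  isClosed_Icc.preimage ((continuous_const.add Real.continuous_cos).div_const 2)

theorem one_add_cos_pos {θ : ℝ} (h : θ ∈ cosBand) : 0 < 1 + Real.cos θ := by
  have := (Real.exp_pos (-2)).trans_le h.1
  linarith

theorem cosTime_mem_Icc {θ : ℝ} (h : θ ∈ cosBand) : cosTime θ ∈ Icc (1 / 2 : ℝ) 2 := by
  have h0 : 0 < (1 + Real.cos θ) / 2 := by linarith [one_add_cos_pos h]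
  have h1 := (Real.le_log_iff_exp_le h0).2 h.1
  have h2 := (Real.log_le_iff_le_exp h0).2 h.2
  constructor <;> rw [cosTime] <;> linarith

theorem cosTime_pos {θ : ℝ} (h : θ ∈ cosBand) : 0 < cosTime θ := by
  linarith [(cosTime_mem_Icc h).1]

theorem hasDerivAt_cosTime {θ : ℝ} (h : 0 < 1 + Real.cos θ) :
    HasDerivAt cosTime (Real.sin θ / (1 + Real.cos θ)) θ := by
  have h1 : HasDerivAt (fun θ => (1 + Real.cos θ) / 2) (-Real.sin θ / 2) θ :=
    ((Real.hasDerivAt_cos θ).const_add 1).div_const 2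
  have h2 : HasDerivAt cosTime _ θ := (h1.log (by linarith)).neg
  refine h2.congr_deriv ?_
  field_simp

/-- A smooth function supported where `1/2 ≤ cosTime ≤ 2`. -/
def IsAmplitude (β : ℝ → ℂ) : Prop := ContDiff ℝ ∞ β ∧ tsupport β ⊆ cosBand

theorem contDiff_of_contDiffAt_tsupport {β : ℝ → ℂ} (h : ∀ θ ∈ tsupport β, ContDiffAt ℝ ∞ β θ) :
    ContDiff ℝ ∞ β := by
  refine contDiff_iff_contDiffAt.2 fun θ => ?_
  by_cases hθ : θ ∈ tsupport β
  · exact h θ hθ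
  · exact contDiffAt_const.congr_of_eventuallyEq (notMem_tsupport_iff_eventuallyEq.1 hθ)

namespace IsAmplitude

variable {β : ℝ → ℂ}

theorem deriv (hβ : IsAmplitude β) : IsAmplitude (deriv β) :=
  ⟨(contDiff_infty_iff_deriv.1 hβ.1).2,
    (closure_minimal support_deriv_subset (isClosed_tsupport β)).trans hβ.2⟩

theorem mul_of_contDiffAt (hβ : IsAmplitude β) {g : ℝ → ℂ}
    (hg : ∀ θ ∈ cosBand, ContDiffAt ℝ ∞ g θ) : IsAmplitude fun θ => β θ * g θ := by
  have hs : tsupport (fun θ => β θ * g θ) ⊆ tsupport β := by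
    refine closure_mono fun θ hθ => ?_
    rw [Function.mem_support] at hθ ⊢
    exact left_ne_zero_of_mul hθ
  exact ⟨contDiff_of_contDiffAt_tsupport fun θ hθ =>
    hβ.1.contDiffAt.mul (hg θ (hβ.2 (hs hθ))), hs.trans hβ.2⟩

theorem mul_deriv_cosTime (hβ : IsAmplitude β) :
    IsAmplitude fun θ => β θ * ((Real.sin θ / (1 + Real.cos θ) : ℝ) : ℂ) := by
  refine hβ.mul_of_contDiffAt fun θ hθ => Complex.ofRealCLM.contDiff.contDiffAt.comp θ ?_
  exact Real.contDiff_sin.contDiffAt.div (contDiffAt_const.add Real.contDiff_cos.contDiffAt)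
    (one_add_cos_pos hθ).ne'

theorem eq_zero (hβ : IsAmplitude β) {θ : ℝ} (hθ : Real.cos θ = -1) : β θ = 0 := by
  by_contra h
  have := one_add_cos_pos (hβ.2 (subset_tsupport β h))
  linarith

end IsAmplitude

/-- The `k`-th derivative of the function `s ↦ p (s / t)`. -/
def scaledDeriv (p : ℝ → ℂ) (t : ℝ) (k : ℕ) (s : ℝ) : ℂ :=
  ((t⁻¹ ^ k : ℝ) : ℂ) * iteratedDeriv k p (s / t)

theorem scaledDeriv_zero (p : ℝ → ℂ) (t s : ℝ) : scaledDeriv p t 0 s = p (s / t) := by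
  simp [scaledDeriv]

namespace IsSymbolZero

variable {p : ℝ → ℂ} (hp : IsSymbolZero p)
include hp

theorem hasDerivAt_iteratedDeriv (k : ℕ) {s : ℝ} (hs : 0 < s) :
    HasDerivAt (iteratedDeriv k p) (iteratedDeriv (k + 1) p s) s := by
  rw [iteratedDeriv_succ]
  refine DifferentiableAt.hasDerivAt ?_
  have h1 := hp.1.differentiableOn_iteratedDerivWithin (m := k) (by exact_mod_cast ENat.natCast_lt_top k)
    isOpen_Ioi.uniqueDiffOn
  exact (h1.congr fun x hx => (iteratedDerivWithin_of_isOpen isOpen_Ioi hx).symm).differentiableAt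
    (Ioi_mem_nhds hs)

theorem hasDerivAt_scaledDeriv {t : ℝ} (ht : 0 < t) (k : ℕ) {s : ℝ} (hs : 0 < s) :
    HasDerivAt (scaledDeriv p t k) (scaledDeriv p t (k + 1) s) s := by
  have h1 : HasDerivAt (fun s : ℝ => s / t) (1 / t) s := (hasDerivAt_id s).div_const t
  have h2 : HasDerivAt (scaledDeriv p t k) _ s :=
    ((hp.hasDerivAt_iteratedDeriv k (div_pos hs ht)).scomp s h1).const_mul ((t⁻¹ ^ k : ℝ) : ℂ)
  refine h2.congr_deriv ?_
  simp only [scaledDeriv, pow_succ, Complex.real_smul]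
  push_cast
  ring

/-- Scale invariance of the symbol class: the derivative equals `s^(-k)` times `(s/t)^k
p^{(k)}(s/t)`, and `s` stays away from `0`. -/
theorem exists_norm_scaledDeriv_le (k : ℕ) : ∃ C : ℝ, 0 < C ∧ ∀ t s : ℝ, 0 < t → 1 / 2 ≤ s →
    ‖scaledDeriv p t k s‖ ≤ C := by
  obtain ⟨C, hC0, hC⟩ := hp.2 k
  refine ⟨2 ^ k * C, by positivity, fun t s ht hs => ?_⟩
  have hs0 : 0 < s := by linarith
  have e : scaledDeriv p t k s = ((s⁻¹ ^ k : ℝ) : ℂ)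
      * ((((s / t : ℝ) : ℂ)) ^ k * iteratedDeriv k p (s / t)) := by
    rw [scaledDeriv, ← mul_assoc]
    congr 1
    norm_cast
    rw [← mul_pow]
    congr 1
    field_simp
  rw [e, norm_mul, Complex.norm_real, Real.norm_eq_abs, abs_of_nonneg (by positivity)]
  refine mul_le_mul (pow_le_pow_left₀ (by positivity) ?_ k) (hC _ (by positivity)) (norm_nonneg _)
    (by positivity)
  rw [inv_le_comm₀ hs0 two_pos]
  linarith

/-- The derivative is a sum of two expressions of the same kind, the amplitude being multiplied by
the derivative of `cosTime` when `p` is differentiated. Outside the support of `β`, where `cosTime`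
need not be smooth, everything vanishes. -/
theorem hasDerivAt_amplitude {β : ℝ → ℂ} (hβ : IsAmplitude β) {t : ℝ} (ht : 0 < t) (k : ℕ) (θ : ℝ) :
    HasDerivAt (fun θ => β θ * scaledDeriv p t k (cosTime θ))
      (deriv β θ * scaledDeriv p t k (cosTime θ)
        + β θ * ((Real.sin θ / (1 + Real.cos θ) : ℝ) : ℂ) * scaledDeriv p t (k + 1) (cosTime θ)) θ := by
  by_cases hθ : θ ∈ tsupport β
  · have hb := hβ.2 hθ
    have h1 := (hp.hasDerivAt_scaledDeriv ht k (cosTime_pos hb)).scomp θ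
      (hasDerivAt_cosTime (one_add_cos_pos hb))
    have h2 : HasDerivAt (fun θ => β θ * scaledDeriv p t k (cosTime θ)) _ θ :=
      ((hβ.1.differentiable (by simp)).differentiableAt (x := θ)).hasDerivAt.mul h1
    refine h2.congr_deriv ?_
    simp only [Complex.real_smul]
    ring
  · have h0 := notMem_tsupport_iff_eventuallyEq.1 hθ
    have h1 : (fun θ => β θ * scaledDeriv p t k (cosTime θ)) =ᶠ[𝓝 θ] fun _ => 0 := by
      filter_upwards [h0] with x hx
      rw [hx]; simp
    rw [h0.deriv_eq, h0.eq_of_nhds]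
    simpa using (hasDerivAt_const θ (0 : ℂ)).congr_of_eventuallyEq h1

theorem continuous_amplitude {β : ℝ → ℂ} (hβ : IsAmplitude β) {t : ℝ} (ht : 0 < t) (k : ℕ) :
    Continuous fun θ => β θ * scaledDeriv p t k (cosTime θ) :=
  continuous_iff_continuousAt.2 fun θ => (hp.hasDerivAt_amplitude hβ ht k θ).continuousAt

theorem exists_norm_amplitude_le {β : ℝ → ℂ} (hβ : IsAmplitude β) (k : ℕ) :
    ∃ C : ℝ, 0 < C ∧ ∀ t θ : ℝ, 0 < t → θ ∈ Icc (-Real.pi) Real.pi →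
      ‖β θ * scaledDeriv p t k (cosTime θ)‖ ≤ C := by
  obtain ⟨C, hC0, hC⟩ := hp.exists_norm_scaledDeriv_le k
  obtain ⟨B, hB⟩ := isCompact_Icc.exists_bound_of_continuousOn (s := Icc (-Real.pi) Real.pi)
    hβ.1.continuous.continuousOn
  have hB0 : 0 ≤ B := (norm_nonneg _).trans (hB 0 ⟨by linarith [Real.pi_pos], Real.pi_pos.le⟩)
  refine ⟨(B + 1) * C, by positivity, fun t θ ht hθ => ?_⟩
  rw [norm_mul]
  by_cases h : β θ = 0
  · rw [h, norm_zero, zero_mul]; positivity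
  · have := cosTime_mem_Icc (hβ.2 (subset_tsupport β h))
    exact mul_le_mul ((hB θ hθ).trans (by linarith)) (hC t _ ht this.1) (norm_nonneg _)
      (by positivity)

/-- Fourier coefficients of symbols localized to a dyadic frequency band decay rapidly, uniformly
in the scale. -/
theorem exists_norm_fourierIntegral_le (M : ℕ) : ∀ (k : ℕ) (β : ℝ → ℂ), IsAmplitude β →
    ∃ C : ℝ, 0 < C ∧ ∀ (t : ℝ) (n : ℤ), 0 < t →
      ‖∫ θ in (-Real.pi)..Real.pi, β θ * scaledDeriv p t k (cosTime θ)
        * Complex.exp (-(n * θ * Complex.I))‖ * |(n : ℝ)| ^ M ≤ C := by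
  induction M with
  | zero =>
    intro k β hβ
    obtain ⟨C, hC0, hC⟩ := hp.exists_norm_amplitude_le hβ k
    have hπ : 0 < |Real.pi - -Real.pi| := abs_pos.2 (by linarith [Real.pi_pos])
    refine ⟨C * |Real.pi - -Real.pi|, by positivity, fun t n ht => ?_⟩
    rw [pow_zero, mul_one]
    refine intervalIntegral.norm_integral_le_of_norm_le_const fun θ hθ => ?_
    rw [uIoc_of_le (by linarith [Real.pi_pos])] at hθ
    have e : Complex.exp (-(n * θ * Complex.I)) = Complex.exp ((-(n * θ) : ℝ) * Complex.I) := by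
      congr 1; push_cast; ring
    rw [norm_mul, e, Complex.norm_exp_ofReal_mul_I, mul_one]
    exact hC t θ ht (Ioc_subset_Icc_self hθ)
  | succ M ih =>
    intro k β hβ
    -- Integration by parts gains one factor `n`. The two terms of the derivative involve other
    -- amplitudes and the next order `k + 1`, which is why the induction runs over all `k` and `β`
    -- at once.
    obtain ⟨C₁, hC₁0, hC₁⟩ := ih k _ hβ.deriv
    obtain ⟨C₂, hC₂0, hC₂⟩ := ih (k + 1) _ hβ.mul_deriv_cosTime
    refine ⟨C₁ + C₂, by positivity, fun t n ht => ?_⟩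
    have h1 := hC₁ t n ht
    have h2 := hC₂ t n ht
    set I₁ := ∫ θ in (-Real.pi)..Real.pi, deriv β θ * scaledDeriv p t k (cosTime θ)
        * Complex.exp (-(n * θ * Complex.I)) with hI₁
    set I₂ := ∫ θ in (-Real.pi)..Real.pi, β θ * ((Real.sin θ / (1 + Real.cos θ) : ℝ) : ℂ)
      * scaledDeriv p t (k + 1) (cosTime θ) * Complex.exp (-(n * θ * Complex.I)) with hI₂
    have ce : Continuous fun θ : ℝ => Complex.exp (-(n * θ * Complex.I)) := by fun_prop
    have c1 := (hp.continuous_amplitude hβ.deriv ht k).mul ce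
    have c2 := (hp.continuous_amplitude hβ.mul_deriv_cosTime ht (k + 1)).mul ce
    have ibp := intervalIntegral.integral_mul_deriv_eq_deriv_mul (a := -Real.pi) (b := Real.pi)
      (u := fun θ => β θ * scaledDeriv p t k (cosTime θ))
      (v := fun θ : ℝ => Complex.exp (-(n * θ * Complex.I)))
      (v' := fun θ : ℝ => Complex.exp (-(n * θ * Complex.I)) * (-(n * Complex.I)))
      (fun θ _ => hp.hasDerivAt_amplitude hβ ht k θ)
      (fun θ _ => by
        have : HasDerivAt (fun θ : ℝ => (-(n * θ * Complex.I) : ℂ)) _ θ :=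
          (((Complex.ofRealCLM.hasDerivAt (x := θ)).const_mul (n : ℂ)).mul_const Complex.I).neg
        exact (this.congr_deriv (by simp)).cexp)
      (((hp.continuous_amplitude hβ.deriv ht k).add
        (hp.continuous_amplitude hβ.mul_deriv_cosTime ht (k + 1))).intervalIntegrable _ _)
      ((ce.mul continuous_const).intervalIntegrable _ _)
    -- The boundary terms vanish: `θ = ±π` corresponds to `v = 0`, outside the frequency band.
    rw [hβ.eq_zero Real.cos_pi, hβ.eq_zero (by rw [Real.cos_neg, Real.cos_pi])] at ibp
    simp only [add_mul] at ibp
    have add := intervalIntegral.integral_add (c1.intervalIntegrable (μ := volume) (-Real.pi) Real.pi)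
      (c2.intervalIntegrable _ _)
    simp only [Pi.mul_apply] at add
    rw [add, ← hI₁, ← hI₂] at ibp
    have e : ∀ θ : ℝ, β θ * scaledDeriv p t k (cosTime θ)
        * (Complex.exp (-(n * θ * Complex.I)) * (-(n * Complex.I)))
        = -(n * Complex.I) * (β θ * scaledDeriv p t k (cosTime θ)
          * Complex.exp (-(n * θ * Complex.I))) := fun θ => by ring
    simp only [e] at ibp
    rw [intervalIntegral.integral_const_mul] at ibp
    have en := congrArg norm ibp
    rw [norm_mul, norm_neg, norm_mul, Complex.norm_I, mul_one, Complex.norm_intCast] at en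
    simp only [zero_mul, sub_zero, zero_sub, norm_neg] at en
    rw [pow_succ, mul_comm (|(n : ℝ)| ^ M), ← mul_assoc, mul_comm _ (|(n : ℝ)|), en]
    have := mul_le_mul_of_nonneg_right (norm_add_le I₁ I₂) (by positivity : 0 ≤ |(n : ℝ)| ^ M)
    linarith [add_mul ‖I₁‖ ‖I₂‖ (|(n : ℝ)| ^ M)]

end IsSymbolZero

/-- A smooth function supported in `[1/2, 2]`. -/
def IsDyadicBump (δ : ℝ → ℝ) : Prop := ContDiff ℝ ∞ δ ∧ ∀ τ, δ τ ≠ 0 → τ ∈ Icc (1 / 2 : ℝ) 2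

/-- The exponent `3` makes up for three factors `e^{-τ}`: one for each outer heat operator and one
for the factor `v` in `chebHeat t 1 m`. -/
theorem IsDyadicBump.isAmplitude {δ : ℝ → ℝ} (hδ : IsDyadicBump δ) (l : ℕ) : IsAmplitude fun θ =>
    ((cosTime θ ^ l * δ (cosTime θ) * Real.exp (3 * cosTime θ) : ℝ) : ℂ) := by
  have hs : tsupport (fun θ => ((cosTime θ ^ l * δ (cosTime θ) * Real.exp (3 * cosTime θ) : ℝ) : ℂ))
      ⊆ cosBand := by
    refine closure_minimal (fun θ hθ => ?_) isClosed_cosBand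
    rw [Function.mem_support, Complex.ofReal_ne_zero] at hθ
    obtain ⟨h1, h2⟩ := hδ.2 _ (right_ne_zero_of_mul (left_ne_zero_of_mul hθ))
    -- If `cos θ = -1`, the convention `log 0 = 0` gives `cosTime θ = 0`, which is outside `[1/2,
    -- 2]`.
    have h0 : 0 < (1 + Real.cos θ) / 2 := by
      refine lt_of_le_of_ne (by linarith [Real.neg_one_le_cos θ]) fun h => ?_
      rw [cosTime, ← h, Real.log_zero] at h1
      norm_num at h1
    rw [cosTime] at h1 h2
    exact ⟨(Real.le_log_iff_exp_le h0).1 (by linarith), (Real.log_le_iff_le_exp h0).1 (by linarith)⟩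
  refine ⟨contDiff_of_contDiffAt_tsupport fun θ hθ => ?_, hs⟩
  have hpos := one_add_cos_pos (hs hθ)
  have hc : ContDiffAt ℝ ∞ cosTime θ :=
    (((contDiffAt_const.add Real.contDiff_cos.contDiffAt).div_const 2).log (by linarith)).neg
  exact Complex.ofRealCLM.contDiff.contDiffAt.comp θ
    (((hc.pow l).mul (hδ.1.contDiffAt.comp θ hc)).mul
      (Real.contDiff_exp.contDiffAt.comp θ (contDiffAt_const.mul hc)))

/-- A dyadic piece of a symbol is, uniformly in the scale, a rapidly converging Chebyshev series in
`v = e^{-tλ}`. -/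
theorem IsSymbolZero.exists_chebyshev_series {p : ℝ → ℂ} (hp : IsSymbolZero p) {δ : ℝ → ℝ}
    (hδ : IsDyadicBump δ) (l N : ℕ) : ∃ C : ℝ, 0 < C ∧ ∀ t : ℝ, 0 < t → ∃ c : ℤ → ℂ,
      (∀ n, ‖c n‖ * (n.natAbs + 1 : ℝ) ^ N ≤ C) ∧ ∀ s : ℝ, 0 < s →
        HasSum (fun n => c n
          * ((Polynomial.Chebyshev.T ℝ n.natAbs).eval (2 * Real.exp (-(t * s)) - 1) : ℝ))
          ((((t * s) ^ l * δ (t * s) * Real.exp (3 * (t * s)) : ℝ) : ℂ) * p s) := by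
  have hβ := hδ.isAmplitude l
  set β : ℝ → ℂ := fun θ => ((cosTime θ ^ l * δ (cosTime θ) * Real.exp (3 * cosTime θ) : ℝ) : ℂ)
  obtain ⟨C₀, hC₀0, hC₀⟩ := hp.exists_norm_fourierIntegral_le 0 0 β hβ
  -- Two powers beyond `N` make the series summable. The estimate `C₀` without decay is needed as
  -- well, because `|n| + 1` and not `|n|` has to be controlled at `n = 0`.
  obtain ⟨C₁, hC₁0, hC₁⟩ := hp.exists_norm_fourierIntegral_le (N + 2) 0 β hβ
  refine ⟨2 ^ (N + 2) * (C₀ + C₁), by positivity, fun t ht => ?_⟩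
  set F : ℝ → ℂ := fun θ => β θ * scaledDeriv p t 0 (cosTime θ) with hF
  have hcont : Continuous F := hp.continuous_amplitude hβ ht 0
  have hcos : ∀ θ θ', Real.cos θ = Real.cos θ' → F θ = F θ' := by
    intro θ θ' h
    have : cosTime θ = cosTime θ' := by rw [cosTime, cosTime, h]
    simp only [hF, β, this]
  have hper : Function.Periodic F (2 * Real.pi) := fun θ => hcos _ _ (Real.cos_add_two_pi θ)
  have : Fact (0 < 2 * Real.pi) := ⟨Real.two_pi_pos⟩
  let g : C(AddCircle (2 * Real.pi), ℂ) := ⟨hper.lift, hcont.quotient_liftOn' _⟩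
  have hg : ∀ θ : ℝ, g θ = F θ := fun θ => hper.lift_coe θ
  have hfour : ∀ (n : ℤ) (θ : ℝ), fourier n (θ : AddCircle (2 * Real.pi))
      = Complex.exp (n * θ * Complex.I) := by
    intro n θ
    rw [fourier_coe_apply]
    congr 1
    have : (Real.pi : ℂ) ≠ 0 := by exact_mod_cast Real.pi_ne_zero
    push_cast
    field_simp
  have hcoef : ∀ n, ‖fourierCoeff g n‖ ≤ ‖∫ θ in (-Real.pi)..Real.pi, F θ
      * Complex.exp (-(n * θ * Complex.I))‖ := by
    intro n
    rw [fourierCoeff_eq_intervalIntegral _ n (-Real.pi), show -Real.pi + 2 * Real.pi = Real.pi by ring]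
    have e : ∀ θ : ℝ, fourier (-n) (θ : AddCircle (2 * Real.pi)) • g θ
        = F θ * Complex.exp (-(n * θ * Complex.I)) := by
      intro θ
      rw [hg, hfour, smul_eq_mul, mul_comm]
      congr 2
      push_cast
      ring
    simp only [e]
    rw [norm_smul]
    refine mul_le_of_le_one_left (norm_nonneg _) ?_
    rw [Real.norm_eq_abs, abs_of_pos (by positivity), div_le_one Real.two_pi_pos]
    linarith [Real.pi_gt_three]
  have hbound : ∀ n : ℤ, ‖fourierCoeff g n‖ * (n.natAbs + 1 : ℝ) ^ (N + 2)
      ≤ 2 ^ (N + 2) * (C₀ + C₁) := by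
    intro n
    have h0 := hC₀ t n ht
    have h1 := hC₁ t n ht
    rw [pow_zero, mul_one] at h0
    have hn : (n.natAbs : ℝ) = |(n : ℝ)| := by rw [Nat.cast_natAbs]; simp
    rw [hn]
    have hle : (|(n : ℝ)| + 1) ^ (N + 2) ≤ 2 ^ (N + 2) * (1 + |(n : ℝ)| ^ (N + 2)) := by
      rcases le_total |(n : ℝ)| 1 with h | h
      · have : (|(n : ℝ)| + 1) ^ (N + 2) ≤ 2 ^ (N + 2) :=
          pow_le_pow_left₀ (by positivity) (by linarith) _
        refine this.trans (le_mul_of_one_le_right (by positivity) ?_)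
        linarith [show 0 ≤ |(n : ℝ)| ^ (N + 2) by positivity]
      · have : (|(n : ℝ)| + 1) ^ (N + 2) ≤ (2 * |(n : ℝ)|) ^ (N + 2) :=
          pow_le_pow_left₀ (by positivity) (by linarith) _
        rw [mul_pow] at this
        refine this.trans (mul_le_mul_of_nonneg_left (by linarith) (by positivity))
    refine (mul_le_mul (hcoef n) hle (by positivity) (norm_nonneg _)).trans ?_
    nlinarith [show (0 : ℝ) < 2 ^ (N + 2) by positivity]
  refine ⟨fourierCoeff g, fun n => le_trans ?_ (hbound n), fun s hs => ?_⟩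
  · refine mul_le_mul_of_nonneg_left (pow_le_pow_right₀ ?_ (by omega)) (norm_nonneg _)
    linarith [(Nat.cast_nonneg n.natAbs : (0 : ℝ) ≤ _)]
  have hsum : Summable (fourierCoeff g) := by
    refine Summable.of_norm_bounded_eventually
      (g := fun n : ℤ => 2 ^ (N + 2) * (C₀ + C₁) * (1 / |(n : ℝ)| ^ 2)) ?_ ?_
    · refine Summable.mul_left _ ?_
      simpa only [sq_abs] using Real.summable_one_div_int_pow.2 one_lt_two
    · rw [eventually_cofinite]
      refine (Set.finite_singleton (0 : ℤ)).subset fun n hn => ?_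
      by_contra h0
      refine hn ?_
      have hn0 : 0 < |(n : ℝ)| := abs_pos.2 (Int.cast_ne_zero.2 h0)
      rw [mul_one_div, le_div_iff₀ (by positivity)]
      refine le_trans (mul_le_mul_of_nonneg_left ?_ (norm_nonneg _)) (hbound n)
      have hn : (n.natAbs : ℝ) = |(n : ℝ)| := by rw [Nat.cast_natAbs]; simp
      rw [hn]
      exact (pow_le_pow_left₀ hn0.le (by linarith) 2).trans
        (pow_le_pow_right₀ (by linarith) (by omega))
  have hv0 := Real.exp_pos (-(t * s))
  have hv1 : Real.exp (-(t * s)) ≤ 1 := Real.exp_le_one_iff.2 (by nlinarith)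
  -- The angle at which `F` takes the value of the localized symbol at `s`, since `cosTime θ = t s`.
  set θ := Real.arccos (2 * Real.exp (-(t * s)) - 1)
  have hθ : Real.cos θ = 2 * Real.exp (-(t * s)) - 1 :=
    Real.cos_arccos (by linarith) (by linarith)
  have hτ : cosTime θ = t * s := by
    rw [cosTime, hθ]
    rw [show (1 + (2 * Real.exp (-(t * s)) - 1)) / 2 = Real.exp (-(t * s)) by ring, Real.log_exp,
      neg_neg]
  have hFθ : F θ = (((t * s) ^ l * δ (t * s) * Real.exp (3 * (t * s)) : ℝ) : ℂ) * p s := by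
    simp only [hF, β, hτ, scaledDeriv_zero]
    rw [mul_div_cancel_left₀ s ht.ne']
  -- As `F` is even, averaging its Fourier series at `θ` and `-θ` turns `e^{inθ}` into `cos nθ =
  -- T_{|n|}(cos θ)`.
  have s1 := has_pointwise_sum_fourier_series_of_summable hsum (θ : AddCircle (2 * Real.pi))
  have s2 := has_pointwise_sum_fourier_series_of_summable hsum ((-θ : ℝ) : AddCircle (2 * Real.pi))
  rw [hg] at s1 s2
  rw [hcos (-θ) θ (Real.cos_neg θ)] at s2
  have s3 := (s1.add s2).mul_left (1 / 2 : ℂ)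
  rw [← hFθ, ← hθ]
  rw [show F θ = 1 / 2 * (F θ + F θ) by ring]
  refine s3.congr_fun fun n => ?_
  rw [hfour, hfour, Polynomial.Chebyshev.T_natAbs, Polynomial.Chebyshev.T_real_cos,
    Complex.ofReal_cos, Complex.cos]
  simp only [smul_eq_mul]
  push_cast
  ring_nf

end ChebyshevSeries

end

noncomputable section

/-! ### Dyadic sums and the dyadic partition of unity. -/

section DyadicSums

/-- Shifting `n` by `m` with `2^m ≤ r < 2^(m+1)` reduces to `r = 1`. There `a > 0` gives a geometric
series as `n → -∞`, and `a < N` one as `n → ∞`. -/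
theorem exists_tsum_dyadic_le {a : ℝ} (ha : 0 < a) {N : ℕ} (hN : a < N) :
    ∃ C : ℝ, ∀ r : ℝ, 0 < r →
      Summable (fun n : ℤ => ((2 : ℝ) ^ n) ^ a * min 1 (((2 : ℝ) ^ n * r) ^ N)⁻¹) ∧
      ∑' n : ℤ, ((2 : ℝ) ^ n) ^ a * min 1 (((2 : ℝ) ^ n * r) ^ N)⁻¹ ≤ C * r ^ (-a) := by
  set g : ℤ → ℝ := fun j => ((2 : ℝ) ^ j) ^ a * min 1 (((2 : ℝ) ^ j) ^ N)⁻¹ with hg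
  have p2 : ∀ j : ℤ, (0 : ℝ) < 2 ^ j := fun j => by positivity
  have g0 : ∀ j, 0 ≤ g j := fun j => by
    have := p2 j
    positivity
  have sg : Summable g := by
    refine Summable.of_nat_of_neg ?_ ?_
    · have hq : (2 : ℝ) ^ (a - N) < 1 := Real.rpow_lt_one_of_one_lt_of_neg one_lt_two (by linarith)
      refine (summable_geometric_of_lt_one (by positivity) hq).of_nonneg_of_le (fun _ => g0 _)
        fun n => ?_
      refine (mul_le_mul_of_nonneg_left (min_le_right _ _) (by positivity)).trans (le_of_eq ?_)
      rw [zpow_natCast, ← Real.rpow_natCast, ← Real.rpow_natCast, ← Real.rpow_natCast,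
        ← Real.rpow_mul zero_le_two, ← Real.rpow_mul zero_le_two, ← Real.rpow_mul zero_le_two,
        ← Real.rpow_neg zero_le_two, ← Real.rpow_add two_pos]
      congr 1
      ring
    · have hq : (2 : ℝ) ^ (-a) < 1 := Real.rpow_lt_one_of_one_lt_of_neg one_lt_two (by linarith)
      refine (summable_geometric_of_lt_one (by positivity) hq).of_nonneg_of_le (fun _ => g0 _)
        fun n => ?_
      refine (mul_le_mul_of_nonneg_left (min_le_left _ _) (by positivity)).trans (le_of_eq ?_)
      rw [mul_one, zpow_neg, zpow_natCast, ← Real.rpow_natCast, ← Real.rpow_natCast,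
        ← Real.rpow_neg zero_le_two, ← Real.rpow_mul zero_le_two, ← Real.rpow_mul zero_le_two]
      congr 1
      ring
  refine ⟨2 ^ a * ∑' j, g j, fun r hr => ?_⟩
  obtain ⟨m, hm1, hm2⟩ := exists_mem_Ico_zpow hr one_lt_two
  have hle : ∀ n : ℤ, ((2 : ℝ) ^ n) ^ a * min 1 (((2 : ℝ) ^ n * r) ^ N)⁻¹
      ≤ 2 ^ a * r ^ (-a) * g (n + m) := by
    intro n
    have e : (2 : ℝ) ^ (n + m) = 2 ^ n * 2 ^ m := zpow_add₀ two_ne_zero n m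
    have h1 : ((2 : ℝ) ^ n) ^ a ≤ 2 ^ a * r ^ (-a) * ((2 : ℝ) ^ (n + m)) ^ a := by
      rw [e, Real.mul_rpow (p2 n).le (p2 m).le, Real.rpow_neg hr.le]
      have h2 : r ^ a ≤ 2 ^ a * ((2 : ℝ) ^ m) ^ a := by
        rw [← Real.mul_rpow zero_le_two (p2 m).le]
        refine Real.rpow_le_rpow hr.le ?_ ha.le
        rw [zpow_add_one₀ two_ne_zero] at hm2
        linarith
      have h3 : 0 < r ^ a := by positivity
      have h4 : 0 < ((2 : ℝ) ^ n) ^ a := Real.rpow_pos_of_pos (p2 n) a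
      rw [show 2 ^ a * (r ^ a)⁻¹ * (((2 : ℝ) ^ n) ^ a * ((2 : ℝ) ^ m) ^ a)
        = ((2 : ℝ) ^ n) ^ a * (2 ^ a * ((2 : ℝ) ^ m) ^ a / r ^ a) by ring]
      exact le_mul_of_one_le_right h4.le ((one_le_div h3).2 h2)
    have h2 : min 1 (((2 : ℝ) ^ n * r) ^ N)⁻¹ ≤ min 1 (((2 : ℝ) ^ (n + m)) ^ N)⁻¹ := by
      refine min_le_min le_rfl ?_
      rw [e]
      have := p2 n
      have := p2 m
      gcongr
    have h5 : (0 : ℝ) ≤ min 1 (((2 : ℝ) ^ n * r) ^ N)⁻¹ := by positivity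
    calc _ ≤ 2 ^ a * r ^ (-a) * ((2 : ℝ) ^ (n + m)) ^ a * min 1 (((2 : ℝ) ^ (n + m)) ^ N)⁻¹ :=
          mul_le_mul h1 h2 h5 (by positivity)
      _ = _ := by rw [hg]; ring
  have sgm : Summable fun n : ℤ => g (n + m) := (Equiv.addRight m).summable_iff.2 sg
  have s1 : Summable fun n : ℤ => ((2 : ℝ) ^ n) ^ a * min 1 (((2 : ℝ) ^ n * r) ^ N)⁻¹ :=
    (sgm.mul_left _).of_nonneg_of_le (fun n => by positivity) hle
  refine ⟨s1, (s1.tsum_le_tsum hle (sgm.mul_left _)).trans (le_of_eq ?_)⟩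
  have eg : ∑' n : ℤ, g (n + m) = ∑' n, g n := (Equiv.addRight m).tsum_eq g
  rw [tsum_mul_left, eg]
  ring

/-- A smooth function equal to `1` on `(-∞, 1]` and to `0` on `[2, ∞)`. -/
def lowPass (τ : ℝ) : ℝ := Real.smoothTransition (2 - τ)

/-- A smooth function whose dyadic dilates sum to one on `(0, ∞)`. -/
def dyadicBump (τ : ℝ) : ℝ := lowPass τ - lowPass (2 * τ)

theorem lowPass_of_le_one {τ : ℝ} (h : τ ≤ 1) : lowPass τ = 1 :=
  Real.smoothTransition.one_of_one_le (by linarith)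

theorem lowPass_of_two_le {τ : ℝ} (h : 2 ≤ τ) : lowPass τ = 0 :=
  Real.smoothTransition.zero_of_nonpos (by linarith)

theorem contDiff_lowPass : ContDiff ℝ ∞ lowPass :=
  Real.smoothTransition.contDiff.comp (contDiff_const.sub contDiff_id)

theorem isDyadicBump_dyadicBump : IsDyadicBump dyadicBump := by
  refine ⟨contDiff_lowPass.sub (contDiff_lowPass.comp (contDiff_const.mul contDiff_id)),
    fun τ hτ => ⟨?_, ?_⟩⟩
  · by_contra! h
    refine hτ ?_
    rw [dyadicBump, lowPass_of_le_one (by linarith), lowPass_of_le_one (by linarith), sub_self]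
  · by_contra! h
    refine hτ ?_
    rw [dyadicBump, lowPass_of_two_le (by linarith), lowPass_of_two_le (by linarith), sub_self]

theorem sum_Ico_neg_sub (a : ℤ → ℝ) (m : ℕ) :
    ∑ n ∈ Finset.Ico (-m : ℤ) m, (a n - a (n - 1)) = a (m - 1) - a (-m - 1) := by
  induction m with
  | zero => simp
  | succ m ih =>
    have e : Finset.Ico (-((m + 1 : ℕ) : ℤ)) ((m + 1 : ℕ) : ℤ)
        = insert (-(m : ℤ) - 1) (insert (m : ℤ) (Finset.Ico (-m : ℤ) m)) := by
      ext x
      simp only [Finset.mem_Ico, Finset.mem_insert]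
      omega
    rw [e, Finset.sum_insert (by simp; try omega), Finset.sum_insert (by simp), ih]
    have e1 : (((m + 1 : ℕ) : ℤ)) - 1 = m := by push_cast; ring
    have e2 : -(((m + 1 : ℕ) : ℤ)) - 1 = -(m : ℤ) - 1 - 1 := by push_cast; ring
    rw [e1, e2]
    ring

/-- A telescoping sum: each bump is the difference of the low-pass cutoffs at two consecutive
scales. -/
theorem sum_dyadicBump (m : ℕ) (s : ℝ) :
    ∑ n ∈ Finset.Ico (-m : ℤ) m, dyadicBump ((2 : ℝ) ^ (-n) * s)
      = lowPass ((2 : ℝ) ^ (1 - m : ℤ) * s) - lowPass ((2 : ℝ) ^ (m + 1 : ℤ) * s) := by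
  have e : ∀ n : ℤ, dyadicBump ((2 : ℝ) ^ (-n) * s)
      = lowPass ((2 : ℝ) ^ (-n) * s) - lowPass ((2 : ℝ) ^ (-(n - 1)) * s) := by
    intro n
    rw [dyadicBump, show -(n - 1) = 1 + -n by ring, zpow_one_add₀ two_ne_zero, mul_assoc]
  simp only [e]
  rw [sum_Ico_neg_sub (fun n => lowPass ((2 : ℝ) ^ (-n) * s))]
  congr 4 <;> ring_nf

theorem abs_sum_dyadicBump_le (m : ℕ) (s : ℝ) :
    |∑ n ∈ Finset.Ico (-m : ℤ) m, dyadicBump ((2 : ℝ) ^ (-n) * s)| ≤ 1 := by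
  rw [sum_dyadicBump]
  have h0 : ∀ τ, 0 ≤ lowPass τ := fun τ => Real.smoothTransition.nonneg _
  have h1 : ∀ τ, lowPass τ ≤ 1 := fun τ => Real.smoothTransition.le_one _
  rw [abs_le]
  constructor
  · linarith [h0 ((2 : ℝ) ^ (1 - m : ℤ) * s), h1 ((2 : ℝ) ^ (m + 1 : ℤ) * s)]
  · linarith [h1 ((2 : ℝ) ^ (1 - m : ℤ) * s), h0 ((2 : ℝ) ^ (m + 1 : ℤ) * s)]

theorem tendsto_sum_dyadicBump {s : ℝ} (hs : 0 < s) :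
    Tendsto (fun m : ℕ => ∑ n ∈ Finset.Ico (-m : ℤ) m, dyadicBump ((2 : ℝ) ^ (-n) * s))
      atTop (𝓝 1) := by
  have hT : Tendsto (fun m : ℕ => (2 : ℝ) ^ m) atTop atTop :=
    tendsto_pow_atTop_atTop_of_one_lt one_lt_two
  refine tendsto_const_nhds.congr' ?_
  filter_upwards [hT.eventually_ge_atTop (2 * s), hT.eventually_ge_atTop (1 / s)] with m h1 h2
  rw [sum_dyadicBump, lowPass_of_le_one, lowPass_of_two_le, sub_zero]
  · rw [zpow_add_one₀ two_ne_zero, zpow_natCast]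
    rw [div_le_iff₀ hs] at h2
    linarith
  · rw [zpow_sub₀ two_ne_zero, zpow_one, zpow_natCast, div_mul_eq_mul_div,
      div_le_one (by positivity)]
    exact h1

end DyadicSums

theorem summable_inv_natAbs_add_one_sq : Summable fun j : ℤ => ((j.natAbs + 1 : ℝ) ^ 2)⁻¹ := by
  have h : Summable fun n : ℕ => (((n : ℝ) + 1) ^ 2)⁻¹ := by
    have := (summable_nat_add_iff 1).2 (Real.summable_nat_pow_inv.2 one_lt_two)
    simpa using this
  refine Summable.of_nat_of_neg ?_ ?_
  · simpa using h
  · simpa using h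

theorem summable_of_norm_mul_natAbs_le {c : ℤ → ℝ} {C : ℝ} {N : ℕ}
    (h : ∀ n, ‖c n‖ * (n.natAbs + 1 : ℝ) ^ (N + 2) ≤ C) : Summable c := by
  refine Summable.of_norm_bounded (summable_inv_natAbs_add_one_sq.mul_left C) fun n => ?_
  have h1 : (1 : ℝ) ≤ n.natAbs + 1 := by linarith [(Nat.cast_nonneg n.natAbs : (0 : ℝ) ≤ _)]
  rw [← div_eq_mul_inv, le_div_iff₀ (by positivity)]
  exact (mul_le_mul_of_nonneg_left (pow_le_pow_right₀ h1 (by omega)) (norm_nonneg _)).trans (h n)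

/-! ### Dyadic pieces of the symbol as series of heat operators. -/

section DyadicPieces

/-- The function `λ^L p(λ) δ(tλ) e^{2tλ}` on `(0, ∞)`, extended by `0`. -/
def dyadicPiece (p : ℝ → ℂ) (t : ℝ) (L : ℕ) : ℝ → ℂ := (Ioi 0).indicator fun s =>
  ((s ^ L * dyadicBump (t * s) * Real.exp (2 * (t * s)) : ℝ) : ℂ) * p s

theorem dyadicPiece_of_pos (p : ℝ → ℂ) (t : ℝ) (L : ℕ) {s : ℝ} (hs : 0 < s) : dyadicPiece p t L s
    = ((s ^ L * dyadicBump (t * s) * Real.exp (2 * (t * s)) : ℝ) : ℂ) * p s :=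
  indicator_of_mem (show s ∈ Ioi 0 from hs) _

theorem dyadicPiece_of_nonpos (p : ℝ → ℂ) (t : ℝ) (L : ℕ) {s : ℝ} (hs : s ≤ 0) :
    dyadicPiece p t L s = 0 :=
  indicator_of_notMem (show s ∉ Ioi 0 from not_lt.2 hs) _

theorem dyadicPiece_succ (p : ℝ → ℂ) (t : ℝ) (L : ℕ) :
    dyadicPiece p t (L + 1) = fun s : ℝ => (s : ℂ) * dyadicPiece p t L s := by
  ext s
  rcases lt_or_ge 0 s with hs | hs
  · rw [dyadicPiece_of_pos _ _ _ hs, dyadicPiece_of_pos _ _ _ hs]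
    push_cast
    ring
  · rw [dyadicPiece_of_nonpos _ _ _ hs, dyadicPiece_of_nonpos _ _ _ hs, mul_zero]

variable {p : ℝ → ℂ} (hp : IsSymbolZero p)
include hp

/-- The function `p` on `(0, ∞)`, extended by zero. -/
theorem IsSymbolZero.bddMeas_indicator : BddMeas ((Ioi 0).indicator p) := by
  obtain ⟨C, hC0, hC⟩ := hp.2 0
  refine ⟨?_, C, fun s => ?_⟩
  · classical
    rw [← piecewise_eq_indicator]
    exact hp.1.continuousOn.measurable_piecewise continuousOn_const measurableSet_Ioi
  · by_cases hs : s ∈ Ioi (0 : ℝ)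
    · rw [indicator_of_mem hs]
      simpa using hC s hs
    · rw [indicator_of_notMem hs, norm_zero]
      exact hC0.le

theorem IsSymbolZero.bddMeas_dyadicPiece {t : ℝ} (ht : 0 < t) (L : ℕ) :
    BddMeas (dyadicPiece p t L) := by
  have e : dyadicPiece p t L = (fun s : ℝ =>
      ((s ^ L * dyadicBump (t * s) * Real.exp (2 * (t * s)) : ℝ) : ℂ)) * (Ioi 0).indicator p := by
    ext s
    rw [Pi.mul_apply, dyadicPiece]
    by_cases hs : s ∈ Ioi (0 : ℝ)
    · rw [indicator_of_mem hs, indicator_of_mem hs]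
    · rw [indicator_of_notMem hs, indicator_of_notMem hs, mul_zero]
  rw [e]
  refine BddMeas.mul ?_ hp.bddMeas_indicator
  have cb : Continuous dyadicBump := isDyadicBump_dyadicBump.1.continuous
  have hc : Continuous fun s : ℝ => s ^ L * dyadicBump (t * s) * Real.exp (2 * (t * s)) := by
    fun_prop
  have hsupp : HasCompactSupport fun s : ℝ => s ^ L * dyadicBump (t * s) * Real.exp (2 * (t * s)) := by
    refine HasCompactSupport.of_support_subset_isCompact (K := Icc (1 / 2 / t) (2 / t)) isCompact_Icc
      fun s hs => ?_
    obtain ⟨h1, h2⟩ := isDyadicBump_dyadicBump.2 _ (right_ne_zero_of_mul (left_ne_zero_of_mul hs))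
    exact ⟨by rw [div_le_iff₀ ht]; linarith, by rw [le_div_iff₀ ht]; linarith⟩
  obtain ⟨C, hC⟩ := hc.bounded_above_of_compact_support hsupp
  refine ⟨(Complex.continuous_ofReal.comp hc).measurable, C, fun s => ?_⟩
  rw [Complex.norm_real]
  exact hC s

/-- Multiplying the scalar Chebyshev series by `t^(-L) v` turns `(tλ)^L e^{3tλ}` into `λ^L e^{2tλ}`.
It converges uniformly in `λ` because `|v T_m(2v - 1)| ≤ 1`, so it may be integrated term by term.
-/
theorem IsSymbolZero.exists_chebHeat_series {H : Type*} [NormedAddCommGroup H]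
    [InnerProductSpace ℂ H] [CompleteSpace H] (P : SpectralMeasure H) (L N : ℕ) :
    ∃ C : ℝ, 0 < C ∧ ∀ t : ℝ, 0 < t →
      ∃ c : ℤ → ℂ, (∀ n, ‖c n‖ * (n.natAbs + 1 : ℝ) ^ (N + 2) ≤ C) ∧ HasSum
        (fun n => (((t ^ L)⁻¹ : ℝ) * c n) • P.integral (chebHeat t 1 n.natAbs))
        (P.integral (dyadicPiece p t L)) := by
  obtain ⟨C, hC0, hC⟩ := hp.exists_chebyshev_series isDyadicBump_dyadicBump L (N + 2)
  refine ⟨C, hC0, fun t ht => ?_⟩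
  obtain ⟨c, hc, hs⟩ := hC t ht
  refine ⟨c, hc, ?_⟩
  have b := fun n : ℤ => bddMeas_chebHeat ht.le 1 n.natAbs
  have hsum : Summable fun n : ℤ => (t ^ L)⁻¹ * ‖c n‖ := by
    refine Summable.mul_left _ (summable_of_norm_mul_natAbs_le (C := C) (N := N) fun n => ?_)
    rw [norm_norm]
    exact hc n
  have key := P.hasSum_integral (g := fun n => (((t ^ L)⁻¹ : ℝ) * c n) • chebHeat t 1 n.natAbs)
    (fun n => (b n).smul _) hsum (fun n s => by
      rw [Pi.smul_apply, norm_smul, norm_mul, Complex.norm_real, Real.norm_eq_abs,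
        abs_of_pos (by positivity)]
      exact mul_le_of_le_one_right (by positivity) (norm_chebHeat_le ht.le 1 _ s))
  have e : (fun s => ∑' n : ℤ, ((((t ^ L)⁻¹ : ℝ) * c n) • chebHeat t 1 n.natAbs) s)
      = dyadicPiece p t L := by
    ext s
    rcases lt_or_ge 0 s with hs0 | hs0
    · have h1 := (hs s hs0).mul_left (((t ^ L)⁻¹ : ℝ) * (Real.exp (-(t * s)) : ℂ))
      rw [dyadicPiece_of_pos _ _ _ hs0]
      refine ((h1.congr_fun fun n => ?_).tsum_eq).trans ?_
      · rw [Pi.smul_apply, chebHeat_of_pos _ _ _ hs0, smul_eq_mul, pow_one]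
        push_cast
        ring
      · rw [← mul_assoc]
        congr 1
        rw [show 3 * (t * s) = t * s + 2 * (t * s) by ring, Real.exp_add, Real.exp_neg]
        have := Real.exp_pos (t * s)
        norm_cast
        rw [mul_pow]
        field_simp
    · rw [dyadicPiece_of_nonpos _ _ _ hs0]
      simp [chebHeat_of_nonpos _ _ _ hs0]
  rw [e] at key
  exact key.congr_fun fun n => (P.integral_smul _ (b n)).symm

end DyadicPieces

/-! ### Pointwise bounds for the dyadic kernels. -/

section DyadicKernels

variable {X : Type*} [MetricSpace X] [MeasurableSpace X] {μ : Measure X}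

/-- The kernel of the dyadic piece `λ^L p(λ) δ(2^{-n}λ)` of the operator `p`. -/
def dyadicKernel (P : SpectralMeasure (Lp ℂ 2 μ)) (k : ℝ → X → X → ℝ) (p : ℝ → ℂ) (L : ℕ) (n : ℤ)
    (x y : X) : ℂ := sandwich μ k ((2 : ℝ) ^ (-n)) (P.integral (dyadicPiece p ((2 : ℝ) ^ (-n)) L)) x y

variable {P : SpectralMeasure (Lp ℂ 2 μ)} {k : ℝ → X → X → ℝ} {d γ c₁ c₂ : ℝ}
  (hk : IsRealHeatKernel P k d γ c₁ c₂) [BorelSpace X] {p : ℝ → ℂ} (hp : IsSymbolZero p)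

/-- The pairs of points where the kernels obey the expected identities and bounds. -/
def IsRegularPair (P : SpectralMeasure (Lp ℂ 2 μ)) (k : ℝ → X → X → ℝ) (d c₁ : ℝ) (x y : X) :
    Prop := ∀ n : ℤ,
  (∀ i : ℕ, 1 ≤ i → sandwich μ k ((2 : ℝ) ^ n) (P.integral (heatFn (i * (2 : ℝ) ^ n))) x y
    = k (i * (2 : ℝ) ^ n + (2 : ℝ) ^ n + (2 : ℝ) ^ n) x y) ∧
  ∀ T, ‖sandwich μ k ((2 : ℝ) ^ n) T x y‖ ≤ ‖T‖ * IsRealHeatKernel.height d c₁ (2 * (2 : ℝ) ^ n)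

include hk

/-- Only countably many times `2^n`, `i 2^n` occur, and the bound holds for all `T` off one null
set. -/
theorem IsRealHeatKernel.ae_isRegularPair : ∀ᵐ q ∂(μ.prod μ), IsRegularPair P k d c₁ q.1 q.2 := by
  have p2 : ∀ n : ℤ, (0 : ℝ) < 2 ^ n := fun n => by positivity
  simp only [IsRegularPair, eventually_and, ae_all_iff]
  intro n
  exact ⟨fun i hi => hk.sandwich_heat (by have := p2 n; positivity) (p2 n),
    hk.norm_sandwich_le (p2 n)⟩

include hp

/-- The symbol is complex, so the operator need not be self-adjoint; the bilinear symmetry is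
inherited from the heat operators through the series. -/
theorem IsRealHeatKernel.isBilinSymm_dyadicPiece (L : ℕ) {t : ℝ} (ht : 0 < t) :
    IsBilinSymm (P.integral (dyadicPiece p t L)) := by
  obtain ⟨C, hC0, hC⟩ := hp.exists_chebHeat_series P L 0
  obtain ⟨c, -, hc⟩ := hC t ht
  exact IsBilinSymm.hasSum (fun n => (hk.isBilinSymm_chebHeat ht _ 1 le_rfl).smul _) hc

/-- Dyadic kernels are concentrated near the diagonal, at the scale given by the heat kernel. -/
theorem IsRealHeatKernel.exists_norm_dyadicKernel_le (L N : ℕ) : ∃ C : ℝ, 0 < C ∧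
    ∀ (n : ℤ) (x y : X), IsRegularPair P k d c₁ x y → x ≠ y →
      ‖dyadicKernel P k p L n x y‖ ≤ C * (((2 : ℝ) ^ n) ^ (L + d / (d + 1))
        * (((2 : ℝ) ^ n * dist x y ^ (d + 1)) ^ N)⁻¹) := by
  -- The power `M` of `m` lost in the interpolation is fixed before the coefficients, which are then
  -- taken to decay like `|j|^(-M-2)`.
  obtain ⟨M, A, hA0, hA⟩ := exists_min_pow_mul_exp_le hk.γ_pos hk.c₂_pos N
  obtain ⟨C, hC0, hC⟩ := hp.exists_chebHeat_series P L M
  have hS : Summable fun j : ℤ => ((j.natAbs + 1 : ℝ) ^ 2)⁻¹ := summable_inv_natAbs_add_one_sq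
  have hd := hk.d_pos
  refine ⟨c₁ * A * C * (1 + ∑' j : ℤ, ((j.natAbs + 1 : ℝ) ^ 2)⁻¹), ?_, fun n x y hq hxy => ?_⟩
  · have := hk.c₁_pos
    have : 0 ≤ ∑' j : ℤ, ((j.natAbs + 1 : ℝ) ^ 2)⁻¹ := tsum_nonneg fun _ => by positivity
    positivity
  set t : ℝ := 2 ^ (-n) with ht'
  have ht : 0 < t := by positivity
  obtain ⟨c, hc, hs⟩ := hC t ht
  obtain ⟨h1, h2⟩ := hq (-n)
  set r := dist x y ^ (d + 1) / t with hr'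
  have hr : 0 < r := by
    have := dist_pos.2 hxy
    positivity
  have hh := hk.height_pos ht
  -- The minimum has two sources: the operator is a contraction between two heat operators, and its
  -- kernel is a combination of heat kernels up to time `(m + 3) t`.
  have hcheb : ∀ m : ℕ, ‖sandwich μ k t (P.integral (chebHeat t 1 m)) x y‖
      ≤ height d c₁ t * (A * (m + 1 : ℝ) ^ M * (r ^ N)⁻¹) := by
    intro m
    refine le_trans ?_ (mul_le_mul_of_nonneg_left (hA m r hr) hh.le)
    rw [mul_min_of_nonneg _ _ hh.le]
    refine le_min ?_ ?_
    · refine (h2 _).trans ?_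
      rw [mul_one]
      refine (mul_le_of_le_one_left (hk.height_pos (by positivity)).le
        (P.norm_integral_le (bddMeas_chebHeat ht.le 1 m).1 zero_le_one
          (norm_chebHeat_le ht.le 1 m))).trans ?_
      refine mul_le_mul_of_nonneg_left ?_ hk.c₁_pos.le
      exact Real.rpow_le_rpow_of_nonpos ht (by linarith) (by rw [neg_nonpos]; positivity)
    · refine (hk.norm_sandwich_chebHeat_le ht h1 m 1 le_rfl).trans (le_of_eq ?_)
      rw [show (((1 + m : ℕ) : ℝ) + 2) = m + 3 by push_cast; ring]
      ring
  have hsum := hs.mapL (sandwichCLM μ k t x y)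
  have hterm : ∀ j : ℤ, ‖sandwichCLM μ k t x y
      ((((t ^ L)⁻¹ : ℝ) * c j) • P.integral (chebHeat t 1 j.natAbs))‖
      ≤ (t ^ L)⁻¹ * height d c₁ t * A * C * (r ^ N)⁻¹ * ((j.natAbs + 1 : ℝ) ^ 2)⁻¹ := by
    intro j
    rw [map_smul, norm_smul, norm_mul, Complex.norm_real, Real.norm_eq_abs,
      abs_of_pos (by positivity)]
    have hj := hcheb j.natAbs
    have hcj := hc j
    set B : ℝ := j.natAbs + 1 with hB
    have hB0 : 0 < B := by positivity
    rw [pow_add] at hcj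
    have e : ‖c j‖ * B ^ M ≤ C * (B ^ 2)⁻¹ := by
      rw [← div_eq_mul_inv, le_div_iff₀ (by positivity)]
      linarith
    calc _ ≤ (t ^ L)⁻¹ * ‖c j‖ * (height d c₁ t * (A * B ^ M * (r ^ N)⁻¹)) :=
          mul_le_mul_of_nonneg_left hj (by positivity)
      _ = (t ^ L)⁻¹ * height d c₁ t * A * (r ^ N)⁻¹ * (‖c j‖ * B ^ M) := by ring
      _ ≤ (t ^ L)⁻¹ * height d c₁ t * A * (r ^ N)⁻¹ * (C * (B ^ 2)⁻¹) :=
          mul_le_mul_of_nonneg_left e (by positivity)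
      _ = _ := by ring
  have hfin := hsum.norm_le_of_bounded ((hS.mul_left _).hasSum) hterm
  have hval : ‖dyadicKernel P k p L n x y‖ = ‖sandwichCLM μ k t x y (P.integral (dyadicPiece p t L))‖ := rfl
  rw [hval]
  refine hfin.trans ?_
  rw [tsum_mul_left]
  have et : (t ^ L)⁻¹ * height d c₁ t = c₁ * ((2 : ℝ) ^ n) ^ (L + d / (d + 1)) := by
    have p2 : (0 : ℝ) < 2 ^ n := by positivity
    rw [height, ht', zpow_neg, Real.rpow_add p2, Real.rpow_natCast, inv_pow, inv_inv,
      Real.rpow_neg (by positivity), Real.inv_rpow p2.le, inv_inv]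
    ring
  have er : r = 2 ^ n * dist x y ^ (d + 1) := by
    rw [hr', ht', zpow_neg, div_inv_eq_mul, mul_comm]
  rw [et, er]
  have hR : 0 ≤ ((2 : ℝ) ^ n) ^ (L + d / (d + 1)) * (((2 : ℝ) ^ n * dist x y ^ (d + 1)) ^ N)⁻¹ := by
    positivity
  have hc1 := hk.c₁_pos
  have hT : 0 ≤ c₁ * A * C * (((2 : ℝ) ^ n) ^ (L + d / (d + 1))
    * (((2 : ℝ) ^ n * dist x y ^ (d + 1)) ^ N)⁻¹) := by positivity
  nlinarith

end DyadicKernels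

end

noncomputable section

/-! ### Dyadic kernels restricted to good pairs; their Laplacians and sums. -/

section RegularKernels

variable {X : Type*} [MeasurableSpace X] {μ : Measure X}

theorem Lp.coeFn_finset_sum {ι : Type*} (s : Finset ι) (f : ι → Lp ℂ 2 μ) :
    ⇑(∑ i ∈ s, f i) =ᵐ[μ] fun x => ∑ i ∈ s, f i x := by
  classical
  induction s using Finset.induction_on with
  | empty =>
    filter_upwards [Lp.coeFn_zero ℂ 2 μ] with x hx
    simpa using hx
  | insert a s ha ih =>
    rw [Finset.sum_insert ha]
    filter_upwards [Lp.coeFn_add (f a) (∑ i ∈ s, f i), ih] with x h1 h2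
    rw [h1, Pi.add_apply, h2, Finset.sum_insert ha]

theorem laplacianEq_of_ae {Δ : Lp ℂ 2 μ →ₗ.[ℂ] Lp ℂ 2 μ} {f g : X → ℂ} {v w : Lp ℂ 2 μ}
    (hf : f =ᵐ[μ] v) (hg : g =ᵐ[μ] w) (h : (v, w) ∈ Δ.graph) : LaplacianEq Δ f g := by
  have mf : MemLp f 2 μ := (memLp_congr_ae hf).2 (Lp.memLp v)
  have mg : MemLp g 2 μ := (memLp_congr_ae hg).2 (Lp.memLp w)
  have ef : mf.toLp f = v := Lp.ext (mf.coeFn_toLp.trans hf)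
  have eg : mg.toLp g = w := Lp.ext (mg.coeFn_toLp.trans hg)
  exact ⟨mf, mg, by rwa [ef, eg]⟩

theorem laplacianEq_zero (Δ : Lp ℂ 2 μ →ₗ.[ℂ] Lp ℂ 2 μ) :
    LaplacianEq Δ (fun _ => (0 : ℂ)) fun _ => (0 : ℂ) :=
  laplacianEq_of_ae (Lp.coeFn_zero ℂ 2 μ).symm (Lp.coeFn_zero ℂ 2 μ).symm Δ.graph.zero_mem

/-- A conull relation contains a conull measurable set whose sections are conull or empty. -/
theorem exists_measurableSet_sections [SFinite μ] {R : X → X → Prop}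
    (h : ∀ᵐ q ∂(μ.prod μ), R q.1 q.2) : ∃ G : Set (X × X), MeasurableSet G ∧
      (∀ q ∈ G, R q.1 q.2) ∧ (∀ᵐ q ∂(μ.prod μ), q ∈ G) ∧
      (∀ x, (∀ y, (x, y) ∉ G) ∨ ∀ᵐ y ∂μ, (x, y) ∈ G) ∧
      ∀ y, (∀ x, (x, y) ∉ G) ∨ ∀ᵐ x ∂μ, (x, y) ∈ G := by
  set M := toMeasurable (μ.prod μ) {q : X × X | ¬ R q.1 q.2} with hM
  have mM : MeasurableSet M := measurableSet_toMeasurable _ _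
  have hM0 : ∀ᵐ q ∂(μ.prod μ), q ∉ M := by
    rw [ae_iff]
    simpa [hM] using ae_iff.1 h
  have hR : ∀ q, q ∉ M → R q.1 q.2 := fun q hq => by
    by_contra h'
    exact hq (subset_toMeasurable _ _ h')
  have a1 : ∀ᵐ x ∂μ, ∀ᵐ y ∂μ, (x, y) ∉ M := Measure.ae_ae_of_ae_prod hM0
  have a2 : ∀ᵐ y ∂μ, ∀ᵐ x ∂μ, (x, y) ∉ M :=
    Measure.ae_ae_of_ae_prod (p := fun q : X × X => (q.2, q.1) ∉ M)
      ((Measure.measurePreserving_swap (μ := μ) (ν := μ)).quasiMeasurePreserving.ae hM0)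
  set N₁ := toMeasurable μ {x | ¬ ∀ᵐ y ∂μ, (x, y) ∉ M} with hN₁
  set N₂ := toMeasurable μ {y | ¬ ∀ᵐ x ∂μ, (x, y) ∉ M} with hN₂
  have b1 : ∀ᵐ x ∂μ, x ∉ N₁ := by
    rw [ae_iff]
    simpa [hN₁] using ae_iff.1 a1
  have b2 : ∀ᵐ x ∂μ, x ∉ N₂ := by
    rw [ae_iff]
    simpa [hN₂] using ae_iff.1 a2
  have c1 : ∀ x, x ∉ N₁ → ∀ᵐ y ∂μ, (x, y) ∉ M := fun x hx => by
    by_contra h'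
    exact hx (subset_toMeasurable _ _ h')
  have c2 : ∀ y, y ∉ N₂ → ∀ᵐ x ∂μ, (x, y) ∉ M := fun x hx => by
    by_contra h'
    exact hx (subset_toMeasurable _ _ h')
  -- The bad rows and columns are deleted entirely. A kernel cut off to this set then has, at every
  -- point, a section that is zero or agrees almost everywhere with the original one, as needed for
  -- smoothness in each variable at all points.
  refine ⟨Mᶜ ∩ (N₁ᶜ ×ˢ N₂ᶜ), mM.compl.inter ((measurableSet_toMeasurable _ _).compl.prod
    (measurableSet_toMeasurable _ _).compl), fun q hq => hR q hq.1, ?_, fun x => ?_, fun y => ?_⟩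
  · filter_upwards [hM0, Measure.quasiMeasurePreserving_fst.ae b1,
      Measure.quasiMeasurePreserving_snd.ae b2] with q h1 h2 h3 using ⟨h1, h2, h3⟩
  · by_cases hx : x ∈ N₁
    · exact Or.inl fun y hy => hy.2.1 hx
    · right
      filter_upwards [c1 x hx, b2] with y h1 h2 using ⟨h1, hx, h2⟩
  · by_cases hy : y ∈ N₂
    · exact Or.inl fun x hx => hx.2.2 hy
    · right
      filter_upwards [c2 y hy, b1] with x h1 h2 using ⟨h1, h2, hy⟩

variable {P : SpectralMeasure (Lp ℂ 2 μ)} {p : ℝ → ℂ}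

theorem integral_heat_dyadicPiece (hp : IsSymbolZero p) {t : ℝ} (ht : 0 < t) (L : ℕ)
    (v : Lp ℂ 2 μ) : P.integral (heatFn t) (P.integral (dyadicPiece p t L) v)
      = P.integral (heatFn t * dyadicPiece p t L) v := by
  rw [P.integral_mul (bddMeas_heatFn ht.le) (hp.bddMeas_dyadicPiece ht L), mul_apply_eq_comp]

/-- The Laplacian shifts the index of the dyadic pieces. -/
theorem mem_graph_dyadicPiece {Δ : Lp ℂ 2 μ →ₗ.[ℂ] Lp ℂ 2 μ}
    (hΔ : ∀ f, BddMeas f → BddMeas (fun s : ℝ => (s : ℂ) * f s) → ∀ v,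
      (P.integral f v, -P.integral (fun s : ℝ => (s : ℂ) * f s) v) ∈ Δ.graph)
    (hp : IsSymbolZero p) {t : ℝ} (ht : 0 < t) (L : ℕ) (v : Lp ℂ 2 μ) :
    (((-1) ^ L : ℂ) • P.integral (heatFn t) (P.integral (dyadicPiece p t L) v),
      ((-1) ^ (L + 1) : ℂ) • P.integral (heatFn t) (P.integral (dyadicPiece p t (L + 1)) v))
        ∈ Δ.graph := by
  have e : (fun s : ℝ => (s : ℂ) * (heatFn t * dyadicPiece p t L) s)
      = heatFn t * dyadicPiece p t (L + 1) := by
    rw [dyadicPiece_succ]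
    ext s
    simp only [Pi.mul_apply]
    ring
  have b := fun L => (bddMeas_heatFn ht.le).mul (hp.bddMeas_dyadicPiece ht L)
  have h := hΔ _ (b L) (by rw [e]; exact b (L + 1)) v
  rw [e, ← integral_heat_dyadicPiece hp ht, ← integral_heat_dyadicPiece hp ht] at h
  have h' := Δ.graph.smul_mem ((-1) ^ L : ℂ) h
  rw [Prod.smul_mk, smul_neg, ← neg_smul] at h'
  rwa [pow_succ, mul_neg_one]

variable [MetricSpace X]

/-- The signed dyadic kernel `Δ_x^l Δ_y^k K_n`, `l + k = L`, restricted to `G`. -/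
def regularKernel (P : SpectralMeasure (Lp ℂ 2 μ)) (k : ℝ → X → X → ℝ) (p : ℝ → ℂ)
    (G : Set (X × X)) (L : ℕ) (n : ℤ) : X × X → ℂ :=
  G.indicator fun q => (-1) ^ L * dyadicKernel P k p L n q.1 q.2

variable {k : ℝ → X → X → ℝ} {d γ c₁ c₂ : ℝ}
  (hk : IsRealHeatKernel P k d γ c₁ c₂) [BorelSpace X] (hp : IsSymbolZero p)
  {G : Set (X × X)}
include hk

namespace IsRealHeatKernel

/-- Both sides are continuous and nonempty open sets have positive measure, so what holds almost
everywhere holds everywhere. -/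
theorem isRegularPair_of_continuous
    (hc : ∀ t, 0 < t → Continuous fun q : X × X => k t q.1 q.2) (x y : X) :
    IsRegularPair P k d c₁ x y := by
  have := hk.doubling.sigmaFinite
  have := hk.doubling.isOpenPosMeasure
  have p2 : ∀ n : ℤ, (0 : ℝ) < 2 ^ n := fun n => by positivity
  intro n
  have cs := fun T => hk.continuous_sandwich (p2 n) (hc _ (p2 n)) T
  refine ⟨fun i hi => ?_, fun T => ?_⟩
  · have hi' : 0 < (i : ℝ) * 2 ^ n := by have := p2 n; positivity
    have h3 : 0 < (i : ℝ) * 2 ^ n + 2 ^ n + 2 ^ n := by have := p2 n; positivity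
    have c3 : Continuous fun q : X × X => ((k (i * 2 ^ n + 2 ^ n + 2 ^ n) q.1 q.2 : ℝ) : ℂ) :=
      Complex.continuous_ofReal.comp (hc _ h3)
    have h := Measure.eq_of_ae_eq (hk.sandwich_heat hi' (p2 n)) (cs _) c3
    have h' := congrFun h (x, y)
    dsimp only at h'
    exact h'
  · have hd := Measure.dense_of_ae ((hk.norm_sandwich_le (p2 n)).mono fun q hq => hq T)
    have hcl := isClosed_le (cs T).norm (continuous_const (y := ‖T‖ * height d c₁ (2 * 2 ^ n)))
    have h : (x, y) ∈ closure {q : X × X | ‖sandwich μ k (2 ^ n) T q.1 q.2‖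
      ≤ ‖T‖ * height d c₁ (2 * 2 ^ n)} := hd (x, y)
    rw [hcl.closure_eq] at h
    exact h

theorem measurable_regularKernel (hG : MeasurableSet G) (L : ℕ) (n : ℤ) :
    Measurable (regularKernel P k p G L n) :=
  (((hk.measurable_sandwich (by positivity) _)).const_mul _).indicator hG

theorem continuous_regularKernel (hc : ∀ t, 0 < t → Continuous fun q : X × X => k t q.1 q.2)
    (L : ℕ) (n : ℤ) : Continuous (regularKernel P k p univ L n) := by
  rw [regularKernel, indicator_univ]
  exact continuous_const.mul (hk.continuous_sandwich (by positivity) (hc _ (by positivity)) _)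

include hp

omit hp in
theorem regularKernel_ae_left {y : X} (hy : ∀ᵐ x ∂μ, (x, y) ∈ G) (L : ℕ) (n : ℤ) :
    (fun x => regularKernel P k p G L n (x, y)) =ᵐ[μ]
      ⇑(((-1) ^ L : ℂ) • P.integral (heatFn (2 ^ (-n))) (P.integral (dyadicPiece p (2 ^ (-n)) L)
        (sectionLp μ fun z => k (2 ^ (-n)) z y))) := by
  filter_upwards [hy, hk.sandwich_ae_left (t := 2 ^ (-n)) (by positivity)
    (P.integral (dyadicPiece p (2 ^ (-n)) L)) y, Lp.coeFn_smul ((-1) ^ L : ℂ)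
    (P.integral (heatFn (2 ^ (-n))) (P.integral (dyadicPiece p (2 ^ (-n)) L)
        (sectionLp μ fun z => k (2 ^ (-n)) z y)))] with x h1 h2 h3
  rw [h3, Pi.smul_apply, ← h2, regularKernel, indicator_of_mem h1]
  rfl

theorem regularKernel_ae_right {x : X} (hx : ∀ᵐ y ∂μ, (x, y) ∈ G) (L : ℕ) (n : ℤ) :
    (fun y => regularKernel P k p G L n (x, y)) =ᵐ[μ]
      ⇑(((-1) ^ L : ℂ) • P.integral (heatFn (2 ^ (-n))) (P.integral (dyadicPiece p (2 ^ (-n)) L)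
        (sectionLp μ (k (2 ^ (-n)) x)))) := by
  filter_upwards [hx, hk.sandwich_ae_right (t := 2 ^ (-n)) (by positivity)
    (hk.isBilinSymm_dyadicPiece hp L (t := 2 ^ (-n)) (by positivity)) x,
    Lp.coeFn_smul ((-1) ^ L : ℂ)
    (P.integral (heatFn (2 ^ (-n))) (P.integral (dyadicPiece p (2 ^ (-n)) L)
        (sectionLp μ (k (2 ^ (-n)) x))))] with y h1 h2 h3
  rw [h3, Pi.smul_apply, ← h2, regularKernel, indicator_of_mem h1]
  rfl

/-- A nonempty section is almost everywhere a heat operator composed with a dyadic piece, applied to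
a row or column of the heat kernel, so `mem_graph_dyadicPiece` applies; an empty section gives the
zero function. -/
theorem isSmoothWithLaplacians_sum {Δ : Lp ℂ 2 μ →ₗ.[ℂ] Lp ℂ 2 μ}
    (hΔ : ∀ f, BddMeas f → BddMeas (fun s : ℝ => (s : ℂ) * f s) → ∀ v,
      (P.integral f v, -P.integral (fun s : ℝ => (s : ℂ) * f s) v) ∈ Δ.graph)
    (hrow : ∀ x, (∀ y, (x, y) ∉ G) ∨ ∀ᵐ y ∂μ, (x, y) ∈ G)
    (hcol : ∀ y, (∀ x, (x, y) ∉ G) ∨ ∀ᵐ x ∂μ, (x, y) ∈ G) (I : Finset ℤ) :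
    IsSmoothWithLaplacians Δ fun l j x y => ∑ n ∈ I, regularKernel P k p G (l + j) n (x, y) := by
  intro l j
  refine ⟨fun y => ?_, fun x => ?_⟩
  · rcases hcol y with h | h
    · simpa only [regularKernel, indicator_of_notMem (h _), Finset.sum_const_zero]
        using laplacianEq_zero Δ
    · have e : ∀ L, (fun x => ∑ n ∈ I, regularKernel P k p G L n (x, y)) =ᵐ[μ]
          ⇑(∑ n ∈ I, (((-1) ^ L : ℂ) • P.integral (heatFn (2 ^ (-n)))
            (P.integral (dyadicPiece p (2 ^ (-n)) L) (sectionLp μ fun z => k (2 ^ (-n)) z y)))) := by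
        intro L
        refine EventuallyEq.trans ?_ (Lp.coeFn_finset_sum I _).symm
        have := (ae_ball_iff I.countable_toSet).2 fun n _ => hk.regularKernel_ae_left (p := p) h L n
        filter_upwards [this] with x hx
        exact Finset.sum_congr rfl hx
      refine laplacianEq_of_ae (e (l + j)) (e (l + 1 + j)) ?_
      rw [show l + 1 + j = l + j + 1 by ring]
      have := Δ.graph.sum_mem (t := I) fun n _ => mem_graph_dyadicPiece hΔ hp (t := 2 ^ (-n))
        (by positivity) (l + j) (sectionLp μ fun z => k (2 ^ (-n)) z y)
      rwa [← prod_mk_sum] at this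
  · rcases hrow x with h | h
    · simpa only [regularKernel, indicator_of_notMem (h _), Finset.sum_const_zero]
        using laplacianEq_zero Δ
    · have e : ∀ L, (fun y => ∑ n ∈ I, regularKernel P k p G L n (x, y)) =ᵐ[μ]
          ⇑(∑ n ∈ I, (((-1) ^ L : ℂ) • P.integral (heatFn (2 ^ (-n)))
            (P.integral (dyadicPiece p (2 ^ (-n)) L) (sectionLp μ (k (2 ^ (-n)) x))))) := by
        intro L
        refine EventuallyEq.trans ?_ (Lp.coeFn_finset_sum I _).symm
        have := (ae_ball_iff I.countable_toSet).2 fun n _ => hk.regularKernel_ae_right hp h L n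
        filter_upwards [this] with y hy
        exact Finset.sum_congr rfl hy
      refine laplacianEq_of_ae (e (l + j)) (e (l + (j + 1))) ?_
      rw [← add_assoc]
      have := Δ.graph.sum_mem (t := I) fun n _ => mem_graph_dyadicPiece hΔ hp (t := 2 ^ (-n))
        (by positivity) (l + j) (sectionLp μ (k (2 ^ (-n)) x))
      rwa [← prod_mk_sum] at this

/-- The dyadic estimate with `N = 0` controls low frequencies, and with `N = L + 1` high ones. The
latter is enough since `L + d/(d+1) < L + 1`. -/
theorem exists_norm_regularKernel_le (hG : ∀ q ∈ G, IsRegularPair P k d c₁ q.1 q.2) (L : ℕ) :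
    ∃ C : ℝ, 0 < C ∧ ∀ (n : ℤ) (q : X × X), q.1 ≠ q.2 → ‖regularKernel P k p G L n q‖
      ≤ C * (((2 : ℝ) ^ n) ^ (L + d / (d + 1))
        * min 1 (((2 : ℝ) ^ n * dist q.1 q.2 ^ (d + 1)) ^ (L + 1))⁻¹) := by
  obtain ⟨C₀, hC₀0, hC₀⟩ := hk.exists_norm_dyadicKernel_le hp L 0
  obtain ⟨C₁, hC₁0, hC₁⟩ := hk.exists_norm_dyadicKernel_le hp L (L + 1)
  refine ⟨max C₀ C₁, lt_max_of_lt_left hC₀0, fun n q hq => ?_⟩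
  by_cases hqG : q ∈ G
  · rw [regularKernel, indicator_of_mem hqG, norm_mul, norm_pow, norm_neg, norm_one, one_pow,
      one_mul]
    have h0 := hC₀ n _ _ (hG q hqG) hq
    have h1 := hC₁ n _ _ (hG q hqG) hq
    rw [pow_zero, inv_one] at h0
    rw [mul_min_of_nonneg _ _ (by positivity), mul_min_of_nonneg _ _ (by positivity)]
    exact le_min (h0.trans (mul_le_mul_of_nonneg_right (le_max_left _ _) (by positivity)))
      (h1.trans (mul_le_mul_of_nonneg_right (le_max_right _ _) (by positivity)))
  · rw [regularKernel, indicator_of_notMem hqG, norm_zero]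
    positivity

/-- Summability of the dyadic kernels away from the diagonal. -/
theorem exists_summable_regularKernel (hG : ∀ q ∈ G, IsRegularPair P k d c₁ q.1 q.2) (L : ℕ)
    {ε : ℝ} (hε : 0 < ε) : ∃ b : ℤ → ℝ, Summable b ∧ ∀ (n : ℤ) (q : X × X), ε ≤ dist q.1 q.2 →
      ‖regularKernel P k p G L n q‖ ≤ b n := by
  obtain ⟨C, hC0, hC⟩ := hk.exists_norm_regularKernel_le hp hG L
  have hd := hk.d_pos
  have ha : d / (d + 1) < 1 := by rw [div_lt_one (by linarith)]; linarith
  obtain ⟨_, hA⟩ := exists_tsum_dyadic_le (a := L + d / (d + 1)) (N := L + 1) (by positivity)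
    (by push_cast; linarith)
  refine ⟨_, (hA (ε ^ (d + 1)) (by positivity)).1.mul_left C, fun n q hq => ?_⟩
  have h0 : 0 < dist q.1 q.2 := hε.trans_le hq
  refine (hC n q (dist_pos.1 h0)).trans ?_
  have h1 : ε ^ (d + 1) ≤ dist q.1 q.2 ^ (d + 1) := Real.rpow_le_rpow hε.le hq (by linarith)
  have p2 : (0 : ℝ) < 2 ^ n := by positivity
  gcongr

/-- The dyadic sum at `r = R^(d+1)` has the exponent `-(d+1)(L + d/(d+1)) = -d - L(d+1)`. -/
theorem exists_norm_tsum_regularKernel_le (hG : ∀ q ∈ G, IsRegularPair P k d c₁ q.1 q.2) (L : ℕ) :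
    ∃ C : ℝ, ∀ q : X × X, q.1 ≠ q.2 → ‖∑' n : ℤ, regularKernel P k p G L n q‖
      ≤ C * dist q.1 q.2 ^ (-d - L * (d + 1)) := by
  obtain ⟨C, hC0, hC⟩ := hk.exists_norm_regularKernel_le hp hG L
  have hd := hk.d_pos
  have ha : d / (d + 1) < 1 := by rw [div_lt_one (by linarith)]; linarith
  obtain ⟨A, hA⟩ := exists_tsum_dyadic_le (a := L + d / (d + 1)) (N := L + 1) (by positivity)
    (by push_cast; linarith)
  refine ⟨C * A, fun q hq => ?_⟩
  have h0 : 0 < dist q.1 q.2 := dist_pos.2 hq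
  obtain ⟨s, hs⟩ := hA (dist q.1 q.2 ^ (d + 1)) (by positivity)
  refine (tsum_of_norm_bounded (s.mul_left C).hasSum fun n => hC n q hq).trans ?_
  rw [tsum_mul_left, mul_assoc]
  refine mul_le_mul_of_nonneg_left (hs.trans (le_of_eq ?_)) hC0.le
  rw [← Real.rpow_mul h0.le]
  congr 2
  field_simp
  ring

end IsRealHeatKernel

end RegularKernels

end

noncomputable section

/-! ### The sum of the dyadic kernels and the operator it represents. -/

section LimitKernel

variable {X : Type*} [MeasurableSpace X] {μ : Measure X}

/-- The operator `δ(2^{-n}λ) p(λ)` is the dyadic piece of `p` between two heat operators. -/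
theorem heatFn_mul_dyadicPiece_mul_heatFn (p : ℝ → ℂ) (t : ℝ) :
    heatFn t * dyadicPiece p t 0 * heatFn t
      = (fun s => (dyadicBump (t * s) : ℂ)) * (Ioi 0).indicator p := by
  ext s
  simp only [Pi.mul_apply]
  rcases lt_or_ge 0 s with hs | hs
  · rw [heatFn_of_pos _ hs, dyadicPiece_of_pos _ _ _ hs, indicator_of_mem (show s ∈ Ioi 0 from hs)]
    have e : Complex.exp (-((t : ℂ) * s)) * (Real.exp (2 * (t * s)) : ℂ)
        * Complex.exp (-((t : ℂ) * s)) = 1 := by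
      push_cast
      rw [← Complex.exp_add, ← Complex.exp_add, ← Complex.exp_zero]
      congr 1
      ring
    rw [pow_zero, one_mul, Complex.ofReal_mul]
    linear_combination (dyadicBump (t * s) : ℂ) * p s * e
  · rw [heatFn_of_nonpos _ hs, indicator_of_notMem (show s ∉ Ioi 0 from not_lt.2 hs)]
    simp

/-- The Littlewood-Paley decomposition of the operator with symbol `p`. -/
theorem IsSymbolZero.tendsto_sum_dyadicPiece (hp : IsSymbolZero p) (P : SpectralMeasure (Lp ℂ 2 μ))
    (u : Lp ℂ 2 μ) : Tendsto (fun m : ℕ => ∑ n ∈ Finset.Ico (-m : ℤ) m,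
      P.integral (heatFn (2 ^ (-n))) (P.integral (dyadicPiece p (2 ^ (-n)) 0)
        (P.integral (heatFn (2 ^ (-n))) u)))
      atTop (𝓝 (P.integral ((Ioi 0).indicator p) u)) := by
  have b : ∀ n : ℤ, BddMeas (heatFn (2 ^ (-n)) * dyadicPiece p (2 ^ (-n)) 0 * heatFn (2 ^ (-n))) := by
    intro n
    have h := bddMeas_heatFn (t := 2 ^ (-n)) (by positivity)
    exact (h.mul (hp.bddMeas_dyadicPiece (by positivity) 0)).mul h
  have e : ∀ n : ℤ, P.integral (heatFn (2 ^ (-n))) (P.integral (dyadicPiece p (2 ^ (-n)) 0)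
        (P.integral (heatFn (2 ^ (-n))) u))
      = P.integral (heatFn (2 ^ (-n)) * dyadicPiece p (2 ^ (-n)) 0 * heatFn (2 ^ (-n))) u := by
    intro n
    have h := bddMeas_heatFn (t := 2 ^ (-n)) (by positivity)
    have h' := hp.bddMeas_dyadicPiece (t := 2 ^ (-n)) (by positivity) 0
    rw [P.integral_mul (h.mul h') h, P.integral_mul h h']
    rfl
  simp only [e]
  have e2 : ∀ m : ℕ, ∑ n ∈ Finset.Ico (-m : ℤ) m,
      P.integral (heatFn (2 ^ (-n)) * dyadicPiece p (2 ^ (-n)) 0 * heatFn (2 ^ (-n))) u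
      = P.integral (∑ n ∈ Finset.Ico (-m : ℤ) m,
        heatFn (2 ^ (-n)) * dyadicPiece p (2 ^ (-n)) 0 * heatFn (2 ^ (-n))) u := by
    intro m
    rw [(P.integral_finset_sum b _).2, _root_.sum_apply]
  simp only [e2]
  obtain ⟨-, C, hC⟩ := hp.bddMeas_indicator
  have val : ∀ (m : ℕ) (s : ℝ), (∑ n ∈ Finset.Ico (-m : ℤ) m,
      heatFn (2 ^ (-n)) * dyadicPiece p (2 ^ (-n)) 0 * heatFn (2 ^ (-n))) s
      = ((∑ n ∈ Finset.Ico (-m : ℤ) m, dyadicBump (2 ^ (-n) * s) : ℝ) : ℂ)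
        * (Ioi 0).indicator p s := by
    intro m s
    rw [Finset.sum_apply, Complex.ofReal_sum, Finset.sum_mul]
    refine Finset.sum_congr rfl fun n _ => ?_
    rw [heatFn_mul_dyadicPiece_mul_heatFn]
    rfl
  refine P.tendsto_integral_apply (C := C) (fun m => (P.integral_finset_sum b _).1.1)
    (fun m s => ?_) (fun s => ?_) u
  · rw [val, norm_mul, Complex.norm_real]
    exact (mul_le_of_le_one_left (norm_nonneg _) (abs_sum_dyadicBump_le m s)).trans (hC s)
  · simp only [val]
    rcases lt_or_ge 0 s with hs | hs
    · have := ((Complex.continuous_ofReal.tendsto _).comp (tendsto_sum_dyadicBump hs)).mul_const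
        ((Ioi 0).indicator p s)
      simpa using this
    · rw [indicator_of_notMem (show s ∉ Ioi 0 from not_lt.2 hs)]
      simp

/-- The kernel `Δ_x^l Δ_y^k K`, `l + k = L`, as a sum of dyadic pieces off the diagonal of `G`. -/
def limitKernel (P : SpectralMeasure (Lp ℂ 2 μ)) (k : ℝ → X → X → ℝ) (p : ℝ → ℂ)
    (G : Set (X × X)) (L : ℕ) (q : X × X) : ℂ :=
  ∑' n : ℤ, regularKernel P k p (G ∩ {q | q.1 ≠ q.2}) L n q

theorem regularKernel_inter_of_ne (P : SpectralMeasure (Lp ℂ 2 μ)) (k : ℝ → X → X → ℝ) (p : ℝ → ℂ)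
    (G : Set (X × X)) (L : ℕ) (n : ℤ) {q : X × X} (hq : q.1 ≠ q.2) :
    regularKernel P k p (G ∩ {q | q.1 ≠ q.2}) L n q = regularKernel P k p G L n q := by
  by_cases h : q ∈ G
  · rw [regularKernel, regularKernel, indicator_of_mem h, indicator_of_mem (mem_inter h hq)]
  · rw [regularKernel, regularKernel, indicator_of_notMem h, indicator_of_notMem fun h' => h h'.1]

variable [MetricSpace X] {P : SpectralMeasure (Lp ℂ 2 μ)} {k : ℝ → X → X → ℝ} {d γ c₁ c₂ : ℝ}
  (hk : IsRealHeatKernel P k d γ c₁ c₂) [BorelSpace X] {p : ℝ → ℂ} (hp : IsSymbolZero p)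
  {G : Set (X × X)}

namespace IsRealHeatKernel

include hk hp

/-- The cutoff off the diagonal in `limitKernel` serves to make the series converge at every point,
so that the sum is a limit of measurable partial sums. -/
theorem summable_regularKernel (hG : ∀ q ∈ G, IsRegularPair P k d c₁ q.1 q.2) (L : ℕ)
    (q : X × X) : Summable fun n => regularKernel P k p (G ∩ {q | q.1 ≠ q.2}) L n q := by
  by_cases hq : q.1 = q.2
  · have : ∀ n, regularKernel P k p (G ∩ {q | q.1 ≠ q.2}) L n q = 0 := fun n =>
      indicator_of_notMem (fun h => h.2 hq) _
    simp only [this]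
    exact summable_zero
  · obtain ⟨b, hb, h⟩ := hk.exists_summable_regularKernel hp hG L (dist_pos.2 hq)
    refine Summable.of_norm_bounded hb fun n => ?_
    rw [regularKernel_inter_of_ne P k p G L n hq]
    exact h n q le_rfl

theorem measurable_limitKernel (mG : MeasurableSet G)
    (hG : ∀ q ∈ G, IsRegularPair P k d c₁ q.1 q.2) (L : ℕ) :
    Measurable (limitKernel P k p G L) := by
  have := hk.doubling.secondCountableTopology
  have mo : MeasurableSet {q : X × X | q.1 ≠ q.2} :=
    (isOpen_ne_fun continuous_fst continuous_snd).measurableSet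
  refine measurable_of_tendsto_metrizable' (atTop : Filter (Finset ℤ))
    (f := fun S q => ∑ n ∈ S, regularKernel P k p (G ∩ {q | q.1 ≠ q.2}) L n q)
    (fun S => Finset.measurable_fun_sum S fun n _ => hk.measurable_regularKernel (mG.inter mo) L n) ?_
  exact tendsto_pi_nhds.2 fun q => (hk.summable_regularKernel hp hG L q).hasSum

theorem tendstoUniformlyOn_limitKernel (hG : ∀ q ∈ G, IsRegularPair P k d c₁ q.1 q.2) (L : ℕ)
    {ε : ℝ} (hε : 0 < ε) : TendstoUniformlyOn
      (fun (m : ℕ) (q : X × X) => ∑ n ∈ Finset.Ico (-m : ℤ) m, regularKernel P k p G L n q)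
      (limitKernel P k p G L) atTop {q | ε ≤ dist q.1 q.2} := by
  obtain ⟨b, hb, h⟩ := hk.exists_summable_regularKernel hp hG L hε
  have h1 := tendstoUniformlyOn_tsum hb h
  have h2 : TendstoUniformlyOn
      (fun (m : ℕ) (q : X × X) => ∑ n ∈ Finset.Ico (-m : ℤ) m, regularKernel P k p G L n q)
      (fun q => ∑' n, regularKernel P k p G L n q) atTop {q | ε ≤ dist q.1 q.2} := fun u hu =>
    (Finset.tendsto_Ico_neg (R := ℤ)).eventually (h1 u hu)
  refine h2.congr_right fun q hq => ?_
  refine tsum_congr fun n => ?_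
  exact (regularKernel_inter_of_ne P k p G L n (dist_pos.1 (hε.trans_le hq))).symm

theorem continuousOn_limitKernel (hc : ∀ t, 0 < t → Continuous fun q : X × X => k t q.1 q.2)
    (L : ℕ) : ContinuousOn (limitKernel P k p univ L) {q : X × X | q.1 ≠ q.2} := by
  intro q hq
  have h0 : 0 < dist q.1 q.2 := dist_pos.2 hq
  have h1 := (hk.tendstoUniformlyOn_limitKernel hp
    (fun q _ => hk.isRegularPair_of_continuous hc q.1 q.2) L (half_pos h0)).continuousOn
    (Frequently.of_forall fun m => (continuous_finsetSum _ fun n _ =>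
      hk.continuous_regularKernel hc L n).continuousOn)
  refine (h1.continuousAt ?_).continuousWithinAt
  exact mem_of_superset ((isOpen_lt continuous_const continuous_dist).mem_nhds
    (show dist q.1 q.2 / 2 < dist q.1 q.2 by linarith)) (ofPred_subset_ofPred.2 fun q' hq' => le_of_lt hq')

/-- The partial Littlewood–Paley sums converge in `L²`, hence almost everywhere along a subsequence.
A point `x` outside the closed set `A` has a positive distance `ε` from it, and there the dyadic
kernels are dominated by a summable sequence. As `u` is integrable, its support having finite
measure, sum and integral can be exchanged. -/
theorem isOffDiagonalKernel (mG : MeasurableSet G)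
    (hG : ∀ q ∈ G, IsRegularPair P k d c₁ q.1 q.2) (aG : ∀ᵐ q ∂(μ.prod μ), q ∈ G) :
    IsOffDiagonalKernel (fun x y => limitKernel P k p G 0 (x, y))
      (P.integral ((Ioi 0).indicator p)) := by
  have := hk.doubling.sigmaFinite
  have mK := hk.measurable_limitKernel hp mG hG 0
  refine ⟨mK, fun u A hA hAb hu => ?_⟩
  set B : ℤ → Lp ℂ 2 μ := fun n => P.integral (heatFn (2 ^ (-n)))
    (P.integral (dyadicPiece p (2 ^ (-n)) 0) (P.integral (heatFn (2 ^ (-n))) u)) with hB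
  obtain ⟨ns, hns, hlim⟩ :=
    (tendstoInMeasure_of_tendsto_Lp (hp.tendsto_sum_dyadicPiece P u)).exists_seq_tendsto_ae
  have hsum : ∀ᵐ x ∂μ, ∀ m : ℕ, (∑ n ∈ Finset.Ico (-m : ℤ) m, B n) x
      = ∑ n ∈ Finset.Ico (-m : ℤ) m, B n x :=
    ae_all_iff.2 fun m => Lp.coeFn_finset_sum _ _
  have hker : ∀ᵐ x ∂μ, ∀ n, B n x = ∫ y, dyadicKernel P k p 0 n x y * u y ∂μ :=
    ae_all_iff.2 fun n => hk.sandwich_apply (by positivity)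
      (hk.isBilinSymm_dyadicPiece hp 0 (by positivity)) u
  filter_upwards [hlim, hsum, hker, Measure.ae_ae_of_ae_prod aG] with x h1 h2 h3 h4 hxA
  have hui : Integrable u μ := by
    obtain ⟨r, hr⟩ := hAb.subset_ball x
    have hfin : μ A < ⊤ := (measure_mono (hr.trans (Metric.ball_subset_ball (le_max_left r 1)))).trans_lt
      (hk.doubling.1 x (max r 1) (by positivity)).2
    have : IsFiniteMeasure (μ.restrict A) := ⟨by simpa using hfin⟩
    have hi : IntegrableOn u A μ := MemLp.integrable (q := 2) (by norm_num) ((Lp.memLp u).restrict A)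
    exact hi.integrable_of_ae_notMem_eq_zero hu
  obtain ⟨ε, hε, hball⟩ := Metric.isOpen_iff.1 hA.isOpen_compl x hxA
  have hfar : ∀ᵐ y ∂μ, u y = 0 ∨ ε ≤ dist x y := by
    filter_upwards [hu] with y hy
    by_cases hyA : y ∈ A
    · right
      by_contra! h
      exact hball (by rwa [Metric.mem_ball, dist_comm]) hyA
    · exact Or.inl (hy hyA)
  obtain ⟨b, hb, hbound⟩ := hk.exists_summable_regularKernel hp hG 0 hε
  set F : ℤ → X → ℂ := fun n y => regularKernel P k p G 0 n (x, y) * u y with hF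
  have bF : ∀ n, ∀ᵐ y ∂μ, ‖F n y‖ ≤ b n * ‖u y‖ := by
    intro n
    filter_upwards [hfar] with y hy
    rcases hy with hy | hy
    · simp [hF, hy]
    · rw [norm_mul]
      exact mul_le_mul_of_nonneg_right (hbound n (x, y) hy) (norm_nonneg _)
  have mu : AEStronglyMeasurable u μ := Lp.aestronglyMeasurable u
  have iF : ∀ n, Integrable (F n) μ := fun n =>
    (hui.norm.const_mul (b n)).mono' ((((hk.measurable_regularKernel mG 0 n).comp
      measurable_prodMk_left).aestronglyMeasurable).mul mu) (bF n)
  have sF : Summable fun n => ∫ y, ‖F n y‖ ∂μ := by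
    refine (hb.mul_right (∫ y, ‖u y‖ ∂μ)).of_nonneg_of_le
      (fun n => integral_nonneg fun _ => norm_nonneg _) fun n => ?_
    rw [← integral_const_mul]
    exact integral_mono_ae (iF n).norm (hui.norm.const_mul _) (bF n)
  have hK : ∀ᵐ y ∂μ, ∑' n, F n y = limitKernel P k p G 0 (x, y) * u y := by
    filter_upwards [hfar] with y hy
    rcases hy with hy | hy
    · simp [hF, hy]
    · rw [limitKernel, ← tsum_mul_right]
      refine tsum_congr fun n => ?_
      rw [regularKernel_inter_of_ne P k p G 0 n (dist_pos.1 (hε.trans_le hy))]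
  have hF_lim := hasSum_integral_of_summable_integral_norm iF sF
  rw [integral_congr_ae hK] at hF_lim
  refine ⟨?_, ?_⟩
  · refine (hui.norm.const_mul (∑' n, b n)).mono'
      (((mK.comp measurable_prodMk_left).aestronglyMeasurable).mul mu) ?_
    filter_upwards [hfar] with y hy
    rcases hy with hy | hy
    · simp [hy]
    · rw [norm_mul]
      refine mul_le_mul_of_nonneg_right ?_ (norm_nonneg _)
      refine tsum_of_norm_bounded hb.hasSum fun n => ?_
      rw [regularKernel_inter_of_ne P k p G 0 n (dist_pos.1 (hε.trans_le hy))]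
      exact hbound n (x, y) hy
  · have hBF : ∀ n, B n x = ∫ y, F n y ∂μ := by
      intro n
      rw [h3]
      refine integral_congr_ae ?_
      filter_upwards [h4] with y hy
      simp only [hF, regularKernel, indicator_of_mem hy, pow_zero, one_mul]
    have h5 : Tendsto (fun m : ℕ => (∑ n ∈ Finset.Ico (-m : ℤ) m, B n) x) atTop
        (𝓝 (∫ y, limitKernel P k p G 0 (x, y) * u y ∂μ)) := by
      simp only [h2, hBF]
      exact hF_lim.comp (Finset.tendsto_Ico_neg (R := ℤ))
    exact tendsto_nhds_unique h1 (h5.comp hns.tendsto_atTop)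

end IsRealHeatKernel

end LimitKernel

end

noncomputable section

/-! ### Reduction to the real heat kernel on the complement of the null space. -/

section Reduction

variable {X : Type*} [MeasurableSpace X] {μ : Measure X}

theorem isResolutionOf_spectralResolution {Δ : Lp ℂ 2 μ →ₗ.[ℂ] Lp ℂ 2 μ}
    (hΔ : IsNonposSelfAdjoint Δ) : (spectralResolution (-Δ)).IsResolutionOf (-Δ) :=
  Classical.epsilon_spec (exists_isResolutionOf (isNonnegSelfAdjointGraph_neg hΔ.1 hΔ.2))

theorem mem_graph_spectralResolution {Δ : Lp ℂ 2 μ →ₗ.[ℂ] Lp ℂ 2 μ} (hΔ : IsNonposSelfAdjoint Δ)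
    {f : ℝ → ℂ} (hf : BddMeas f) (hf' : BddMeas fun s : ℝ => (s : ℂ) * f s) (v : Lp ℂ 2 μ) :
    ((spectralResolution (-Δ)).integral f v,
      -(spectralResolution (-Δ)).integral (fun s : ℝ => (s : ℂ) * f s) v) ∈ Δ.graph :=
  (Δ.mem_graph_neg_iff _ _).1
    ((isResolutionOf_spectralResolution hΔ).mem_graph hΔ.1.dense_domain hf hf' v)

/-- Heat kernel bounds that tend to `0` as `t → ∞` exclude a null space. -/
theorem integral_indicator_zero_eq_zero (P : SpectralMeasure (Lp ℂ 2 μ)) {h : ℝ → X → X → ℂ}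
    {M : ℝ → ℝ} (hM : Tendsto M atTop (𝓝 0))
    (hker : ∀ t, 0 < t → IsIntegralKernel (h t)
      (P.integral ((Ici 0).indicator fun s => Complex.exp (-((t : ℂ) * (s : ℂ))))))
    (hb : ∀ t, 0 < t → ∀ x y, ‖h t x y‖ ≤ M t) :
    P.integral (({0} : Set ℝ).indicator 1) = 0 := by
  set f : ℝ → ℝ → ℂ := fun t => (Ici 0).indicator fun s => Complex.exp (-((t : ℂ) * (s : ℂ))) with hf
  have mf : ∀ t, Measurable (f t) := fun t => Measurable.indicator (by fun_prop) measurableSet_Ici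
  have bf : ∀ t, 0 ≤ t → ∀ s, ‖f t s‖ ≤ 1 := by
    intro t ht s
    by_cases hs : s ∈ Ici (0 : ℝ)
    · simp only [hf, indicator_of_mem hs]
      rw [norm_exp_neg_mul]
      exact Real.exp_le_one_iff.2 (by nlinarith [mul_nonneg ht (mem_Ici.1 hs)])
    · simp [hf, indicator_of_notMem hs]
  have lim : ∀ s, Tendsto (fun n : ℕ => f (n + 1 : ℕ) s) atTop
      (𝓝 (({0} : Set ℝ).indicator 1 s)) := by
    intro s
    rcases lt_trichotomy s 0 with hs | rfl | hs
    · have h1 : s ∉ Ici (0 : ℝ) := not_le.2 hs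
      have h2 : s ∉ ({0} : Set ℝ) := hs.ne
      simp [hf, indicator_of_notMem h1, indicator_of_notMem h2]
    · simp [hf]
    · have h1 : s ∈ Ici (0 : ℝ) := hs.le
      have h2 : s ∉ ({0} : Set ℝ) := hs.ne'
      simp only [hf, indicator_of_mem h1, indicator_of_notMem h2]
      rw [tendsto_zero_iff_norm_tendsto_zero]
      simp only [norm_exp_neg_mul]
      refine Real.tendsto_exp_neg_atTop_nhds_zero.comp ?_
      exact (tendsto_natCast_atTop_atTop.comp (tendsto_add_atTop_nat 1)).atTop_mul_const hs
  set Q := P.integral (({0} : Set ℝ).indicator 1) with hQ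
  -- The heat operators converge strongly to the projection `Q` as `t → ∞`, while for integrable `u`
  -- their quadratic forms are at most `M(t) ‖u‖₁²`, which tends to `0`.
  have hQu : ∀ u : Lp ℂ 2 μ, Integrable u μ → inner ℂ u (Q u) = 0 := by
    intro u hu
    have t1 := P.tendsto_integral_apply (fun n : ℕ => mf (n + 1 : ℕ))
      (fun n s => bf (n + 1 : ℕ) (by positivity) s) lim u
    have t2 : Tendsto (fun n : ℕ => inner ℂ u (P.integral (f (n + 1 : ℕ)) u)) atTop
        (𝓝 (inner ℂ u (Q u))) := tendsto_const_nhds.inner t1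
    have t3 : Tendsto (fun n : ℕ => M (n + 1 : ℕ) * (∫ y, ‖u y‖ ∂μ) ^ 2) atTop (𝓝 0) := by
      have := (hM.comp (tendsto_natCast_atTop_atTop.comp (tendsto_add_atTop_nat 1))).mul_const
        ((∫ y, ‖u y‖ ∂μ) ^ 2)
      simpa using this
    refine tendsto_nhds_unique t2 (squeeze_zero_norm (fun n => ?_) t3)
    have hpos : (0 : ℝ) < (n + 1 : ℕ) := by positivity
    rw [L2.inner_def]
    have e : M (n + 1 : ℕ) * (∫ y, ‖u y‖ ∂μ) ^ 2
        = ∫ x, (M (n + 1 : ℕ) * ∫ y, ‖u y‖ ∂μ) * ‖u x‖ ∂μ := by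
      rw [integral_const_mul]; ring
    rw [e]
    refine norm_integral_le_of_norm_le (hu.norm.const_mul _) ?_
    filter_upwards [(hker _ hpos).2 u] with x hx
    refine (norm_inner_le_norm _ _).trans ?_
    rw [mul_comm]
    refine mul_le_mul_of_nonneg_right ?_ (norm_nonneg _)
    rw [hx.2, ← integral_const_mul]
    refine norm_integral_le_of_norm_le (hu.norm.const_mul _) (Eventually.of_forall fun y => ?_)
    rw [norm_mul]
    exact mul_le_mul_of_nonneg_right (hb _ hpos x y) (norm_nonneg _)
  refine ext_inner_quadratic fun u => ?_
  have hc : Continuous fun u : Lp ℂ 2 μ => inner ℂ u (Q u) := continuous_id.inner Q.continuous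
  have := congrFun (hc.ext_on dense_integrable_L2 continuous_const hQu) u
  simpa using this

/-- The two versions of the heat operator differ by the projection onto the null space. This
projection vanishes under the first alternative, since the height `c₁ t^(-d/(d+1))` tends to `0`. -/
theorem exists_isRealHeatKernel [MetricSpace X] (hμ : IsDoubling μ) {Δ : Lp ℂ 2 μ →ₗ.[ℂ] Lp ℂ 2 μ} {d γ : ℝ}
    (hd : 0 < d) (hγ : 0 < γ) {h : ℂ → X → X → ℂ} (hh : IsHeatKernel Δ h)
    (hbound : HasSubGaussianBound d γ h) : ∃ c₁ c₂ : ℝ,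
      IsRealHeatKernel (spectralResolution (-Δ)) (fun t x y => (h t x y).re) d γ c₁ c₂ := by
  obtain ⟨c₁, c₂, hc₁, hc₂, hb⟩ := hbound
  obtain ⟨hker, him, -⟩ := hh
  have hre : ∀ t : ℝ, 0 < t → ∀ x y, (((h t x y).re : ℝ) : ℂ) = h t x y := fun t ht x y =>
    Complex.ext (by simp) (by simp [him t ht x y])
  set P := spectralResolution (-Δ) with hP
  have hred : ∀ t : ℝ, 0 < t → IsIntegralKernel (h t) (P.integral (heatFn t)) := by
    rcases hker with hker | hker
    · have hM : Tendsto (fun t : ℝ => c₁ * t ^ (-(d / (d + 1)))) atTop (𝓝 0) := by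
        have := (tendsto_rpow_neg_atTop (show 0 < d / (d + 1) by positivity)).const_mul c₁
        simpa using this
      have hQ := integral_indicator_zero_eq_zero P (h := fun t => h t) hM hker
        fun t ht x y => (hb t ht x y).trans (mul_le_of_le_one_right (by positivity)
          (Real.exp_le_one_iff.2 (by
            rw [neg_nonpos]
            have := hc₂
            positivity)))
      intro t ht
      have e : ((Ici 0).indicator fun s : ℝ => Complex.exp (-((t : ℂ) * (s : ℂ))))
          = heatFn t + ({0} : Set ℝ).indicator 1 := by
        ext s
        rw [Pi.add_apply]
        rcases lt_trichotomy s 0 with hs | rfl | hs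
        · simp [heatFn_of_nonpos t hs.le, hs.ne, hs.not_ge]
        · simp [heatFn_of_nonpos t le_rfl]
        · rw [heatFn_of_pos t hs]
          simp [hs.ne', hs.le]
      have h1 := hker t ht
      rw [heatOperator, e, P.integral_add (bddMeas_heatFn ht.le)
        (BddMeas.one.indicator (measurableSet_singleton 0)), hQ, add_zero] at h1
      exact h1
    · exact hker
  refine ⟨c₁, c₂, hμ, hd, hγ, hc₁, hc₂, fun t ht => Complex.measurable_re.comp (hred t ht).1,
    fun t ht u => ?_, fun t ht x y => (Complex.abs_re_le_norm _).trans (hb t ht x y)⟩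
  filter_upwards [(hred t ht).2 u] with x hx
  simp only [hre t ht]
  exact hx.2

end Reduction

end
-- Assembly of the kernel and its Laplacians.
theorem mainTheorem1 {X : Type*} [MetricSpace X] [MeasurableSpace X] [BorelSpace X]
    (μ : Measure X) (hμ : IsDoubling μ)
    (Δ : Lp ℂ 2 μ →ₗ.[ℂ] Lp ℂ 2 μ) (hΔ : IsNonposSelfAdjoint Δ)
    (d γ : ℝ) (hd : 0 < d) (hγ : 0 < γ)
    (h : ℂ → X → X → ℂ) (hh : IsHeatKernel Δ h) (hbound : HasSubGaussianBound d γ h)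
    (p : ℝ → ℂ) (hp : IsSymbolZero p) :
    ∃ (K : X → X → ℂ) (D : ℕ → ℕ → X → X → ℂ),
      IsOffDiagonalKernel K (spectralMultiplier Δ p) ∧
      IsSmoothOffDiagonal Δ K D ∧
      ((∀ t : ℝ, 0 < t → Continuous fun q : X × X => h t q.1 q.2) →
        ∀ l k : ℕ, ContinuousOn (fun q : X × X => D l k q.1 q.2) {q : X × X | q.1 ≠ q.2}) ∧
      (∃ C : ℝ, ∀ x y : X, x ≠ y → ‖K x y‖ ≤ C * dist x y ^ (-d)) ∧
      ∀ l k : ℕ, ∃ C : ℝ, ∀ x y : X, x ≠ y →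
        ‖D l k x y‖ ≤ C * dist x y ^ (-d - ((l : ℝ) + (k : ℝ)) * (d + 1)) := by
  have := hμ.sigmaFinite
  obtain ⟨c₁, c₂, hk⟩ := exists_isRealHeatKernel hμ hd hγ hh hbound
  set P := spectralResolution (-Δ) with hP
  set κ : ℝ → X → X → ℝ := fun t x y => (h t x y).re with hκ
  have hre : (∀ t : ℝ, 0 < t → Continuous fun q : X × X => h t q.1 q.2) →
      ∀ t : ℝ, 0 < t → Continuous fun q : X × X => κ t q.1 q.2 := fun hc t ht =>
    Complex.continuous_re.comp (hc t ht)
  -- No pair may be discarded when the heat kernel is continuous, since the cutoff would destroy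
  -- continuity; then all pairs are regular.
  obtain ⟨G, mG, hG, aG, hrow, hcol, hGc⟩ : ∃ G : Set (X × X), MeasurableSet G ∧
      (∀ q ∈ G, IsRegularPair P κ d c₁ q.1 q.2) ∧ (∀ᵐ q ∂(μ.prod μ), q ∈ G) ∧
      (∀ x, (∀ y, (x, y) ∉ G) ∨ ∀ᵐ y ∂μ, (x, y) ∈ G) ∧
      (∀ y, (∀ x, (x, y) ∉ G) ∨ ∀ᵐ x ∂μ, (x, y) ∈ G) ∧
      ((∀ t : ℝ, 0 < t → Continuous fun q : X × X => h t q.1 q.2) → G = univ) := by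
    by_cases hc : ∀ t : ℝ, 0 < t → Continuous fun q : X × X => h t q.1 q.2
    · exact ⟨univ, MeasurableSet.univ, fun q _ => hk.isRegularPair_of_continuous (hre hc) _ _,
        by simp, by simp, by simp, fun _ => rfl⟩
    · obtain ⟨G, h1, h2, h3, h4, h5⟩ := exists_measurableSet_sections hk.ae_isRegularPair
      exact ⟨G, h1, h2, h3, h4, h5, fun hc' => absurd hc' hc⟩
  have hG' : ∀ q ∈ G ∩ {q | q.1 ≠ q.2}, IsRegularPair P κ d c₁ q.1 q.2 := fun q hq => hG q hq.1
  -- The Laplacians in `x` and in `y` both multiply the symbol by `-λ`, so `D l k` depends only on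
  -- `l + k`.
  refine ⟨fun x y => limitKernel P κ p G 0 (x, y), fun l k x y => limitKernel P κ p G (l + k) (x, y),
    hk.isOffDiagonalKernel hp mG hG aG, ⟨fun _ _ _ => rfl,
      fun m l k x y => ∑ n ∈ Finset.Ico (-m : ℤ) m, regularKernel P κ p G (l + k) n (x, y),
      fun m => hk.isSmoothWithLaplacians_sum hp
        (fun f hf hf' v => mem_graph_spectralResolution hΔ hf hf' v) hrow hcol _,
      fun l k ε hε => hk.tendstoUniformlyOn_limitKernel hp hG (l + k) hε⟩, fun hc l k => ?_, ?_,
    fun l k => ?_⟩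
  · obtain rfl := hGc hc
    exact hk.continuousOn_limitKernel hp (hre hc) (l + k)
  · obtain ⟨C, hC⟩ := hk.exists_norm_tsum_regularKernel_le hp hG' 0
    refine ⟨C, fun x y hxy => ?_⟩
    simpa [limitKernel] using hC (x, y) hxy
  · obtain ⟨C, hC⟩ := hk.exists_norm_tsum_regularKernel_le hp hG' (l + k)
    refine ⟨C, fun x y hxy => ?_⟩
    simpa [limitKernel] using hC (x, y) hxy
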